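/- **Setting.** Fix the constant vorticity $a\in\mathbb R$. The laminar flow of depth $d>0$ has stream function $U(y)=-\tfrac a2y(y-d)+\tfrac yd$, surface velocity $\kappa=U'(d)=\tfrac1d-\tfrac{ad}2$ and Bernoulli constant $\mathcal R(d)=\tfrac12\bigl(\tfrac1{d^2}-a+\tfrac{a^2d^2}4\bigr)+d$. Let $d_c=d_c(a)$ be the minimum point of $\mathcal R$ on $(0,\infty)$ and $d_s=d_s(a)=\sqrt{2/|a|}$ for $a\ne0$ (for $a>0$, $\kappa=0$ exactly at $d=d_s$). Let $\gamma(y;\tau)=\sinh(\tau y)/\sinh(\tau d)$, $\gamma(y;0)=y/d$, and $\sigma(\tau)=\kappa^2\gamma'(d;\tau)+a\kappa-1$. For $d>d_c$ and $\kappa\neq0$ let $\tau_*$ be the unique positive root of $\sigma$, and $\Lambda_*=2\pi/\tau_*$. *Branch.* For such $a,d$, a Stokes branch is a family $(\psi,\eta,\lambda)(t)$, $t\ge0$ small, where $\psi$ is analytic in $(t,x,y)$ at the points $(0,x,y)$ with $0\le y\le d$, $\eta$ is analytic in $(t,x)$ at the points $(0,x)$, $\lambda$ is analytic at $0$; $\psi$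 and $\eta>0$ are even and $\Lambda_*$-periodic in $x$, and $$\lambda^2\psi_{xx}+\psi_{yy}+a=0\ (0<y<\eta),\quad \psi|_{y=0}=0,\quad \psi|_{y=\eta}=1,\quad \tfrac12(\psi_y^2+\lambda^2\psi_x^2)+\eta=\mathcal R(d)\ (y=\eta),$$ with $\psi=U-t\kappa\gamma(y;\tau_*)\cos\tau_*x+O(t^2)$, $\eta=d+t\cos\tau_*x+O(t^2)$, $\lambda=1+O(t^2)$. The eigenvalues $\mu$ of the Fréchet derivative at a point of the branch are those for which there is an even, $\Lambda_*$-periodic $v\not\equiv0$, $C^2$ up to the boundary, with $(\lambda^2\partial_x^2+\partial_y^2)v=0$ for $0<y<\eta$, $v|_{y=0}=0$ and $$\lambda^2\psi_xv_x+\psi_yv_y-\frac{1+\lambda^2\psi_{xy}\psi_x+\psi_{yy}\psi_y}{\psi_y}\,v=\frac{\mu}{\psi_y}\,v\quad(y=\eta).$$ *The number $\mu_2(a,d)$.* With $G=\gamma'(d;\tau_*)$, $G_2=\gamma'(d;2\tau_*)$, $A_1=-\frac a4-\frac{\kappa G}2$, $B_1=-\frac34\tau_*^2\kappa^2+\frac{a^2}4+\frac{a\kappa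 G}2+\frac{\kappa^2G^2}4$, $C_1=\frac12\tau_*^2\kappa^2$, let $(a_1,c_1)$ and $(b_1,d_1)$ solve $$\kappa a_1+dc_1+A_1=0,\quad(1-a\kappa)a_1+\kappa c_1+B_1+C_1=0;\qquad \kappa b_1+d_1+A_1=0,\quad(1-a\kappa)b_1+\kappa G_2d_1+B_1=0.$$ With $\Xi=-a-\kappa G$ put $$A_2=(a_1+\tfrac12b_1)\Xi+c_1+\tfrac12G_2d_1-\tfrac38\kappa\tau_*^2,$$ $$C_2=-(a_1+\tfrac12b_1)(a\Xi+\kappa^2\tau_*^2)+c_1\Xi+d_1(\kappa\tau_*^2+\tfrac12\Xi G_2)+\tfrac34a\kappa\tau_*^2+\tfrac58\kappa^2\tau_*^2G,$$ $$\lambda_2=\frac{\kappa C_2-(1-a\kappa)A_2}{\kappa^3(d\tau_*^2+G)-d\kappa(1-a\kappa)G},\qquad \mu_2(a,d)=-2\kappa^2\tau_*\lambda_2\Bigl(\tau_*d+\Bigl(1-\frac{(1-a\kappa)d}{\kappa^2}\Bigr)\coth\tau_*d\Bigr).$$ **Theorem.** 1. Let $d>d_c(a)$, $\kappa\ne0$.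 If along a Stokes branch $\mu(t)$ is, for small $t\ge0$, the second eigenvalue of the Fréchet derivative (exactly one eigenvalue is smaller), $\mu$ is analytic at $0$, and it has eigenfunctions $v(x,y;t)$ analytic in $(t,x,y)$ at the points $(0,x,y)$, $0\le y\le d$, then $\mu(t)=\mu_2(a,d)t^2+O(t^3)$ as $t\to0+$. 2. For each $a$, $\mu_2(a,d)=\dfrac{5(4-d_c^3)}{12d_c^4}(d-d_c)^{-1}+O(1)$ as $d\to d_c+$, and $\mu_2(a,d)\to+\infty$. 3. For each $a>0$, $d_c<d_s$, and as $d\to d_s$ (from either side) $\mu_2(a,d)=-\dfrac2{a^4}(d-d_s)^{-4}+O((d-d_s)^{-3})$; in particular $\mu_2(a,d)\to-\infty$. 4. The equation $q=2\tanh q$ has a unique positive root $q_1$, and $m=\dfrac{q_1^6-11q_1^4+28q_1^2-16}{8q_1^2}$ satisfies $|m-(-0.4067)|<5\cdot10^{-5}$, so $m<0$. For each $a\ne0$, $\mu_2(a,d)=ma^2d^{-1}+O(d^{-2})$ as $d\to\infty$. 5. For each $a\in\mathbb R$ there is $d_0>d_c(a)$, with $\kappa\neq0$ at $d=d_0$,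 such that $\mu_2(a,d_0)=0$; if $a>0$, $d_0$ can be taken in $(d_c,d_s)$. -/

import Mathlib

open Set Filter Topology Asymptotics

noncomputable section

namespace StokesWave

/-! ### The laminar flow of constant vorticity `a` and depth `d` -/

/-- The stream function `U` of the laminar flow: `U'' + a = 0`, `U(0) = 0`, `U(d) = 1`. -/
def laminar (a d y : ℝ) : ℝ := -(a / 2) * y * (y - d) + y / d

/-- The surface velocity `κ = U'(d) = 1/d - a d / 2`. -/
def kappa (a d : ℝ) : ℝ := deriv (laminar a d) d

/-- The Bernoulli constant `R = U'(d)^2 / 2 + d` of the laminar flow. -/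
def bernoulli (a d : ℝ) : ℝ := (1 / 2) * (1 / d ^ 2 - a + a ^ 2 * d ^ 2 / 4) + d

/-- The critical depth: the point of `(0, ∞)` at which `bernoulli a` is minimal. -/
def criticalDepth (a : ℝ) : ℝ := sInf {d : ℝ | 0 < d ∧ IsMinOn (bernoulli a) (Ioi 0) d}

/-- The depth `√(2 / |a|)` at which the laminar flow has a stagnation point
on the surface (if `a > 0`) or on the bottom (if `a < 0`). -/
def stagnationDepth (a : ℝ) : ℝ := Real.sqrt (2 / |a|)

/-- `γ(y; τ)`: the solution of `γ'' = τ² γ` with `γ(0) = 0`, `γ(d) = 1`. -/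
def gam (d τ y : ℝ) : ℝ :=
  if τ = 0 then y / d else Real.sinh (τ * y) / Real.sinh (τ * d)

/-- `γ'(d; τ)`. -/
def gamSlope (d τ : ℝ) : ℝ := deriv (gam d τ) d

/-- The dispersion function `σ(τ) = κ² γ'(d; τ) + a κ - 1`. -/
def disp (a d τ : ℝ) : ℝ := kappa a d ^ 2 * gamSlope d τ + a * kappa a d - 1

/-- The bifurcation frequency `τ_*`, the positive root of `σ`; see `tauStar_spec`. -/
def tauStar (a d : ℝ) : ℝ := sInf {τ : ℝ | 0 < τ ∧ disp a d τ = 0}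

/-- The period `2π / τ_*` in which bifurcation occurs. -/
def basePeriod (a d : ℝ) : ℝ := 2 * Real.pi / tauStar a d

/-! ### Stokes waves and the spectral problem

A stream function is written `ψ x y`; it is a function on the whole plane of which only the values
near the closed fluid domain `0 ≤ y ≤ η x` matter. -/

/-- `(ψ, η, lam)` is an even, `P`-periodic steady wave of constant vorticity `a` with Bernoulli
constant `R`, in the horizontal variable scaled by `lam`. -/
structure IsWave (a R P lam : ℝ) (ψ : ℝ → ℝ → ℝ) (η : ℝ → ℝ) : Prop where
  pos : ∀ x, 0 < η x
  even_surface : ∀ x, η (-x) = η x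
  periodic_surface : ∀ x, η (x + P) = η x
  even_stream : ∀ x y, ψ (-x) y = ψ x y
  periodic_stream : ∀ x y, ψ (x + P) y = ψ x y
  vorticity : ∀ x, ∀ y ∈ Ioo 0 (η x),
    lam ^ 2 * deriv (deriv fun s => ψ s y) x + deriv (deriv (ψ x)) y + a = 0
  bottom : ∀ x, ψ x 0 = 0
  surface : ∀ x, ψ x (η x) = 1
  dynamic : ∀ x,
    (1 / 2) * (deriv (ψ x) (η x) ^ 2 + lam ^ 2 * deriv (fun s => ψ s (η x)) x ^ 2) + η x = R

/-- `v` is an eigenfunction with eigenvalue `μ` of the Fréchet derivative at the wave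
`(ψ, η, lam)` of constant vorticity, acting on even `P`-periodic functions:
`(lam² ∂x² + ∂y²) v = 0` in the fluid, `v = 0` on the bottom and
`lam² ψ_x v_x + ψ_y v_y - (ρ / ψ_y) v = (μ / ψ_y) v` on the surface, where
`ρ = 1 + lam² ψ_xy ψ_x + ψ_yy ψ_y`. -/
structure IsEigenfunction (P lam : ℝ) (ψ : ℝ → ℝ → ℝ) (η : ℝ → ℝ) (μ : ℝ) (v : ℝ → ℝ → ℝ) :
    Prop where
  regular : ∀ x, ∀ y ∈ Icc 0 (η x), ContDiffAt ℝ 2 (fun p : ℝ × ℝ => v p.1 p.2) (x, y)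
  nonzero : ∃ x, ∃ y ∈ Icc 0 (η x), v x y ≠ 0
  even : ∀ x y, v (-x) y = v x y
  periodic : ∀ x y, v (x + P) y = v x y
  interior : ∀ x, ∀ y ∈ Ioo 0 (η x),
    lam ^ 2 * deriv (deriv fun s => v s y) x + deriv (deriv (v x)) y = 0
  bottom : ∀ x, v x 0 = 0
  surface : ∀ x,
    lam ^ 2 * deriv (fun s => ψ s (η x)) x * deriv (fun s => v s (η x)) x
        + deriv (ψ x) (η x) * deriv (v x) (η x)
        - (1 + lam ^ 2 * deriv (fun s => deriv (ψ s) (η x)) x * deriv (fun s => ψ s (η x)) x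
            + deriv (deriv (ψ x)) (η x) * deriv (ψ x) (η x)) / deriv (ψ x) (η x) * v x (η x)
      = μ / deriv (ψ x) (η x) * v x (η x)

/-- `μ` is an eigenvalue of the Fréchet derivative. -/
def IsEigenvalue (P lam : ℝ) (ψ : ℝ → ℝ → ℝ) (η : ℝ → ℝ) (μ : ℝ) : Prop :=
  ∃ v, IsEigenfunction P lam ψ η μ v

/-- `μ` is the second eigenvalue: exactly one eigenvalue is smaller. -/
def IsSecondEigenvalue (P lam : ℝ) (ψ : ℝ → ℝ → ℝ) (η : ℝ → ℝ) (μ : ℝ) : Prop :=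
  IsEigenvalue P lam ψ η μ ∧ ∃! ν, ν < μ ∧ IsEigenvalue P lam ψ η ν

/-- `(ψ t, η t, lam t)`, `t ≥ 0` small, is the analytic branch of Stokes waves that bifurcates
from the laminar flow of depth `d` at the frequency `τ_*`, with fixed Bernoulli constant. -/
structure IsStokesBranch (a d : ℝ) (ψ : ℝ → ℝ → ℝ → ℝ) (η : ℝ → ℝ → ℝ) (lam : ℝ → ℝ) :
    Prop where
  analytic_stream : ∀ x, ∀ y ∈ Icc 0 d,
    AnalyticAt ℝ (fun p : ℝ × ℝ × ℝ => ψ p.1 p.2.1 p.2.2) (0, x, y)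
  analytic_surface : ∀ x, AnalyticAt ℝ (fun p : ℝ × ℝ => η p.1 p.2) (0, x)
  analytic_lam : AnalyticAt ℝ lam 0
  wave : ∀ᶠ t in 𝓝[≥] (0 : ℝ), IsWave a (bernoulli a d) (basePeriod a d) (lam t) (ψ t) (η t)
  stream_zero : ∀ x, ∀ y ∈ Icc 0 d, ψ 0 x y = laminar a d y
  surface_zero : ∀ x, η 0 x = d
  lam_zero : lam 0 = 1
  stream_one : ∀ x, ∀ y ∈ Icc 0 d, deriv (fun t => ψ t x y) 0
    = -kappa a d * gam d (tauStar a d) y * Real.cos (tauStar a d * x)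
  surface_one : ∀ x, deriv (fun t => η t x) 0 = Real.cos (tauStar a d * x)
  lam_one : deriv lam 0 = 0

/-! ### The coefficient `μ₂(a, d)`

With `ζ = η - d` and `ψ` expanded in powers of `t`, the terms of order two are
`a₁ + b₁ cos 2τ_*x` and `c₁ y + d₁ γ(y; 2τ_*) cos 2τ_*x`, where
`κ a₁ + d c₁ + A₁ = 0`, `(1 - aκ) a₁ + κ c₁ + B₁ + C₁ = 0`,
`κ b₁ + d₁ + A₁ = 0`, `(1 - aκ) b₁ + κ γ'(d; 2τ_*) d₁ + B₁ = 0`. -/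

def coefA1 (a d : ℝ) : ℝ := -a / 4 - kappa a d * gamSlope d (tauStar a d) / 2

def coefB1 (a d : ℝ) : ℝ :=
  -3 / 4 * tauStar a d ^ 2 * kappa a d ^ 2 + a ^ 2 / 4
    + a * kappa a d * gamSlope d (tauStar a d) / 2
    + kappa a d ^ 2 * gamSlope d (tauStar a d) ^ 2 / 4

def coefC1 (a d : ℝ) : ℝ := tauStar a d ^ 2 * kappa a d ^ 2 / 2

def a1 (a d : ℝ) : ℝ :=
  (d * (coefB1 a d + coefC1 a d) - kappa a d * coefA1 a d) / (d * disp a d 0)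

def c1 (a d : ℝ) : ℝ :=
  ((1 - a * kappa a d) * coefA1 a d - kappa a d * (coefB1 a d + coefC1 a d)) / (d * disp a d 0)

def b1 (a d : ℝ) : ℝ :=
  (coefB1 a d - kappa a d * gamSlope d (2 * tauStar a d) * coefA1 a d) / disp a d (2 * tauStar a d)

def d1 (a d : ℝ) : ℝ :=
  ((1 - a * kappa a d) * coefA1 a d - kappa a d * coefB1 a d) / disp a d (2 * tauStar a d)

def xi (a d : ℝ) : ℝ := -a - kappa a d * gamSlope d (tauStar a d)

def coefA2 (a d : ℝ) : ℝ :=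
  (a1 a d + b1 a d / 2) * xi a d + c1 a d + gamSlope d (2 * tauStar a d) * d1 a d / 2
    - 3 / 8 * kappa a d * tauStar a d ^ 2

def coefC2 (a d : ℝ) : ℝ :=
  -(a1 a d + b1 a d / 2) * (a * xi a d + kappa a d ^ 2 * tauStar a d ^ 2) + c1 a d * xi a d
    + d1 a d * (kappa a d * tauStar a d ^ 2 + xi a d * gamSlope d (2 * tauStar a d) / 2)
    + 3 / 4 * a * kappa a d * tauStar a d ^ 2
    + 5 / 8 * kappa a d ^ 2 * tauStar a d ^ 2 * gamSlope d (tauStar a d)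

/-- The coefficient in `lam t = 1 + λ₂ t² + O(t³)`. -/
def lambda2 (a d : ℝ) : ℝ :=
  (kappa a d * coefC2 a d - (1 - a * kappa a d) * coefA2 a d) /
    (kappa a d ^ 3 * (d * tauStar a d ^ 2 + gamSlope d (tauStar a d))
      - d * kappa a d * (1 - a * kappa a d) * gamSlope d (tauStar a d))

/-- The coefficient in the expansion `μ(t) = μ₂ t² + O(t³)` of the second eigenvalue. -/
def mu2 (a d : ℝ) : ℝ :=
  -2 * kappa a d ^ 2 * tauStar a d * lambda2 a d *
    (tauStar a d * d + (1 - (1 - a * kappa a d) * d / kappa a d ^ 2) *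
      (Real.cosh (tauStar a d * d) / Real.sinh (tauStar a d * d)))

/-! ### The critical depth and the bifurcation frequency are well defined -/

lemma kappa_eq (a d : ℝ) : kappa a d = 1 / d - a * d / 2 := by
  have h : HasDerivAt (laminar a d)
      ((-(a / 2) * 1) * (d - d) + (-(a / 2) * d) * 1 + 1 / d) d := by
    unfold laminar
    exact (((hasDerivAt_id d).const_mul (-(a / 2))).mul ((hasDerivAt_id d).sub_const d)).add
      ((hasDerivAt_id d).div_const d)
  rw [kappa, h.deriv]
  ring

lemma gamSlope_eq {d τ : ℝ} (hτ : τ ≠ 0) :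
    gamSlope d τ = τ * Real.cosh (τ * d) / Real.sinh (τ * d) := by
  have h : HasDerivAt (gam d τ) (Real.cosh (τ * d) * (τ * 1) / Real.sinh (τ * d)) d := by
    have e : gam d τ = fun y => Real.sinh (τ * y) / Real.sinh (τ * d) := by
      funext y; simp [gam, hτ]
    rw [e]
    exact (((hasDerivAt_id d).const_mul τ).sinh).div_const _
  rw [gamSlope, h.deriv]
  ring

lemma gamSlope_zero (d : ℝ) : gamSlope d 0 = 1 / d := by
  have e : gam d 0 = fun y => y / d := by funext y; simp [gam]
  rw [gamSlope, e]
  exact ((hasDerivAt_id d).div_const d).deriv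

lemma exists_depth (a : ℝ) : ∃ c : ℝ, 0 < c ∧ a ^ 2 * c ^ 4 / 4 + c ^ 3 = 1 := by
  have hc : ContinuousOn (fun c : ℝ => a ^ 2 * c ^ 4 / 4 + c ^ 3) (Icc 0 1) := by fun_prop
  obtain ⟨c, hc1, hc2⟩ := intermediate_value_Icc (zero_le_one) hc
    (show (1 : ℝ) ∈ Icc _ _ by constructor <;> norm_num; positivity)
  refine ⟨c, lt_of_le_of_ne hc1.1 ?_, hc2⟩
  rintro rfl
  norm_num at hc2

lemma bernoulli_sub {a c d : ℝ} (hc : 0 < c) (hd : 0 < d) (h : a ^ 2 * c ^ 4 / 4 + c ^ 3 = 1) :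
    bernoulli a d - bernoulli a c
      = (d - c) ^ 2 * ((2 * d + c) / (2 * c ^ 3 * d ^ 2) + a ^ 2 / 8) := by
  have e : bernoulli a d - bernoulli a c
      - (d - c) ^ 2 * ((2 * d + c) / (2 * c ^ 3 * d ^ 2) + a ^ 2 / 8)
      = (d - c) * ((a ^ 2 * c ^ 4 / 4 + c ^ 3) - 1) / c ^ 3 := by
    unfold bernoulli
    field_simp
    ring
  rw [h] at e
  simp at e
  linarith

/-- The critical depth is the unique minimum point of `bernoulli a` on `(0, ∞)`. -/
lemma criticalDepth_spec (a : ℝ) :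
    0 < criticalDepth a ∧
      a ^ 2 * criticalDepth a ^ 4 / 4 + criticalDepth a ^ 3 = 1 ∧
      ∀ d : ℝ, (0 < d ∧ IsMinOn (bernoulli a) (Ioi 0) d) ↔ d = criticalDepth a := by
  obtain ⟨c, hc, h⟩ := exists_depth a
  have key : ∀ d : ℝ, (0 < d ∧ IsMinOn (bernoulli a) (Ioi 0) d) ↔ d = c := by
    intro d
    constructor
    · rintro ⟨hd, hm⟩
      have h1 : bernoulli a d ≤ bernoulli a c := hm (show c ∈ Ioi (0 : ℝ) from hc)
      have h2 := bernoulli_sub hc hd h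
      have h3 : 0 < (2 * d + c) / (2 * c ^ 3 * d ^ 2) + a ^ 2 / 8 := by positivity
      by_contra hne
      have h4 : 0 < (d - c) ^ 2 := by
        have : d - c ≠ 0 := sub_ne_zero.mpr hne
        positivity
      have := mul_pos h4 h3
      linarith
    · rintro rfl
      refine ⟨hc, fun e he => ?_⟩
      have he' : 0 < e := he
      have h2 := bernoulli_sub hc he' h
      have h3 : 0 ≤ (e - d) ^ 2 * ((2 * e + d) / (2 * d ^ 3 * e ^ 2) + a ^ 2 / 8) := by positivity
      show bernoulli a d ≤ bernoulli a e
      linarith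
  have hs : {d : ℝ | 0 < d ∧ IsMinOn (bernoulli a) (Ioi 0) d} = {c} := by
    ext d; simpa using key d
  have hcd : criticalDepth a = c := by rw [criticalDepth, hs, csInf_singleton]
  rw [hcd]
  exact ⟨hc, h, key⟩

lemma disp_zero_neg {a d : ℝ} (hd : criticalDepth a < d) : disp a d 0 < 0 := by
  obtain ⟨hc, h, -⟩ := criticalDepth_spec a
  set c := criticalDepth a
  have hd0 : 0 < d := hc.trans hd
  have h1 : 1 < a ^ 2 * d ^ 4 / 4 + d ^ 3 := by
    have h3 : c ^ 3 < d ^ 3 := by gcongr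
    have h4 : c ^ 4 ≤ d ^ 4 := by gcongr
    nlinarith [sq_nonneg a]
  have e : disp a d 0 = (1 - (a ^ 2 * d ^ 4 / 4 + d ^ 3)) / d ^ 3 := by
    rw [disp, gamSlope_zero, kappa_eq]
    field_simp
    ring
  rw [e]
  exact div_neg_of_neg_of_pos (by linarith) (by positivity)

lemma gamSlope_strictMonoOn {d : ℝ} (hd : 0 < d) : StrictMonoOn (gamSlope d) (Ioi 0) := by
  have hs : ∀ τ ∈ Ioi (0 : ℝ), Real.sinh (τ * d) ≠ 0 := fun τ hτ =>
    (Real.sinh_pos_iff.mpr (mul_pos hτ hd)).ne'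
  have hder : ∀ τ ∈ Ioi (0 : ℝ), HasDerivAt (fun τ => τ * Real.cosh (τ * d) / Real.sinh (τ * d))
      (((1 * Real.cosh (τ * d) + τ * (Real.sinh (τ * d) * (1 * d))) * Real.sinh (τ * d)
        - τ * Real.cosh (τ * d) * (Real.cosh (τ * d) * (1 * d))) / Real.sinh (τ * d) ^ 2) τ := by
    intro τ hτ
    have h1 := (hasDerivAt_id τ).mul_const d
    exact ((hasDerivAt_id τ).mul h1.cosh).div h1.sinh (hs τ hτ)
  have hm : StrictMonoOn (fun τ => τ * Real.cosh (τ * d) / Real.sinh (τ * d)) (Ioi 0) := by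
    refine strictMonoOn_of_deriv_pos (convex_Ioi 0)
      (fun τ hτ => (hder τ hτ).continuousAt.continuousWithinAt) ?_
    intro τ hτ
    rw [interior_Ioi] at hτ
    rw [(hder τ hτ).deriv]
    have hx : 0 < τ * d := mul_pos hτ hd
    have h1 := Real.self_lt_sinh_iff.mpr hx
    have h2 := Real.one_lt_cosh.mpr hx.ne'
    have h3 := Real.cosh_sq (τ * d)
    refine div_pos ?_ (by have := hs τ hτ; positivity)
    have e : (1 * Real.cosh (τ * d) + τ * (Real.sinh (τ * d) * (1 * d))) * Real.sinh (τ * d)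
        - τ * Real.cosh (τ * d) * (Real.cosh (τ * d) * (1 * d))
        = Real.cosh (τ * d) * Real.sinh (τ * d) - τ * d := by
      linear_combination (-τ * d) * h3
    rw [e]
    nlinarith
  exact hm.congr fun τ hτ => (gamSlope_eq (ne_of_gt hτ)).symm

/-- For a subcritical depth with `κ ≠ 0`, `tauStar a d` is the unique positive root of the
dispersion equation. -/
lemma tauStar_spec {a d : ℝ} (hd : criticalDepth a < d) (hk : kappa a d ≠ 0) :
    ∀ τ : ℝ, (0 < τ ∧ disp a d τ = 0) ↔ τ = tauStar a d := by
  have hd0 : 0 < d := (criticalDepth_spec a).1.trans hd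
  have hk2 : 0 < kappa a d ^ 2 := by positivity
  have hmono : StrictMonoOn (disp a d) (Ioi 0) := by
    intro x hx y hy hxy
    have := mul_lt_mul_of_pos_left (gamSlope_strictMonoOn hd0 hx hy hxy) hk2
    simp only [disp]
    linarith
  have hneg := disp_zero_neg hd
  rw [disp, gamSlope_zero] at hneg
  obtain ⟨τ₁, hτ₁, h₁⟩ : ∃ τ : ℝ, 0 < τ ∧ disp a d τ < 0 := by
    have hlim : Tendsto (fun τ : ℝ =>
        kappa a d ^ 2 * (Real.cosh (τ * d) / d) + a * kappa a d - 1) (𝓝[>] 0)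
        (𝓝 (kappa a d ^ 2 * (1 / d) + a * kappa a d - 1)) := by
      have hc : Continuous fun τ : ℝ =>
          kappa a d ^ 2 * (Real.cosh (τ * d) / d) + a * kappa a d - 1 := by fun_prop
      have := hc.tendsto 0
      simp only [zero_mul, Real.cosh_zero] at this
      exact this.mono_left nhdsWithin_le_nhds
    obtain ⟨τ, h1, h2⟩ := ((hlim.eventually_lt_const hneg).and self_mem_nhdsWithin).exists
    have h2' : 0 < τ := h2
    refine ⟨τ, h2', lt_of_le_of_lt ?_ h1⟩
    rw [disp, gamSlope_eq h2'.ne']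
    have hx : 0 < τ * d := mul_pos h2' hd0
    have h3 := Real.self_lt_sinh_iff.mpr hx
    have h4 := Real.cosh_pos (τ * d)
    have h5 : τ * Real.cosh (τ * d) / Real.sinh (τ * d) ≤ Real.cosh (τ * d) / d := by
      rw [div_le_div_iff₀ (hx.trans h3) hd0]
      nlinarith
    have := mul_le_mul_of_nonneg_left h5 hk2.le
    linarith
  obtain ⟨τ₂, hτ₂, h₂⟩ : ∃ τ : ℝ, 0 < τ ∧ 0 < disp a d τ := by
    refine ⟨(1 + |a * kappa a d - 1|) / kappa a d ^ 2, by positivity, ?_⟩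
    set τ := (1 + |a * kappa a d - 1|) / kappa a d ^ 2 with hτ
    have h2' : 0 < τ := by positivity
    have hx : 0 < τ * d := mul_pos h2' hd0
    have h3 : τ ≤ τ * Real.cosh (τ * d) / Real.sinh (τ * d) := by
      rw [le_div_iff₀ (Real.sinh_pos_iff.mpr hx)]
      have := (Real.sinh_lt_cosh (τ * d)).le
      gcongr
    have h4 : kappa a d ^ 2 * τ = 1 + |a * kappa a d - 1| := by
      rw [hτ]; field_simp
    rw [disp, gamSlope_eq h2'.ne']
    have := mul_le_mul_of_nonneg_left h3 hk2.le
    have := neg_abs_le (a * kappa a d - 1)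
    linarith
  have hcont : ContinuousOn (disp a d) (Ioi 0) := by
    have : ContinuousOn (fun τ => kappa a d ^ 2 * (τ * Real.cosh (τ * d) / Real.sinh (τ * d))
        + a * kappa a d - 1) (Ioi 0) := by
      have hq : ContinuousOn (fun τ => τ * Real.cosh (τ * d) / Real.sinh (τ * d)) (Ioi 0) :=
        ContinuousOn.div (by fun_prop) (by fun_prop)
          fun τ hτ => (Real.sinh_pos_iff.mpr (mul_pos hτ hd0)).ne'
      fun_prop
    refine this.congr fun τ hτ => ?_
    rw [disp, gamSlope_eq (ne_of_gt hτ)]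
  obtain ⟨τ₀, h0, hr⟩ := isPreconnected_Ioi.intermediate_value (show τ₁ ∈ Ioi (0 : ℝ) from hτ₁)
    (show τ₂ ∈ Ioi (0 : ℝ) from hτ₂) hcont (show (0 : ℝ) ∈ Icc _ _ from ⟨h₁.le, h₂.le⟩)
  have key : ∀ τ : ℝ, (0 < τ ∧ disp a d τ = 0) ↔ τ = τ₀ := by
    intro τ
    constructor
    · rintro ⟨h1, h2⟩
      exact hmono.injOn h1 h0 (h2.trans hr.symm)
    · rintro rfl
      exact ⟨h0, hr⟩
  have hs : {τ : ℝ | 0 < τ ∧ disp a d τ = 0} = {τ₀} := by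
    ext τ; simpa using key τ
  have : tauStar a d = τ₀ := by rw [tauStar, hs, csInf_singleton]
  rw [this]
  exact key

end StokesWave

end

open StokesWave

noncomputable section

namespace StokesWave

/-! ### A rational formula for `mu2` -/

/-! The theorem has two halves, which meet in the number `mu2 a d`.

Asymptotics and sign of `mu2`. Put `q = τ_* d`, `H = q coth q`, `w = q ^ 2`, `k = κ / d`. The
dispersion relation says `H = d (1 - a κ) / κ ^ 2`, so `H` is an explicit rational function of `d`,
and `q` is recovered through the inverse `qinv` of the increasing function `q coth q`. The
duplication formula for `coth` expresses `γ'(d; 2 τ_*)` by `H` and `w`, and the last factor of `mu2`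
cancels the denominator of `lambda2`. Hence `d * mu2 a d = phi a k H w` with `phi` rational
(`mu2_eq`). At the critical depth `H → 1` and `q → 0`, with `(H - 1) / w → 1 / 3`. At the stagnation
depth `k → 0` and `H` blows up like `k ^ (-2)`, while `H ^ 2 - w = (q / sinh q) ^ 2` stays bounded.
At infinite depth `k → -a / 2` and `H → 2`, so `q → q₁`. In each regime a suitable multiple of `mu2`
is a function differentiable at the limit point: its value there is the leading coefficient, and
differentiability gives the error term. Since `mu2 → +∞` at the critical depth, a zero exists as
soon as `mu2` is negative somewhere that can be reached without crossing `κ = 0`: at large depth for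
`a < 0`, at `d = 2` for `a = 0`, just before the stagnation depth for `a > 0`.

Expansion of the eigenvalue. The eigenfunction need not be expanded. The derivative `∂ₜψ` along the
branch solves the linearised problem with `μ = 0`, up to terms carrying the factor `λ'(t)`. Green's
identity between `∂ₜψ` and an eigenfunction `v` therefore gives an exact relation
(`GoodTime.eigenvalue_identity`): `μ ∫ v η_t / ψ_y` equals `λ λ'` times a surface term minus twice
the integral of `v ψ_xx` over the fluid. At `t = 0` the problem is diagonal in cosines with
eigenvalues `σ(n τ_*)`; the second one is `σ(τ_*) = 0`, so `v` has a nonzero first mode and the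
integral on the left has a nonzero limit. On the right both `λ'` and the bracket vanish at `t = 0`,
and `μ / t ^ 2` tends to `-λ''(0) κ ^ 2 (G + d τ_* ^ 2 - d G ^ 2)` (`tendsto_eigenvalue`).

It remains to find `λ''(0)`, which is fixed by solvability at third order. The surface conditions
are differentiated three times in `t` and the result is projected on `cos τ_* x`. In this projection
`ψ_tt` enters only through its modes `0` and `2`, which the second-order conditions determine
(`second_modes`); its undetermined first mode drops out. The outcome is exactly `mu2`
(`deriv_deriv_lam`), and analyticity of `μ` turns the limit of `μ / t ^ 2` into an error `O(t ^ 3)`.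
-/

/-- The function `q coth q`. -/
def qcoth (q : ℝ) : ℝ := q * Real.cosh q / Real.sinh q

/-- `mu2 a d = phi a (κ / d) (q coth q) (q ^ 2) / d` with `q = τ_* d`; see `mu2_eq`. -/
def phi (a k H w : ℝ) : ℝ :=
  let A := -a / 4 - k * H / 2
  let B := -3 / 4 * k ^ 2 * w + a ^ 2 / 4 + a * k * H / 2 + k ^ 2 * H ^ 2 / 4
  let C := k ^ 2 * w / 2
  (2 * ((B + C - k * A) / (k ^ 2 * (1 - H))) + (B - k * (H + w / H) * A) * H / (k ^ 2 * w))
      * (k ^ 2 * w - (a + k * H) ^ 2)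
    + 2 * ((k * H * A - (B + C)) / (k * (1 - H))) * (a + 2 * k * H)
    + (k * H * A - B) * H / (k * w) * ((H + w / H) * (a + 2 * k * H) - 2 * k * w)
    - k * w * (2 * k * H + 3 / 2 * a)

lemma self_lt_sinh_mul_cosh {q : ℝ} (hq : 0 < q) : q < Real.sinh q * Real.cosh q := by
  have h1 := Real.self_lt_sinh_iff.mpr hq
  have h2 := Real.one_lt_cosh.mpr hq.ne'
  nlinarith

/-- A form of `cosh ^ 2 = 1 + sinh ^ 2`. The left side is the factor shared by the denominator of
`lambda2` and the last factor of `mu2`; since `q < sinh q cosh q` it is positive and may be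
cancelled. -/
lemma qcoth_sub {q : ℝ} (hq : 0 < q) :
    q ^ 2 + qcoth q - qcoth q ^ 2
      = q * (Real.sinh q * Real.cosh q - q) / Real.sinh q ^ 2 := by
  have hs := (Real.sinh_pos_iff.mpr hq).ne'
  rw [qcoth]
  field_simp
  linear_combination (-q) * Real.cosh_sq q

lemma qcoth_gt_one {q : ℝ} (hq : 0 < q) : 1 < qcoth q := by
  have hs := Real.sinh_pos_iff.mpr hq
  rw [qcoth, lt_div_iff₀ hs, one_mul]
  have h1 : StrictMonoOn (fun x : ℝ => x * Real.cosh x - Real.sinh x) (Ici 0) := by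
    refine strictMonoOn_of_deriv_pos (convex_Ici 0) (by fun_prop) ?_
    intro x hx
    rw [interior_Ici] at hx
    have hx : 0 < x := hx
    have : HasDerivAt (fun x : ℝ => x * Real.cosh x - Real.sinh x)
        (1 * Real.cosh x + x * Real.sinh x - Real.cosh x) x :=
      ((hasDerivAt_id x).mul (Real.hasDerivAt_cosh x)).sub (Real.hasDerivAt_sinh x)
    rw [this.deriv]
    have := mul_pos hx (Real.sinh_pos_iff.mpr hx)
    linarith
  have := h1 self_mem_Ici (show q ∈ Ici 0 from hq.le) hq
  simpa using this

lemma gamSlope_eq_qcoth {d τ : ℝ} (hd : 0 < d) (hτ : 0 < τ) :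
    gamSlope d τ = qcoth (τ * d) / d := by
  rw [gamSlope_eq hτ.ne', qcoth]
  have hs := (Real.sinh_pos_iff.mpr (mul_pos hτ hd)).ne'
  field_simp

/-- This is `2 coth 2q = coth q + tanh q`. It keeps the second harmonic inside the field generated
by `q coth q` and `q ^ 2`. -/
lemma gamSlope_two_mul {d τ : ℝ} (hd : 0 < d) (hτ : 0 < τ) :
    gamSlope d (2 * τ) = (qcoth (τ * d) + (τ * d) ^ 2 / qcoth (τ * d)) / d := by
  have hs := (Real.sinh_pos_iff.mpr (mul_pos hτ hd)).ne'
  have hc := (Real.cosh_pos (τ * d)).ne'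
  rw [gamSlope_eq (by positivity), qcoth, mul_assoc 2 τ d, Real.sinh_two_mul, Real.cosh_two_mul]
  field_simp

lemma tauStar_pos {a d : ℝ} (hd : criticalDepth a < d) (hk : kappa a d ≠ 0) : 0 < tauStar a d :=
  ((tauStar_spec hd hk _).mpr rfl).1

lemma disp_tauStar {a d : ℝ} (hd : criticalDepth a < d) (hk : kappa a d ≠ 0) :
    disp a d (tauStar a d) = 0 :=
  ((tauStar_spec hd hk _).mpr rfl).2

lemma pos_of_criticalDepth_lt {a d : ℝ} (hd : criticalDepth a < d) : 0 < d :=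
  (criticalDepth_spec a).1.trans hd

lemma one_sub_mul_kappa {a d : ℝ} (hd : criticalDepth a < d) (hk : kappa a d ≠ 0) :
    1 - a * kappa a d = kappa a d ^ 2 * gamSlope d (tauStar a d) := by
  have := disp_tauStar hd hk
  rw [disp] at this
  linarith

/-- The dispersion relation solved for `q coth q`. The right side no longer contains `τ_*`, so the
only transcendental operation left is the inversion of `q coth q`. -/
lemma qcoth_tauStar {a d : ℝ} (hd : criticalDepth a < d) (hk : kappa a d ≠ 0) :
    qcoth (tauStar a d * d) = d * (1 - a * kappa a d) / kappa a d ^ 2 := by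
  have hd0 := pos_of_criticalDepth_lt hd
  have h1 := one_sub_mul_kappa hd hk
  rw [gamSlope_eq_qcoth hd0 (tauStar_pos hd hk)] at h1
  rw [h1]
  field_simp

/-- `mu2` in terms of `gamSlope`; the last factor of `mu2` cancels the denominator of `lambda2`. -/
lemma mu2_eq_coefs {a d : ℝ} (hd : criticalDepth a < d) (hk : kappa a d ≠ 0) :
    mu2 a d = 2 * (kappa a d * gamSlope d (tauStar a d) * coefA2 a d - coefC2 a d) := by
  have hd0 := pos_of_criticalDepth_lt hd
  have ht := tauStar_pos hd hk
  have hq := mul_pos ht hd0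
  have h1 := one_sub_mul_kappa hd hk
  have h2 := qcoth_sub hq
  have h3 : 0 < (tauStar a d * d) ^ 2 + qcoth (tauStar a d * d) - qcoth (tauStar a d * d) ^ 2 := by
    rw [h2]
    have := sub_pos.mpr (self_lt_sinh_mul_cosh hq)
    have := Real.sinh_pos_iff.mpr hq
    positivity
  have e : Real.cosh (tauStar a d * d) / Real.sinh (tauStar a d * d)
      = qcoth (tauStar a d * d) / (tauStar a d * d) := by
    rw [qcoth]
    have hs := (Real.sinh_pos_iff.mpr hq).ne'
    field_simp
  rw [mu2, lambda2, e, h1, gamSlope_eq_qcoth hd0 ht]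
  generalize qcoth (tauStar a d * d) = H at *
  generalize kappa a d = κ at *
  generalize tauStar a d = τ at *
  have h4 : κ ^ 3 * (d * τ ^ 2 + H / d) - d * κ * (κ ^ 2 * (H / d)) * (H / d)
      = κ ^ 3 / d * ((τ * d) ^ 2 + H - H ^ 2) := by
    field_simp
  have h5 : τ * d + (1 - κ ^ 2 * (H / d) * d / κ ^ 2) * (H / (τ * d))
      = ((τ * d) ^ 2 + H - H ^ 2) / (τ * d) := by
    field_simp
    ring
  rw [h4, h5]
  have := h3.ne'
  generalize (τ * d) ^ 2 + H - H ^ 2 = D at *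
  field_simp
  ring

lemma disp_zero_eq {a d : ℝ} (hd : criticalDepth a < d) (hk : kappa a d ≠ 0) :
    disp a d 0 = kappa a d ^ 2 * (1 - qcoth (tauStar a d * d)) / d := by
  have hd0 := pos_of_criticalDepth_lt hd
  have h1 := one_sub_mul_kappa hd hk
  rw [gamSlope_eq_qcoth hd0 (tauStar_pos hd hk)] at h1
  rw [disp, gamSlope_zero]
  linear_combination -h1

/-- Subtracting `σ(τ_*) = 0` leaves `κ ^ 2` times the difference of the two slopes, which the
duplication formula makes explicit. With `disp_zero_eq` this handles all denominators of the
second-order coefficients. -/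
lemma disp_two_mul_eq {a d : ℝ} (hd : criticalDepth a < d) (hk : kappa a d ≠ 0) :
    disp a d (2 * tauStar a d) = kappa a d ^ 2 * (tauStar a d * d) ^ 2
      / (d * qcoth (tauStar a d * d)) := by
  have hd0 := pos_of_criticalDepth_lt hd
  have ht := tauStar_pos hd hk
  have h1 := one_sub_mul_kappa hd hk
  have h2 := (zero_lt_one.trans (qcoth_gt_one (mul_pos ht hd0))).ne'
  rw [gamSlope_eq_qcoth hd0 ht] at h1
  rw [disp, gamSlope_two_mul hd0 ht]
  field_simp
  field_simp at h1
  linear_combination -qcoth (tauStar a d * d) * h1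

lemma mu2_eq {a d : ℝ} (hd : criticalDepth a < d) (hk : kappa a d ≠ 0) :
    mu2 a d
      = phi a (kappa a d / d) (qcoth (tauStar a d * d)) ((tauStar a d * d) ^ 2) / d := by
  have hd0 := pos_of_criticalDepth_lt hd
  have ht := tauStar_pos hd hk
  have h0 := qcoth_gt_one (mul_pos ht hd0)
  have h1 := one_sub_mul_kappa hd hk
  rw [gamSlope_eq_qcoth hd0 ht] at h1
  have hH : qcoth (tauStar a d * d) ≠ 0 := by positivity
  have hH1 : 1 - qcoth (tauStar a d * d) ≠ 0 := by linarith
  have hA : coefA1 a d = -a / 4 - kappa a d / d * qcoth (tauStar a d * d) / 2 := by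
    rw [coefA1, gamSlope_eq_qcoth hd0 ht]; ring
  have hB : coefB1 a d = -3 / 4 * (kappa a d / d) ^ 2 * (tauStar a d * d) ^ 2 + a ^ 2 / 4
      + a * (kappa a d / d) * qcoth (tauStar a d * d) / 2
      + (kappa a d / d) ^ 2 * qcoth (tauStar a d * d) ^ 2 / 4 := by
    rw [coefB1, gamSlope_eq_qcoth hd0 ht]; field_simp
  have hC : coefC1 a d = (kappa a d / d) ^ 2 * (tauStar a d * d) ^ 2 / 2 := by
    rw [coefC1]; field_simp
  rw [mu2_eq_coefs hd hk, coefA2, coefC2, xi, a1, b1, c1, d1, disp_zero_eq hd hk,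
    disp_two_mul_eq hd hk, phi, ← hA, ← hB, ← hC, h1, gamSlope_eq_qcoth hd0 ht,
    gamSlope_two_mul hd0 ht]
  generalize qcoth (tauStar a d * d) = H at *
  generalize kappa a d = κ at *
  generalize tauStar a d = τ at *
  generalize coefA1 a d = A at *
  generalize coefB1 a d = B at *
  generalize coefC1 a d = C at *
  have e1 : (d * (B + C) - κ * A) / (d * (κ ^ 2 * (1 - H) / d))
      = (B + C - κ / d * A) / ((κ / d) ^ 2 * (1 - H)) / d := by
    field_simp
  have e2 : (B - κ * ((H + (τ * d) ^ 2 / H) / d) * A) / (κ ^ 2 * (τ * d) ^ 2 / (d * H))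
      = (B - κ / d * (H + (τ * d) ^ 2 / H) * A) * H / ((κ / d) ^ 2 * (τ * d) ^ 2) / d := by
    field_simp
  have e3 : (κ ^ 2 * (H / d) * A - κ * (B + C)) / (d * (κ ^ 2 * (1 - H) / d))
      = (κ / d * H * A - (B + C)) / (κ / d * (1 - H)) / d := by
    field_simp
  have e4 : (κ ^ 2 * (H / d) * A - κ * B) / (κ ^ 2 * (τ * d) ^ 2 / (d * H))
      = (κ / d * H * A - B) * H / (κ / d * (τ * d) ^ 2) := by
    field_simp
  rw [e1, e2, e3, e4]
  generalize (B + C - κ / d * A) / ((κ / d) ^ 2 * (1 - H)) = X1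
  generalize (B - κ / d * (H + (τ * d) ^ 2 / H) * A) * H / ((κ / d) ^ 2 * (τ * d) ^ 2) = X2
  generalize (κ / d * H * A - (B + C)) / (κ / d * (1 - H)) = X3
  generalize (κ / d * H * A - B) * H / (κ / d * (τ * d) ^ 2) = X4
  field_simp
  ring

/-! ### The inverse of `q coth q` -/

lemma qcoth_eq_gamSlope (q : ℝ) (hq : 0 < q) : qcoth q = gamSlope 1 q := by
  simp [gamSlope_eq_qcoth one_pos hq]

lemma qcoth_strictMonoOn : StrictMonoOn qcoth (Ioi 0) :=
  (gamSlope_strictMonoOn one_pos).congr fun q hq => (qcoth_eq_gamSlope q hq).symm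

lemma hasDerivAt_qcoth {q : ℝ} (hq : 0 < q) :
    HasDerivAt qcoth ((Real.sinh q * Real.cosh q - q) / Real.sinh q ^ 2) q := by
  have hs := (Real.sinh_pos_iff.mpr hq).ne'
  refine (((hasDerivAt_id q).mul (Real.hasDerivAt_cosh q)).div (Real.hasDerivAt_sinh q)
    hs).congr_deriv ?_
  congr 1
  simp only [id, Pi.mul_apply]
  linear_combination (-q) * Real.cosh_sq q

/-- The inverse of `qcoth` on `(0, ∞)`. -/
def qinv (H : ℝ) : ℝ := Function.invFunOn qcoth (Ioi 0) H

lemma qinv_qcoth {q : ℝ} (hq : 0 < q) : qinv (qcoth q) = q :=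
  (qcoth_strictMonoOn.injOn.leftInvOn_invFunOn) (show q ∈ Ioi 0 from hq)

lemma exists_qcoth_eq {x y H : ℝ} (hx : 0 < x) (hxy : x ≤ y) (hH : H ∈ Icc (qcoth x) (qcoth y)) :
    ∃ q ∈ Icc x y, qcoth q = H := by
  have hc : ContinuousOn qcoth (Icc x y) := fun q hq =>
    (hasDerivAt_qcoth (hx.trans_le hq.1)).continuousAt.continuousWithinAt
  exact intermediate_value_Icc hxy hc hH

/-- By the intermediate value theorem every value near `qcoth q` is attained near `q`, so `qinv` is
a continuous local inverse there; the derivative of `qcoth` is nonzero because `q < sinh q cosh q`.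
-/
lemma differentiableAt_qinv {q : ℝ} (hq : 0 < q) : DifferentiableAt ℝ qinv (qcoth q) := by
  have key : ∀ ε, 0 < ε → ε < q →
      ∀ᶠ H in 𝓝 (qcoth q), qcoth (qinv H) = H ∧ qinv H ∈ Icc (q - ε) (q + ε) := by
    intro ε hε hεq
    have h0 : 0 < q - ε := sub_pos.mpr hεq
    have h1 : qcoth (q - ε) < qcoth q :=
      qcoth_strictMonoOn (show q - ε ∈ Ioi 0 from h0) (show q ∈ Ioi 0 from hq) (by linarith)
    have h2 : qcoth q < qcoth (q + ε) :=
      qcoth_strictMonoOn (show q ∈ Ioi 0 from hq) (show 0 < q + ε by linarith) (by linarith)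
    filter_upwards [Icc_mem_nhds h1 h2] with H hH
    obtain ⟨p, hp, rfl⟩ := exists_qcoth_eq h0 (by linarith) hH
    rw [qinv_qcoth (h0.trans_le hp.1)]
    exact ⟨rfl, hp⟩
  have hcont : ContinuousAt qinv (qcoth q) := by
    rw [Metric.continuousAt_iff']
    intro ε hε
    have hpos : 0 < min (ε / 2) (q / 2) := by positivity
    filter_upwards [key _ hpos (lt_of_le_of_lt (min_le_right _ _) (by linarith))] with H hH
    rw [qinv_qcoth hq, Real.dist_eq, abs_lt]
    have := min_le_left (ε / 2) (q / 2)
    constructor <;> linarith [hH.2.1, hH.2.2]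
  have hd := hasDerivAt_qcoth hq
  have hne : (Real.sinh q * Real.cosh q - q) / Real.sinh q ^ 2 ≠ 0 := by
    have := sub_pos.mpr (self_lt_sinh_mul_cosh hq)
    have := Real.sinh_pos_iff.mpr hq
    positivity
  have hev := (key (q / 2) (by positivity) (by linarith)).mono fun H hH => hH.1
  rw [← qinv_qcoth hq] at hd
  exact (HasDerivAt.of_local_left_inverse hcont hd (by simpa [qinv_qcoth hq] using hne)
    hev).differentiableAt

/-! ### The dimensionless depth `q = τ_* d` as a function of `d` -/

/-- The value of `q coth q` at `q = τ_* d`. -/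
def depthFun (a d : ℝ) : ℝ := d * (1 - a * kappa a d) / kappa a d ^ 2

lemma qinv_depthFun {a d : ℝ} (hd : criticalDepth a < d) (hk : kappa a d ≠ 0) :
    qinv (depthFun a d) = tauStar a d * d := by
  rw [depthFun, ← qcoth_tauStar hd hk,
    qinv_qcoth (mul_pos (tauStar_pos hd hk) (pos_of_criticalDepth_lt hd))]

lemma mu2_eq_depthFun {a d : ℝ} (hd : criticalDepth a < d) (hk : kappa a d ≠ 0) :
    mu2 a d = phi a (kappa a d / d) (depthFun a d) (qinv (depthFun a d) ^ 2) / d := by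
  rw [mu2_eq hd hk, qinv_depthFun hd hk, qcoth_tauStar hd hk, depthFun]

/-- The numerator of `H - 1` is `a ^ 2 d ^ 4 / 4 + d ^ 3 - 1`, which vanishes at the critical depth
`c`. Factoring out `d - c` exhibits the simple zero that becomes the pole of `mu2`. -/
lemma depthFun_sub_one {a c d : ℝ} (h : a ^ 2 * c ^ 4 / 4 + c ^ 3 = 1) (hd : 0 < d)
    (hk : kappa a d ≠ 0) :
    depthFun a d - 1 = (d - c) * (a ^ 2 / 4 * (d ^ 3 + d ^ 2 * c + d * c ^ 2 + c ^ 3)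
      + d ^ 2 + d * c + c ^ 2) / (kappa a d ^ 2 * d ^ 2) := by
  have : depthFun a d - 1 = (a ^ 2 * d ^ 4 / 4 + d ^ 3 - 1) / (kappa a d ^ 2 * d ^ 2) := by
    rw [depthFun, eq_div_iff (by positivity)]
    field_simp
    rw [kappa_eq]
    field_simp
    ring
  rw [this]
  congr 1
  linear_combination h

lemma depthFun_gt_one {a d : ℝ} (hd : criticalDepth a < d) (hk : kappa a d ≠ 0) :
    1 < depthFun a d := by
  rw [depthFun, ← qcoth_tauStar hd hk]
  exact qcoth_gt_one (mul_pos (tauStar_pos hd hk) (pos_of_criticalDepth_lt hd))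

/-! ### The critical depth -/

lemma qcoth_taylor : (fun q : ℝ => (qcoth q - 1) / q ^ 2 - 1 / 3) =O[𝓝[>] 0] fun q => q ^ 2 := by
  have he : (fun x : ℝ => Real.exp x - ∑ i ∈ Finset.range 5, x ^ i / (i.factorial : ℝ))
      =O[𝓝 0] fun x => x ^ 5 := Real.exp_sub_sum_range_isBigO_pow 5
  have hm : (fun x : ℝ => Real.exp (-x) - ∑ i ∈ Finset.range 5, (-x) ^ i / (i.factorial : ℝ))
      =O[𝓝 0] fun x => x ^ 5 := by
    have ht : Tendsto (fun x : ℝ => -x) (𝓝 0) (𝓝 0) := by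
      simpa using (continuous_neg (G := ℝ)).tendsto 0
    have := he.comp_tendsto ht
    refine this.trans (IsBigO.of_bound 1 (Eventually.of_forall fun x => ?_))
    simp
  have hs : (fun x : ℝ => Real.sinh x - (x + x ^ 3 / 6)) =O[𝓝 0] fun x => x ^ 5 := by
    refine ((he.sub hm).const_mul_left (1 / 2)).congr_left fun x => ?_
    rw [Real.sinh_eq]
    simp [Finset.sum_range_succ, Nat.factorial]
    ring
  have hc : (fun x : ℝ => Real.cosh x - (1 + x ^ 2 / 2 + x ^ 4 / 24)) =O[𝓝 0] fun x => x ^ 5 := by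
    refine ((he.add hm).const_mul_left (1 / 2)).congr_left fun x => ?_
    rw [Real.cosh_eq]
    simp [Finset.sum_range_succ, Nat.factorial]
    ring
  have hb : ∀ f : ℝ → ℝ, Continuous f → f =O[𝓝 0] fun _ => (1 : ℝ) := fun f hf =>
    hf.continuousAt.norm.isBoundedUnder_le.isBigO_one ℝ
  -- The terms of degree 1 and 3 cancel; the Taylor polynomials contribute `x ^ 5 / 24` and `x ^ 5 /
  -- 18`.
  have hF : (fun x : ℝ => x * Real.cosh x - Real.sinh x - x ^ 2 / 3 * Real.sinh x)
      =O[𝓝 0] fun x => x ^ 5 := by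
    have h1 := (hb (fun x => x) (by fun_prop)).mul hc
    have h2 := (hb (fun x => 1 + x ^ 2 / 3) (by fun_prop)).mul hs
    have h3 := (hb (fun x => 1 / 24 - 1 / 18) (by fun_prop)).mul
      (isBigO_refl (fun x : ℝ => x ^ 5) (𝓝 0))
    simp only [one_mul] at h1 h2 h3
    exact ((h1.sub h2).add h3).congr_left fun x => by ring
  have hG : (fun q : ℝ => (q * Real.cosh q - Real.sinh q - q ^ 2 / 3 * Real.sinh q)
      * (q ^ 3)⁻¹) =O[𝓝[>] 0] fun q => q ^ 5 * (q ^ 3)⁻¹ :=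
    (hF.mono nhdsWithin_le_nhds).mul (isBigO_refl _ _)
  refine IsBigO.trans (IsBigO.of_bound 1 ?_) (hG.trans (IsBigO.of_bound 1 ?_))
  · filter_upwards [self_mem_nhdsWithin] with q hq
    have hq : 0 < q := hq
    have h1 := Real.self_lt_sinh_iff.mpr hq
    have h2 : 0 < Real.sinh q := hq.trans h1
    have e : (qcoth q - 1) / q ^ 2 - 1 / 3
        = (q * Real.cosh q - Real.sinh q - q ^ 2 / 3 * Real.sinh q) * (q ^ 2 * Real.sinh q)⁻¹ := by
      rw [qcoth]
      field_simp
    rw [e, norm_mul, norm_mul, one_mul]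
    gcongr
    rw [norm_inv, norm_inv, Real.norm_of_nonneg (by positivity), Real.norm_of_nonneg (by positivity)]
    gcongr
    nlinarith [sq_nonneg q]
  · filter_upwards [self_mem_nhdsWithin] with q hq
    have hq : 0 < q := hq
    rw [one_mul]
    apply le_of_eq
    congr 1
    field_simp

lemma tendsto_of_qcoth_tendsto_one {ι : Type*} {l : Filter ι} {f : ι → ℝ} (hf : ∀ᶠ i in l, 0 < f i)
    (h : Tendsto (fun i => qcoth (f i)) l (𝓝 1)) : Tendsto f l (𝓝[>] 0) := by
  refine tendsto_nhdsWithin_iff.mpr ⟨?_, hf⟩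
  rw [tendsto_order]
  refine ⟨fun x hx => hf.mono fun i hi => hx.trans hi, fun x hx => ?_⟩
  filter_upwards [hf, h.eventually_lt_const (qcoth_gt_one hx)] with i h1 h2
  exact (qcoth_strictMonoOn.lt_iff_lt h1 hx).mp h2

/-- If `κ = 0` at `c`, then `a c ^ 2 = 2`, so `a ^ 2 c ^ 4 / 4 = 1` and the equation for `c` forces
`c ^ 3 = 0`. -/
lemma kappa_criticalDepth_ne_zero (a : ℝ) : kappa a (criticalDepth a) ≠ 0 := by
  obtain ⟨hc, h, -⟩ := criticalDepth_spec a
  rw [kappa_eq]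
  intro h0
  field_simp at h0
  have : a ^ 2 * criticalDepth a ^ 4 = 4 := by
    have : a * criticalDepth a ^ 2 = 2 := by linarith
    calc a ^ 2 * criticalDepth a ^ 4 = (a * criticalDepth a ^ 2) ^ 2 := by ring
      _ = 4 := by rw [this]; norm_num
  have : 0 < criticalDepth a ^ 3 := by positivity
  linarith

lemma continuousAt_kappa (a : ℝ) {d : ℝ} (hd : 0 < d) : ContinuousAt (kappa a) d := by
  have : kappa a = fun d => 1 / d - a * d / 2 := funext (kappa_eq a)
  rw [this]
  have := hd.ne'
  fun_prop (disch := assumption)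

lemma differentiableAt_kappa (a : ℝ) {d : ℝ} (hd : 0 < d) : DifferentiableAt ℝ (kappa a) d := by
  have : kappa a = fun d => 1 / d - a * d / 2 := funext (kappa_eq a)
  rw [this]
  have := hd.ne'
  fun_prop (disch := assumption)

/-- `w * phi a k (1 + r w) w`, without singularity at `w = 0`. -/
def phiCrit (a k r w : ℝ) : ℝ :=
  let H := 1 + r * w
  let A := -a / 4 - k * H / 2
  let B := -3 / 4 * k ^ 2 * w + a ^ 2 / 4 + a * k * H / 2 + k ^ 2 * H ^ 2 / 4
  let C := k ^ 2 * w / 2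
  (2 * ((B + C - k * A) / (-(k ^ 2 * r))) + (B - k * (H + w / H) * A) * H / k ^ 2)
      * (k ^ 2 * w - (a + k * H) ^ 2)
    + 2 * ((k * H * A - (B + C)) / (-(k * r))) * (a + 2 * k * H)
    + (k * H * A - B) * H / k * ((H + w / H) * (a + 2 * k * H) - 2 * k * w)
    - w * (k * w * (2 * k * H + 3 / 2 * a))

lemma mul_phi_eq_phiCrit {a k r w : ℝ} (hk : k ≠ 0) (hr : r ≠ 0) (hw : w ≠ 0) :
    w * phi a k (1 + r * w) w = phiCrit a k r w := by
  rw [phi, phiCrit]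
  generalize hH : 1 + r * w = H
  have e : 1 - H = -(r * w) := by rw [← hH]; ring
  simp only [e]
  generalize -a / 4 - k * H / 2 = A
  generalize -3 / 4 * k ^ 2 * w + a ^ 2 / 4 + a * k * H / 2 + k ^ 2 * H ^ 2 / 4 = B
  generalize k ^ 2 * w / 2 = C
  generalize H + w / H = X
  field_simp

/-- With `r = (H - 1) / w` as a separate variable, `(d - c) * mu2` is a function `F` of `(d, r, w)`
differentiable at `(c, 1 / 3, 0)`, and all three variables approach their limits at rate `O(d - c)`.
-/
lemma critical_asymptotics (a : ℝ) :
    (fun d => (d - criticalDepth a) * mu2 a d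
      - 5 * (4 - criticalDepth a ^ 3) / (12 * criticalDepth a ^ 4))
      =O[𝓝[>] criticalDepth a] fun d => d - criticalDepth a := by
  obtain ⟨hc, h, -⟩ := criticalDepth_spec a
  have hkc := kappa_criticalDepth_ne_zero a
  set c := criticalDepth a with hcdef
  set S : ℝ → ℝ := fun d => a ^ 2 / 4 * (d ^ 3 + d ^ 2 * c + d * c ^ 2 + c ^ 3)
      + d ^ 2 + d * c + c ^ 2 with hS
  have hSpos : ∀ d, 0 < d → 0 < S d := fun d hd => by simp only [hS]; positivity
  -- The prefactor comes from `r w = H - 1 = (d - c) S / (κ ^ 2 d ^ 2)`: solved for `d - c`, it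
  -- supplies the factor `w` that removes the pole of `phi`.
  set F : ℝ × ℝ × ℝ → ℝ := fun p =>
    p.2.1 * kappa a p.1 ^ 2 * p.1 / S p.1 * phiCrit a (kappa a p.1 / p.1) p.2.1 p.2.2 with hF
  have hFd : DifferentiableAt ℝ F (c, 1 / 3, 0) := by
    have h1 : DifferentiableAt ℝ (fun p : ℝ × ℝ × ℝ => kappa a p.1) (c, 1 / 3, 0) :=
      DifferentiableAt.comp (c, (1 / 3 : ℝ), (0 : ℝ)) (differentiableAt_kappa a hc)
        differentiableAt_fst
    have h2 : DifferentiableAt ℝ (fun p : ℝ × ℝ × ℝ => kappa a p.1 / p.1) (c, 1 / 3, 0) := by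
      fun_prop (disch := exact hc.ne')
    have hk1 : kappa a c / c ≠ 0 := by positivity
    have h3 : DifferentiableAt ℝ (fun q : ℝ × ℝ × ℝ => phiCrit a q.1 q.2.1 q.2.2)
        (kappa a c / c, 1 / 3, 0) := by
      unfold phiCrit
      fun_prop (disch := simp [hkc, hc.ne'])
    have h4 : DifferentiableAt ℝ (fun p : ℝ × ℝ × ℝ =>
        phiCrit a (kappa a p.1 / p.1) p.2.1 p.2.2) (c, 1 / 3, 0) :=
      DifferentiableAt.comp (g := fun q : ℝ × ℝ × ℝ => phiCrit a q.1 q.2.1 q.2.2)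
        (f := fun p : ℝ × ℝ × ℝ => (kappa a p.1 / p.1, p.2.1, p.2.2)) (c, (1 / 3 : ℝ), (0 : ℝ))
        h3 (by fun_prop)
    have h5 : DifferentiableAt ℝ (fun p : ℝ × ℝ × ℝ => S p.1) (c, 1 / 3, 0) := by
      simp only [hS]; fun_prop
    simp only [hF]
    fun_prop (disch := exact (hSpos c hc).ne')
  have hF0 : F (c, 1 / 3, 0) = 5 * (4 - c ^ 3) / (12 * c ^ 4) := by
    have hS0 : S c = (4 - c ^ 3) / c := by
      simp only [hS]
      field_simp
      linear_combination 16 * h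
    have h4 : 4 - c ^ 3 ≠ 0 := by
      have : 0 ≤ a ^ 2 * c ^ 4 / 4 := by positivity
      have : c ^ 3 ≤ 1 := by linarith
      intro h; linarith
    simp only [hF, hS0, phiCrit]
    have hk : kappa a c = c * (kappa a c / c) := by field_simp
    -- This is `σ(0) = 0`, the criticality of `c`, in terms of `k = κ / c`.
    have hk2 : (kappa a c / c) ^ 2 + a * (kappa a c / c) = 1 / c := by
      rw [kappa_eq]
      field_simp
      linear_combination -4 * h
    have hk3 : kappa a c / c ≠ 0 := by positivity
    have hac : (a ^ 2 + 3 / c) = (4 - c ^ 3) / c ^ 4 := by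
      field_simp
      linear_combination 4 * h
    rw [hk]
    simp only [mul_div_cancel_left₀ _ hc.ne']
    generalize kappa a c / c = k at *
    have e : 5 * (4 - c ^ 3) / (12 * c ^ 4)
        = 1 / 3 * (c ^ 4 / (4 - c ^ 3)) * (5 / 4 * ((4 - c ^ 3) / c ^ 4) ^ 2) := by
      field_simp
      ring
    -- At `r = 1 / 3`, `w = 0` the product `k ^ 2 * phiCrit` collapses to `5 / 4 * (a ^ 2 + 3 a k +
    -- 3 k ^ 2) ^ 2`, and the quadratic form is evaluated here.
    have e' : a ^ 2 + 3 * a * k + 3 * k ^ 2 = (4 - c ^ 3) / c ^ 4 := by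
      rw [← hac]; linear_combination 3 * hk2
    rw [e, ← e']
    field_simp
    ring
  set q : ℝ → ℝ := fun d => tauStar a d * d with hq
  set H : ℝ → ℝ := depthFun a with hH
  have hkev : ∀ᶠ d in 𝓝[>] c, kappa a d ≠ 0 :=
    ((continuousAt_kappa a hc).eventually_ne hkc).filter_mono nhdsWithin_le_nhds
  have hev : ∀ᶠ d in 𝓝[>] c, c < d ∧ kappa a d ≠ 0 :=
    (eventually_mem_nhdsWithin (s := Ioi c)).and hkev
  have hqpos : ∀ᶠ d in 𝓝[>] c, 0 < q d := hev.mono fun d hd =>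
    mul_pos (tauStar_pos hd.1 hd.2) (hc.trans hd.1)
  have hHq : ∀ᶠ d in 𝓝[>] c, qcoth (q d) = H d := hev.mono fun d hd => qcoth_tauStar hd.1 hd.2
  have hH1 : ∀ᶠ d in 𝓝[>] c, H d - 1 = (d - c) * S d / (kappa a d ^ 2 * d ^ 2) :=
    hev.mono fun d hd => depthFun_sub_one h (hc.trans hd.1) hd.2
  have hHO : (fun d => H d - 1) =O[𝓝[>] c] fun d => d - c := by
    have hb : (fun d => S d / (kappa a d ^ 2 * d ^ 2)) =O[𝓝[>] c] fun _ => (1 : ℝ) := by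
      have : ContinuousAt (fun d => S d / (kappa a d ^ 2 * d ^ 2)) c := by
        have h1 := continuousAt_kappa a hc
        have h2 : ContinuousAt S c := by simp only [hS]; fun_prop
        have h3 : kappa a c ^ 2 * c ^ 2 ≠ 0 := by positivity
        fun_prop (disch := exact h3)
      exact (this.norm.isBoundedUnder_le.isBigO_one ℝ).mono nhdsWithin_le_nhds
    have := (isBigO_refl (fun d => d - c) (𝓝[>] c)).mul hb
    simp only [mul_one] at this
    refine this.congr' ?_ EventuallyEq.rfl
    filter_upwards [hH1] with d hd
    rw [hd]; ring
  have hsub : Tendsto (fun d => d - c) (𝓝[>] c) (𝓝 0) := by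
    have : Tendsto (fun d => d - c) (𝓝 c) (𝓝 (c - c)) := by
      exact (continuous_id.sub continuous_const).tendsto c
    rw [sub_self] at this
    exact this.mono_left nhdsWithin_le_nhds
  have hHlim : Tendsto H (𝓝[>] c) (𝓝 1) := by
    have := (hHO.trans_tendsto hsub).add_const 1
    simpa using this
  have hq0 : Tendsto q (𝓝[>] c) (𝓝[>] 0) :=
    tendsto_of_qcoth_tendsto_one hqpos (hHlim.congr' (hHq.mono fun d hd => hd.symm))
  have hq0' : Tendsto q (𝓝[>] c) (𝓝 0) := hq0.mono_right nhdsWithin_le_nhds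
  set r : ℝ → ℝ := fun d => (H d - 1) / q d ^ 2 with hr
  have hrO : (fun d => r d - 1 / 3) =O[𝓝[>] c] fun d => q d ^ 2 := by
    refine (qcoth_taylor.comp_tendsto hq0).congr' ?_ EventuallyEq.rfl
    filter_upwards [hHq] with d hd
    simp only [Function.comp, hd, hr]
  have hrlim : Tendsto r (𝓝[>] c) (𝓝 (1 / 3)) := by
    have h1 : Tendsto (fun d => q d ^ 2) (𝓝[>] c) (𝓝 0) := by simpa using hq0'.pow 2
    have := (hrO.trans_tendsto h1).add_const (1 / 3)
    simpa using this
  have hwO : (fun d => q d ^ 2) =O[𝓝[>] c] fun d => d - c := by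
    have h1 : (fun d => (r d)⁻¹) =O[𝓝[>] c] fun _ => (1 : ℝ) :=
      (hrlim.inv₀ (by norm_num)).isBigO_one ℝ
    have := hHO.mul h1
    simp only [mul_one] at this
    refine this.congr' ?_ EventuallyEq.rfl
    filter_upwards [hqpos, hev] with d hd hd'
    have : H d - 1 ≠ 0 := (sub_pos.mpr (depthFun_gt_one hd'.1 hd'.2)).ne'
    simp only [hr]
    field_simp
  have hp : Tendsto (fun d => (d, r d, q d ^ 2)) (𝓝[>] c) (𝓝 (c, 1 / 3, 0)) := by
    refine (tendsto_id.mono_left nhdsWithin_le_nhds).prodMk_nhds (hrlim.prodMk_nhds ?_)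
    simpa using hq0'.pow 2
  have hmain := hFd.isBigO_sub.comp_tendsto hp
  -- Here `r - 1 / 3 = O(q ^ 2)` by the Taylor expansion, and `q ^ 2 = (H - 1) / r = O(d - c)`.
  have hpO : (fun d => (d, r d, q d ^ 2) - ((c, 1 / 3, 0) : ℝ × ℝ × ℝ))
      =O[𝓝[>] c] fun d => d - c := by
    refine (isBigO_refl _ _).prod_left (((hrO.trans hwO)).prod_left ?_)
    simpa using hwO
  refine (hmain.trans hpO).congr' ?_ EventuallyEq.rfl
  filter_upwards [hqpos, hev, hH1] with d hd hd' hdH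
  have hd0 : 0 < d := hc.trans hd'.1
  have hH1' : H d - 1 ≠ 0 := (sub_pos.mpr (depthFun_gt_one hd'.1 hd'.2)).ne'
  have hr0 : r d ≠ 0 := div_ne_zero hH1' (by positivity)
  simp only [Function.comp, hF0]
  congr 1
  have hk2 := hd'.2
  simp only [hF]
  rw [← mul_phi_eq_phiCrit (by positivity) hr0 (by positivity),
    mu2_eq_depthFun hd'.1 hd'.2, qinv_depthFun hd'.1 hd'.2]
  have e1 : 1 + r d * q d ^ 2 = H d := by
    simp only [hr]; field_simp; ring
  rw [e1]
  have e2 : r d * q d ^ 2 = H d - 1 := by linarith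
  change _ = (d - c) * (phi a (kappa a d / d) (H d) (q d ^ 2) / d)
  have hSd := (hSpos d hd0).ne'
  generalize phi a (kappa a d / d) (H d) (q d ^ 2) = Φ
  calc _ = (r d * q d ^ 2) * kappa a d ^ 2 * d / S d * Φ := by ring
    _ = _ := by
      rw [e2, hdH]
      field_simp

lemma sub_div_isBigO_of_mul {l : Filter ℝ} {f g : ℝ → ℝ} {c L : ℝ} (n : ℕ)
    (hl : ∀ᶠ d in l, d ≠ c)
    (h : (fun d => (d - c) ^ (n + 1) * f d - L) =O[l] fun d => d - c)
    (hg : ∀ᶠ d in l, g d = L * ((d - c) ^ (n + 1))⁻¹) :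
    (fun d => f d - g d) =O[l] fun d => ((d - c) ^ n)⁻¹ := by
  refine (h.mul (isBigO_refl (fun d => ((d - c) ^ (n + 1))⁻¹) l)).congr' ?_ ?_
  · filter_upwards [hl, hg] with d hd hgd
    have := sub_ne_zero.mpr hd
    rw [hgd]
    field_simp
  · filter_upwards [hl] with d hd
    have := sub_ne_zero.mpr hd
    field_simp
    ring

lemma critical_behaviour (a : ℝ) :
    (fun d => mu2 a d - 5 * (4 - criticalDepth a ^ 3) / (12 * criticalDepth a ^ 4)
        * (d - criticalDepth a)⁻¹) =O[𝓝[>] criticalDepth a] (fun _ => (1 : ℝ)) ∧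
      Tendsto (mu2 a) (𝓝[>] criticalDepth a) atTop := by
  have key := critical_asymptotics a
  obtain ⟨hc, h, -⟩ := criticalDepth_spec a
  set c := criticalDepth a
  have hne : ∀ᶠ d in 𝓝[>] c, d ≠ c := by
    filter_upwards [self_mem_nhdsWithin] with d hd using ne_of_gt hd
  have h1 : (fun d => mu2 a d - 5 * (4 - c ^ 3) / (12 * c ^ 4) * (d - c)⁻¹)
      =O[𝓝[>] c] (fun _ => (1 : ℝ)) := by
    have := sub_div_isBigO_of_mul (f := mu2 a) (g := fun d => 5 * (4 - c ^ 3) / (12 * c ^ 4)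
      * (d - c)⁻¹) (c := c) (L := 5 * (4 - c ^ 3) / (12 * c ^ 4)) 0 hne (by simpa using key)
      (Eventually.of_forall fun d => by simp)
    simpa using this
  refine ⟨h1, ?_⟩
  have hL : 0 < 5 * (4 - c ^ 3) / (12 * c ^ 4) := by
    have : 0 ≤ a ^ 2 * c ^ 4 / 4 := by positivity
    have : 0 < 4 - c ^ 3 := by linarith
    positivity
  have hsub : Tendsto (fun d => d - c) (𝓝[>] c) (𝓝[>] 0) := by
    refine tendsto_nhdsWithin_iff.mpr ⟨?_, ?_⟩
    · have : Tendsto (fun d => d - c) (𝓝 c) (𝓝 (c - c)) :=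
        (continuous_id.sub continuous_const).tendsto c
      rw [sub_self] at this
      exact this.mono_left nhdsWithin_le_nhds
    · filter_upwards [self_mem_nhdsWithin] with d hd
      exact sub_pos.mpr (show c < d from hd)
  have h2 : Tendsto (fun d => (d - c)⁻¹) (𝓝[>] c) atTop := tendsto_inv_nhdsGT_zero.comp hsub
  have h3 : Tendsto (fun d => (d - c) * mu2 a d) (𝓝[>] c) (𝓝 (5 * (4 - c ^ 3) / (12 * c ^ 4))) := by
    have := (key.trans_tendsto (hsub.mono_right nhdsWithin_le_nhds)).add_const
      (5 * (4 - c ^ 3) / (12 * c ^ 4))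
    simpa using this
  refine (h2.atTop_mul_pos hL h3).congr' ?_
  filter_upwards [hne] with d hd
  have := sub_ne_zero.mpr hd
  field_simp

/-! ### The stagnation depth -/

/-- `k ^ 4 * phi a k (h / k ^ 2) (h ^ 2 / k ^ 4 - D / k ^ 4)`, without singularity at `k = 0`. -/
def phiStag (a k h D : ℝ) : ℝ :=
  let A := -a * k / 4 - h / 2
  let B := -3 / 4 * (h ^ 2 - D) + a ^ 2 * k ^ 2 / 4 + a * h * k / 2 + h ^ 2 / 4
  let C := (h ^ 2 - D) / 2
  (2 * ((B + C - k ^ 2 * A) / (k ^ 2 - h)) + (B - (2 * h - D / h) * A) / (h - D / h))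
      * (-D - a ^ 2 * k ^ 2 - 2 * a * h * k)
    + k ^ 2 * (2 * ((h * A - (B + C)) / (k ^ 2 - h)) * (a * k + 2 * h))
    + (h * A - B) / (h - D / h)
      * ((2 * h - D / h) * (a * k + 2 * h) - 2 * (h ^ 2 - D))
    - (h ^ 2 - D) * (2 * h + 3 / 2 * a * k)

/-- The variables are rescaled by the blow-up rate: `h = k ^ 2 H` has a finite nonzero limit at the
stagnation depth, and `D = k ^ 4 (H ^ 2 - w)` tends to zero. -/
lemma pow_mul_phi_eq_phiStag {a k h D : ℝ} (hk : k ≠ 0) (hh : h ≠ 0) (hD : h ^ 2 - D ≠ 0)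
    (hkh : k ^ 2 - h ≠ 0) :
    k ^ 4 * phi a k (h / k ^ 2) ((h ^ 2 - D) / k ^ 4) = phiStag a k h D := by
  have e1 : 1 - h / k ^ 2 = (k ^ 2 - h) / k ^ 2 := by field_simp
  have e2 : h - D / h = (h ^ 2 - D) / h := by field_simp
  have e3 : h / k ^ 2 + (h ^ 2 - D) / k ^ 4 / (h / k ^ 2) = (2 * h - D / h) / k ^ 2 := by
    field_simp
    ring
  have eA : -a / 4 - k * (h / k ^ 2) / 2 = (-a * k / 4 - h / 2) / k := by field_simp
  have eB : -3 / 4 * k ^ 2 * ((h ^ 2 - D) / k ^ 4) + a ^ 2 / 4 + a * k * (h / k ^ 2) / 2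
      + k ^ 2 * (h / k ^ 2) ^ 2 / 4
      = (-3 / 4 * (h ^ 2 - D) + a ^ 2 * k ^ 2 / 4 + a * h * k / 2 + h ^ 2 / 4) / k ^ 2 := by
    field_simp
  have eC : k ^ 2 * ((h ^ 2 - D) / k ^ 4) / 2 = ((h ^ 2 - D) / 2) / k ^ 2 := by field_simp
  have eY : k ^ 2 * ((h ^ 2 - D) / k ^ 4) - (a + k * (h / k ^ 2)) ^ 2
      = (-D - a ^ 2 * k ^ 2 - 2 * a * h * k) / k ^ 2 := by
    field_simp
    ring
  simp only [phi, phiStag]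
  rw [eA, eB, eC, eY, e1, e2, e3]
  generalize -a * k / 4 - h / 2 = A
  generalize -3 / 4 * (h ^ 2 - D) + a ^ 2 * k ^ 2 / 4 + a * h * k / 2 + h ^ 2 / 4 = B
  generalize hC : (h ^ 2 - D) / 2 = C
  generalize -D - a ^ 2 * k ^ 2 - 2 * a * h * k = Y
  generalize 2 * h - D / h = X
  generalize h ^ 2 - D = Z at *
  generalize k ^ 2 - h = V at *
  field_simp

/-- At `c` one has `a ^ 2 c ^ 4 / 4 = 1 - c ^ 3 < 1`, that is `a c ^ 2 < 2`. -/
lemma criticalDepth_lt_stagnationDepth {a : ℝ} (ha : 0 < a) :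
    criticalDepth a < stagnationDepth a := by
  obtain ⟨hc, h, -⟩ := criticalDepth_spec a
  rw [stagnationDepth, abs_of_pos ha]
  apply Real.lt_sqrt_of_sq_lt
  rw [lt_div_iff₀ ha]
  have h3 : 0 < criticalDepth a ^ 3 := by positivity
  have h4 : 0 < criticalDepth a ^ 2 * a := by positivity
  nlinarith

lemma kappa_eq_mul_sub {a : ℝ} (ha : 0 < a) {d : ℝ} (hd : 0 < d) :
    kappa a d
      = (d - stagnationDepth a) * (-a * (d + stagnationDepth a) / (2 * d)) := by
  have h : stagnationDepth a ^ 2 = 2 / a := by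
    rw [stagnationDepth, abs_of_pos ha, Real.sq_sqrt (by positivity)]
  have e : (d - stagnationDepth a) * (-a * (d + stagnationDepth a) / (2 * d))
      = -a * (d ^ 2 - stagnationDepth a ^ 2) / (2 * d) := by ring
  rw [e, h, kappa_eq]
  field_simp
  ring

/-- The zero of `κ` at `s` is simple, so `k ^ 4` is comparable with `(d - s) ^ 4`, and `k ^ 4 * phi`
extends smoothly to `k = 0`. At `k = D = 0` every term of `phiStag` vanishes except the last, which
is `-2 h ^ 3`. -/
lemma stagnation_asymptotics {a : ℝ} (ha : 0 < a) :
    (fun d => (d - stagnationDepth a) ^ 4 * mu2 a d - -2 / a ^ 4)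
      =O[𝓝[≠] stagnationDepth a] fun d => d - stagnationDepth a := by
  have hcs := criticalDepth_lt_stagnationDepth ha
  have hs : 0 < stagnationDepth a := pos_of_criticalDepth_lt hcs
  have hkap : ∀ d, 0 < d → kappa a d
      = (d - stagnationDepth a) * (-a * (d + stagnationDepth a) / (2 * d)) :=
    fun d => kappa_eq_mul_sub ha
  set s := stagnationDepth a
  have hks : kappa a s = 0 := by rw [hkap s hs]; simp
  -- From `d - s = κ * 2 d / (-a (d + s))` and `κ = d k`, the product `(d - s) ^ 4 * phi / d` is
  -- this prefactor times `k ^ 4 * phi`. Where `κ ≠ 0`, the argument `1 / d - a k` is `k ^ 2 H`.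
  set F : ℝ × ℝ → ℝ := fun p => (2 * p.1 / (-a * (p.1 + s))) ^ 4 * p.1 ^ 3
      * phiStag a (kappa a p.1 / p.1) (1 / p.1 - a * (kappa a p.1 / p.1)) p.2 with hF
  have hFd : DifferentiableAt ℝ F (s, 0) := by
    have h1 : DifferentiableAt ℝ (fun p : ℝ × ℝ => kappa a p.1) (s, 0) :=
      DifferentiableAt.comp (s, (0 : ℝ)) (differentiableAt_kappa a hs) differentiableAt_fst
    have h2 : DifferentiableAt ℝ (fun p : ℝ × ℝ => kappa a p.1 / p.1) (s, 0) := by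
      fun_prop (disch := exact hs.ne')
    have h3 : DifferentiableAt ℝ (fun q : ℝ × ℝ × ℝ => phiStag a q.1 q.2.1 q.2.2)
        (kappa a s / s, 1 / s - a * (kappa a s / s), 0) := by
      unfold phiStag
      fun_prop (disch := simp [hks, hs.ne'])
    have h5 : DifferentiableAt ℝ (fun p : ℝ × ℝ => 1 / p.1) (s, 0) := by
      fun_prop (disch := exact hs.ne')
    have h4 : DifferentiableAt ℝ (fun p : ℝ × ℝ =>
        phiStag a (kappa a p.1 / p.1) (1 / p.1 - a * (kappa a p.1 / p.1)) p.2) (s, 0) :=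
      DifferentiableAt.comp (g := fun q : ℝ × ℝ × ℝ => phiStag a q.1 q.2.1 q.2.2)
        (f := fun p : ℝ × ℝ =>
          (kappa a p.1 / p.1, 1 / p.1 - a * (kappa a p.1 / p.1), p.2)) (s, (0 : ℝ))
        h3 (by fun_prop)
    have h6 : -a * (s + s) ≠ 0 := by
      have : 0 < a * (s + s) := by positivity
      linarith
    simp only [hF]
    fun_prop (disch := exact h6)
  have hF0 : F (s, 0) = -2 / a ^ 4 := by
    simp only [hF, hks, phiStag]
    field_simp
    ring
  set q : ℝ → ℝ := fun d => tauStar a d * d with hq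
  have hev : ∀ᶠ d in 𝓝[≠] s, d ≠ s ∧ criticalDepth a < d := by
    filter_upwards [self_mem_nhdsWithin, nhdsWithin_le_nhds (Ioi_mem_nhds hcs)] with d h1 h2
      using ⟨h1, h2⟩
  have hk : ∀ d, d ≠ s → criticalDepth a < d → kappa a d ≠ 0 := by
    intro d h1 h2
    have hd0 := pos_of_criticalDepth_lt h2
    rw [hkap d hd0]
    have : 0 < a * (d + s) := by positivity
    refine mul_ne_zero (sub_ne_zero.mpr h1) (div_ne_zero (by linarith) (by positivity))
  set δ : ℝ → ℝ := fun d => q d ^ 2 / Real.sinh (q d) ^ 2 with hδ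
  set D : ℝ → ℝ := fun d => (kappa a d / d) ^ 4 * δ d with hD
  have hsub : Tendsto (fun d => d - s) (𝓝[≠] s) (𝓝 0) := by
    have : Tendsto (fun d => d - s) (𝓝 s) (𝓝 (s - s)) :=
      (continuous_id.sub continuous_const).tendsto s
    rw [sub_self] at this
    exact this.mono_left nhdsWithin_le_nhds
  have hδ1 : δ =O[𝓝[≠] s] fun _ => (1 : ℝ) := by
    refine IsBigO.of_bound 1 ?_
    filter_upwards [hev] with d hd
    have hq0 : 0 < q d := mul_pos (tauStar_pos hd.2 (hk d hd.1 hd.2)) (pos_of_criticalDepth_lt hd.2)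
    have hsq := Real.self_lt_sinh_iff.mpr hq0
    have hs0 := hq0.trans hsq
    rw [Real.norm_of_nonneg (by positivity)]
    simp only [hδ, norm_one, mul_one]
    rw [div_le_one (by positivity)]
    gcongr
  have hkO : (fun d => kappa a d / d) =O[𝓝[≠] s] fun d => d - s := by
    have h1 : ContinuousAt (fun d => -a * (d + s) / (2 * d) / d) s := by
      have : 2 * s ≠ 0 := by positivity
      fun_prop (disch := first | exact hs.ne' | exact this)
    have h2 := (isBigO_refl (fun d => d - s) (𝓝[≠] s)).mul
      ((h1.norm.isBoundedUnder_le.isBigO_one ℝ).mono (nhdsWithin_le_nhds (s := {s}ᶜ)))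
    simp only [mul_one] at h2
    refine h2.congr' ?_ EventuallyEq.rfl
    filter_upwards [hev] with d hd
    rw [hkap d (pos_of_criticalDepth_lt hd.2)]
    ring
  have hDO : D =O[𝓝[≠] s] fun d => d - s := by
    have h1 := (hkO.pow 4).mul hδ1
    simp only [mul_one] at h1
    refine h1.trans ?_
    have h2 : (fun d => (d - s) ^ 3) =O[𝓝[≠] s] fun _ => (1 : ℝ) := (hsub.pow 3).isBigO_one ℝ
    have := h2.mul (isBigO_refl (fun d => d - s) (𝓝[≠] s))
    simp only [one_mul] at this
    exact this.congr_left fun d => by ring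
  have hp : Tendsto (fun d => (d, D d)) (𝓝[≠] s) (𝓝 (s, 0)) :=
    (tendsto_id.mono_left nhdsWithin_le_nhds).prodMk_nhds (hDO.trans_tendsto hsub)
  have hpO : (fun d => (d, D d) - ((s, 0) : ℝ × ℝ)) =O[𝓝[≠] s] fun d => d - s := by
    refine (isBigO_refl _ _).prod_left ?_
    simpa using hDO
  refine ((hFd.isBigO_sub.comp_tendsto hp).trans hpO).congr' ?_ EventuallyEq.rfl
  filter_upwards [hev] with d hd
  have hd0 := pos_of_criticalDepth_lt hd.2
  have hkd := hk d hd.1 hd.2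
  have hq0 : 0 < q d := mul_pos (tauStar_pos hd.2 hkd) hd0
  have hsq := Real.self_lt_sinh_iff.mpr hq0
  have hs0 := hq0.trans hsq
  simp only [Function.comp, hF0]
  congr 1
  have hH1 := depthFun_gt_one hd.2 hkd
  -- This is `coth ^ 2 - 1 = 1 / sinh ^ 2`. The remainder `δ` stays between `0` and `1`, so no
  -- asymptotics of `q` itself is needed.
  have hw : q d ^ 2 = depthFun a d ^ 2 - δ d := by
    have : depthFun a d = qcoth (q d) := (qcoth_tauStar hd.2 hkd).symm
    rw [this, qcoth]
    simp only [hδ]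
    generalize q d = x at *
    field_simp
    linear_combination -Real.cosh_sq x
  set k := kappa a d / d with hkdef
  have hk0 : k ≠ 0 := div_ne_zero hkd hd0.ne'
  have hH : depthFun a d = (1 / d - a * k) / k ^ 2 := by
    rw [depthFun, hkdef]
    field_simp
  have hw' : q d ^ 2 = ((1 / d - a * k) ^ 2 - D d) / k ^ 4 := by
    rw [hw, hH]
    simp only [hD, ← hkdef]
    field_simp
  have hne1 : (1 / d - a * k) ^ 2 - D d ≠ 0 := by
    intro h0
    rw [h0, zero_div] at hw'
    exact (pow_ne_zero 2 hq0.ne') hw'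
  have hh : 1 / d - a * k ≠ 0 := by
    intro h0
    rw [hH, h0, zero_div] at hH1
    linarith
  have hne2 : k ^ 2 - (1 / d - a * k) ≠ 0 := by
    intro h0
    have : depthFun a d = 1 := by
      rw [hH, ← sub_eq_zero.mp h0, div_self (by positivity)]
    linarith
  simp only [hF, ← hkdef]
  rw [← pow_mul_phi_eq_phiStag hk0 hh hne1 hne2, mu2_eq_depthFun hd.2 hkd,
    qinv_depthFun hd.2 hkd]
  change _ = (d - s) ^ 4 * (phi a k (depthFun a d) (q d ^ 2) / d)
  rw [hw', hH]
  generalize phi a k ((1 / d - a * k) / k ^ 2) (((1 / d - a * k) ^ 2 - D d) / k ^ 4) = Φ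
  have e1 : k = (d - s) * (-a * (d + s) / (2 * d)) / d := by rw [hkdef, hkap d hd0]
  have h6 : a * (d + s) ≠ 0 := by positivity
  rw [e1]
  have : d + s ≠ 0 := by positivity
  field_simp

lemma stagnation_behaviour {a : ℝ} (ha : 0 < a) :
    (fun d => mu2 a d - -2 / a ^ 4 * ((d - stagnationDepth a) ^ 4)⁻¹)
        =O[𝓝[≠] stagnationDepth a] (fun d => ((d - stagnationDepth a) ^ 3)⁻¹) ∧
      Tendsto (mu2 a) (𝓝[≠] stagnationDepth a) atBot := by
  have key := stagnation_asymptotics ha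
  set s := stagnationDepth a
  have hne : ∀ᶠ d in 𝓝[≠] s, d ≠ s := eventually_mem_nhdsWithin
  refine ⟨sub_div_isBigO_of_mul 3 hne key (Eventually.of_forall fun d => rfl), ?_⟩
  have hsub : Tendsto (fun d => d - s) (𝓝[≠] s) (𝓝 0) := by
    have : Tendsto (fun d => d - s) (𝓝 s) (𝓝 (s - s)) :=
      (continuous_id.sub continuous_const).tendsto s
    rw [sub_self] at this
    exact this.mono_left nhdsWithin_le_nhds
  have h1 : Tendsto (fun d => (d - s) ^ 4) (𝓝[≠] s) (𝓝[>] 0) := by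
    refine tendsto_nhdsWithin_iff.mpr ⟨by simpa using hsub.pow 4, ?_⟩
    filter_upwards [hne] with d hd
    have := sub_ne_zero.mpr hd
    show 0 < (d - s) ^ 4
    positivity
  have h2 : Tendsto (fun d => ((d - s) ^ 4)⁻¹) (𝓝[≠] s) atTop := tendsto_inv_nhdsGT_zero.comp h1
  have h3 : Tendsto (fun d => (d - s) ^ 4 * mu2 a d) (𝓝[≠] s) (𝓝 (-2 / a ^ 4)) := by
    have := (key.trans_tendsto hsub).add_const (-2 / a ^ 4)
    simpa using this
  have hL : -2 / a ^ 4 < 0 := div_neg_of_neg_of_pos (by norm_num) (by positivity)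
  refine (h2.atTop_mul_neg hL h3).congr' ?_
  filter_upwards [hne] with d hd
  have := sub_ne_zero.mpr hd
  field_simp

/-! ### Infinite depth -/

/-- The coefficient of the leading term at infinite depth, as a function of `q ^ 2`. -/
def deepCoef (w : ℝ) : ℝ := (w ^ 3 - 11 * w ^ 2 + 28 * w - 16) / (8 * w)

lemma eq_two_tanh_iff {q : ℝ} (hq : 0 < q) : q = 2 * Real.tanh q ↔ qcoth q = 2 := by
  have hs := (Real.sinh_pos_iff.mpr hq).ne'
  have hc := (Real.cosh_pos q).ne'
  rw [qcoth, Real.tanh_eq_sinh_div_cosh, div_eq_iff hs, mul_div_assoc', eq_div_iff hc]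

/-- Clearing denominators turns the sign of `2 - q coth q` into that of `exp (2q) (2 - q) - (2 +
q)`, which needs only numerical bounds for `exp`. -/
lemma two_sub_qcoth_mul {q : ℝ} (hq : 0 < q) :
    (2 - qcoth q) * (2 * Real.exp q * Real.sinh q)
      = Real.exp q ^ 2 * (2 - q) - (2 + q) := by
  have hs := (Real.sinh_pos_iff.mpr hq).ne'
  have h : Real.exp (-q) * Real.exp q = 1 := by rw [← Real.exp_add]; simp
  have e : (2 - qcoth q) * (2 * Real.exp q * Real.sinh q)
      = 2 * Real.exp q * (2 * Real.sinh q - q * Real.cosh q) := by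
    rw [qcoth]
    field_simp
  rw [e, Real.sinh_eq, Real.cosh_eq]
  linear_combination (-(2 + q)) * h

lemma deep_root : ∃ q : ℝ, q ∈ Ioo 1.91498 1.915009 ∧ qcoth q = 2 := by
  have h1 : qcoth 1.91498 < 2 := by
    refine sub_pos.mp (pos_of_mul_pos_left (b := 2 * Real.exp 1.91498 * Real.sinh 1.91498) ?_ ?_)
    swap
    · have := Real.sinh_pos_iff.mpr (show (0 : ℝ) < 1.91498 by norm_num)
      positivity
    rw [two_sub_qcoth_mul (by norm_num)]
    have h := Real.sum_le_exp_of_nonneg (x := 0.95749) (by norm_num) 12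
    have e : Real.exp 1.91498 ^ 2 = Real.exp 0.95749 ^ 4 := by
      rw [← Real.exp_nat_mul, ← Real.exp_nat_mul]; norm_num
    have h' := pow_le_pow_left₀ (by positivity) h 4
    rw [e]
    -- A lower bound for `exp (2 * 1.91498)` that suffices because `46.05 * (2 - 1.91498) > 2 +
    -- 1.91498`.
    have : (46.05 : ℝ) ≤ (∑ i ∈ Finset.range 12, 0.95749 ^ i / (i.factorial : ℝ)) ^ 4 := by
      norm_num [Finset.sum_range_succ, Nat.factorial]
    linarith
  have h2 : 2 < qcoth 1.915009 := by
    have hs : 0 < 2 * Real.exp 1.915009 * Real.sinh 1.915009 := by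
      have := Real.sinh_pos_iff.mpr (show (0 : ℝ) < 1.915009 by norm_num)
      positivity
    refine sub_neg.mp (neg_of_mul_neg_left (b := 2 * Real.exp 1.915009 * Real.sinh 1.915009) ?_
      hs.le)
    rw [two_sub_qcoth_mul (by norm_num)]
    -- The remainder bound requires an argument in `[0, 1]`; hence half the endpoint and the fourth
    -- power below.
    have h := Real.exp_bound' (x := 0.9575045) (by norm_num) (by norm_num) (n := 12) (by norm_num)
    have e : Real.exp 1.915009 ^ 2 = Real.exp 0.9575045 ^ 4 := by
      rw [← Real.exp_nat_mul, ← Real.exp_nat_mul]; norm_num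
    have h' := pow_le_pow_left₀ (Real.exp_pos _).le h 4
    rw [e]
    have : (∑ m ∈ Finset.range 12, 0.9575045 ^ m / (m.factorial : ℝ)
        + 0.9575045 ^ 12 * ((12 : ℕ) + 1) / ((Nat.factorial 12 : ℕ) * (12 : ℕ))) ^ 4
          ≤ (46.0637 : ℝ) := by
      norm_num [Finset.sum_range_succ, Nat.factorial]
    linarith
  obtain ⟨q, hq, h⟩ := exists_qcoth_eq (by norm_num) (by norm_num) ⟨h1.le, h2.le⟩
  refine ⟨q, ⟨lt_of_le_of_ne hq.1 ?_, lt_of_le_of_ne hq.2 ?_⟩, h⟩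
  · rintro rfl; linarith
  · rintro rfl; linarith

lemma deepCoef_bounds {q : ℝ} (hq : q ∈ Ioo 1.91498 1.915009) :
    |deepCoef (q ^ 2) - (-0.4067)| < 0.00005 := by
  have h1 : 3.6671 < q ^ 2 := by nlinarith [hq.1]
  have h2 : q ^ 2 < 3.667259471 := by nlinarith [hq.1, hq.2]
  generalize q ^ 2 = w at *
  have hw : 0 < 8 * w := by linarith
  have e : deepCoef w - (-0.4067) = (w ^ 3 - 11 * w ^ 2 + 28 * w - 16 + 0.4067 * (8 * w))
      / (8 * w) := by
    rw [deepCoef]; field_simp; ring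
  rw [e, abs_lt, lt_div_iff₀ hw, div_lt_iff₀ hw]
  have h3 : 0 < (w - 3.6671) * (3.667259471 - w) :=
    mul_pos (by linarith) (by linarith)
  constructor
  · nlinarith
  · nlinarith

/-- In the variable `e = 1 / d` one has `κ / d = e ^ 2 - a / 2`, so infinite depth becomes the
regular point `e = 0`, where `k = -a / 2`, `H = 2` and `qinv H = q`. Then `mu2 = e * F e` with `F`
differentiable at `0`. -/
lemma deep_asymptotics {a q : ℝ} (ha : a ≠ 0) (hq : 0 < q) (hq2 : qcoth q = 2) :
    (fun d => mu2 a d - deepCoef (q ^ 2) * a ^ 2 * d⁻¹) =O[atTop] fun d : ℝ => (d ^ 2)⁻¹ := by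
  set k : ℝ → ℝ := fun e => e ^ 2 - a / 2 with hk
  set H : ℝ → ℝ := fun e => (e - a * k e) / k e ^ 2 with hH
  have hk0 : k 0 ≠ 0 := by simpa [hk] using ha
  have hH0 : H 0 = 2 := by
    simp only [hH, hk]
    field_simp
    norm_num
    field_simp
  set F : ℝ → ℝ := fun e => phi a (k e) (H e) (qinv (H e) ^ 2) with hF
  have hkd : DifferentiableAt ℝ k 0 := by simp only [hk]; fun_prop
  have hHd : DifferentiableAt ℝ H 0 := by
    simp only [hH]
    fun_prop (disch := exact pow_ne_zero 2 hk0)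
  have hqd : DifferentiableAt ℝ (fun e => qinv (H e)) 0 := by
    refine DifferentiableAt.comp (0 : ℝ) (g := qinv) (f := H) ?_ hHd
    rw [hH0, ← hq2]
    exact differentiableAt_qinv hq
  have hqi : qinv 2 = q := by rw [← hq2, qinv_qcoth hq]
  have hFd : DifferentiableAt ℝ F 0 := by
    have h3 : DifferentiableAt ℝ (fun p : ℝ × ℝ × ℝ => phi a p.1 p.2.1 p.2.2)
        (k 0, H 0, qinv (H 0) ^ 2) := by
      rw [hH0, hqi]
      unfold phi
      fun_prop (disch := norm_num [hk0, hq.ne'])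
    exact DifferentiableAt.comp (g := fun p : ℝ × ℝ × ℝ => phi a p.1 p.2.1 p.2.2)
      (f := fun e => (k e, H e, qinv (H e) ^ 2)) (0 : ℝ) h3 (by fun_prop)
  have hF0 : F 0 = deepCoef (q ^ 2) * a ^ 2 := by
    have hk1 : k 0 = -a / 2 := by simp only [hk]; ring
    simp only [hF, hH0, hqi, phi, deepCoef, hk1]
    have := hq.ne'
    have hw : q ^ 2 ≠ 0 := by positivity
    generalize q ^ 2 = w at *
    field_simp
    ring
  have hlim : Tendsto (fun d : ℝ => d⁻¹) atTop (𝓝 0) := tendsto_inv_atTop_zero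
  have h1 := (hFd.isBigO_sub.comp_tendsto hlim).mul (isBigO_refl (fun d : ℝ => d⁻¹) atTop)
  have hkev : ∀ᶠ d in atTop, k d⁻¹ ≠ 0 :=
    (hkd.continuousAt.tendsto.comp hlim).eventually_ne hk0
  refine h1.congr' ?_ ?_
  · filter_upwards [hkev, eventually_gt_atTop (criticalDepth a)] with d hd1 hd
    have hd0 := pos_of_criticalDepth_lt hd
    have e1 : kappa a d / d = k d⁻¹ := by
      rw [kappa_eq]; simp only [hk]; field_simp
    have hkd : kappa a d ≠ 0 := by
      intro h
      rw [h, zero_div] at e1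
      exact hd1 e1.symm
    have e2 : depthFun a d = H d⁻¹ := by
      simp only [hH]
      rw [← e1, depthFun]
      field_simp
    rw [mu2_eq_depthFun hd hkd, e1, e2]
    simp only [Function.comp, hF0]
    simp only [hF]
    ring
  · filter_upwards [eventually_gt_atTop 0] with d hd
    simp only [Function.comp, sub_zero]
    field_simp

/-! ### Sign change of `mu2` -/

lemma continuousOn_mu2 (a : ℝ) :
    ContinuousOn (mu2 a) {d | criticalDepth a < d ∧ kappa a d ≠ 0} := by
  have hc : ContinuousOn (fun d => phi a (kappa a d / d) (depthFun a d)
      (qinv (depthFun a d) ^ 2) / d) {d | criticalDepth a < d ∧ kappa a d ≠ 0} := by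
    intro d hd
    have hd0 := pos_of_criticalDepth_lt hd.1
    have hkd := hd.2
    have hq := mul_pos (tauStar_pos hd.1 hd.2) hd0
    have hH1 := depthFun_gt_one hd.1 hd.2
    have hkc := continuousAt_kappa a hd0
    have hHc : ContinuousAt (depthFun a) d := by
      unfold depthFun
      fun_prop (disch := positivity)
    have hqc : ContinuousAt (fun d => qinv (depthFun a d)) d := by
      refine ContinuousAt.comp (g := qinv) (f := depthFun a) ?_ hHc
      rw [depthFun, ← qcoth_tauStar hd.1 hd.2]
      exact (differentiableAt_qinv hq).continuousAt
    have h3 : ContinuousAt (fun p : ℝ × ℝ × ℝ => phi a p.1 p.2.1 p.2.2)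
        (kappa a d / d, depthFun a d, qinv (depthFun a d) ^ 2) := by
      rw [qinv_depthFun hd.1 hd.2]
      have h1 : 1 - depthFun a d ≠ 0 := by linarith
      have h2 : depthFun a d ≠ 0 := by linarith
      have h3 : kappa a d / d ≠ 0 := by positivity
      unfold phi
      fun_prop (disch := first | exact h2 | (simp only [ne_eq]; positivity))
    have h4 : ContinuousAt (fun d => phi a (kappa a d / d) (depthFun a d)
        (qinv (depthFun a d) ^ 2)) d :=
      ContinuousAt.comp (g := fun p : ℝ × ℝ × ℝ => phi a p.1 p.2.1 p.2.2)
        (f := fun d => (kappa a d / d, depthFun a d, qinv (depthFun a d) ^ 2)) h3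
        (by fun_prop (disch := exact hd0.ne'))
    exact (h4.div continuousAt_id hd0.ne').continuousWithinAt
  exact hc.congr fun d hd => mu2_eq_depthFun hd.1 hd.2

lemma kappa_pos_of_nonpos {a d : ℝ} (ha : a ≤ 0) (hd : 0 < d) : 0 < kappa a d := by
  rw [kappa_eq]
  have h1 : 0 < 1 / d := by positivity
  have h2 : a * d ≤ 0 := mul_nonpos_of_nonpos_of_nonneg ha hd.le
  linarith

/-- For `a = 0` the coefficient of the deep-water term degenerates, so one explicit depth is tested.
At `d = 2`, `κ = 1 / 2` and `H = 8`, hence `q ^ 2 = 64 - (q / sinh q) ^ 2` lies in `(63, 64)`, where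
the rational expression for `mu2` has a definite sign. -/
lemma mu2_zero_two_neg : mu2 0 2 < 0 := by
  have hd : criticalDepth 0 < 2 := by
    obtain ⟨hc, h, -⟩ := criticalDepth_spec 0
    by_contra h2
    have := pow_le_pow_left₀ (by norm_num) (not_lt.mp h2) 3
    norm_num at h this
    linarith
  have hk : kappa 0 2 = 1 / 2 := by rw [kappa_eq]; norm_num
  have hk0 : kappa 0 2 ≠ 0 := by rw [hk]; norm_num
  have hH : qcoth (tauStar 0 2 * 2) = 8 := by
    rw [qcoth_tauStar hd hk0, hk]; norm_num
  have hq : 0 < tauStar 0 2 * 2 := mul_pos (tauStar_pos hd hk0) (by norm_num)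
  rw [mu2_eq hd hk0, hH, hk]
  generalize tauStar 0 2 * 2 = q at *
  have hs := Real.self_lt_sinh_iff.mpr hq
  have hs0 := hq.trans hs
  have hw : q ^ 2 = 64 - q ^ 2 / Real.sinh q ^ 2 := by
    have h64 : (64 : ℝ) = qcoth q ^ 2 := by rw [hH]; norm_num
    rw [h64, qcoth]
    field_simp
    linear_combination -Real.cosh_sq q
  have h1 : q ^ 2 / Real.sinh q ^ 2 < 1 := by
    rw [div_lt_one (by positivity)]
    gcongr
  have h2 : 0 < q ^ 2 / Real.sinh q ^ 2 := by positivity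
  have h3 : q ^ 2 < 64 := by linarith
  have h4 : 63 < q ^ 2 := by linarith
  generalize q ^ 2 = w at *
  have hw0 : w ≠ 0 := by linarith
  have e : phi 0 (1 / 2 / 2) 8 w / 2
      = -(4128768 - 104448 * w + 1648 * w ^ 2 - 4 * w ^ 3) / (1792 * w) := by
    rw [phi]
    field_simp
    ring
  rw [e]
  refine div_neg_of_neg_of_pos ?_ (by linarith)
  have h5 : 0 < (64 - w) * (w - 63) := mul_pos (by linarith) (by linarith)
  nlinarith

/-- Intermediate value theorem between the blow-up `+∞` at the critical depth and a depth with `mu2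
< 0`. Continuity of `mu2` requires `κ ≠ 0` on the whole interval: automatic for `a ≤ 0`, and for `a
> 0` ensured by staying to the left of the stagnation depth. -/
lemma exists_mu2_eq_zero (a : ℝ) : ∃ d₀ : ℝ, criticalDepth a < d₀ ∧ kappa a d₀ ≠ 0 ∧
    mu2 a d₀ = 0 ∧ (0 < a → d₀ < stagnationDepth a) := by
  obtain ⟨hc, h, -⟩ := criticalDepth_spec a
  have htop := (critical_behaviour a).2
  suffices hneg : ∃ d, criticalDepth a < d ∧ mu2 a d < 0 ∧
      ∀ x, criticalDepth a < x → x ≤ d → kappa a x ≠ 0 ∧ (0 < a → x < stagnationDepth a) by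
    obtain ⟨d, hd, hneg, hall⟩ := hneg
    obtain ⟨e, he, hed, hce⟩ : ∃ e, 0 < mu2 a e ∧ e < d ∧ criticalDepth a < e :=
      ((htop.eventually_gt_atTop 0).and ((show ∀ᶠ x in 𝓝[>] criticalDepth a, x < d from
        nhdsWithin_le_nhds (Iio_mem_nhds hd)).and eventually_mem_nhdsWithin)).exists
    have hcont : ContinuousOn (mu2 a) (Icc e d) :=
      (continuousOn_mu2 a).mono fun x hx => ⟨hce.trans_le hx.1, (hall x (hce.trans_le hx.1) hx.2).1⟩
    obtain ⟨x, hx, h0⟩ := intermediate_value_Icc' hed.le hcont ⟨hneg.le, he.le⟩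
    have hcx := hce.trans_le hx.1
    exact ⟨x, hcx, (hall x hcx hx.2).1, h0, (hall x hcx hx.2).2⟩
  rcases lt_trichotomy a 0 with ha | ha | ha
  · obtain ⟨q, hq, hq2⟩ := deep_root
    have hm := deepCoef_bounds hq
    have hm0 : deepCoef (q ^ 2) < 0 := by
      rw [abs_lt] at hm; linarith [hm.2]
    have hq0 : 0 < q := lt_trans (by norm_num) hq.1
    have h1 := (deep_asymptotics ha.ne hq0 hq2).mul (isBigO_refl (fun d : ℝ => d) atTop)
    have h2 : Tendsto (fun d : ℝ => (d ^ 2)⁻¹ * d) atTop (𝓝 0) := by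
      refine tendsto_inv_atTop_zero.congr' ?_
      filter_upwards [eventually_gt_atTop 0] with d hd
      field_simp
    have h3 : Tendsto (fun d => mu2 a d * d) atTop (𝓝 (deepCoef (q ^ 2) * a ^ 2)) := by
      have := (h1.trans_tendsto h2).add_const (deepCoef (q ^ 2) * a ^ 2)
      rw [zero_add] at this
      refine this.congr' ?_
      filter_upwards [eventually_gt_atTop 0] with d hd
      field_simp
      ring
    have hneg : deepCoef (q ^ 2) * a ^ 2 < 0 :=
      mul_neg_of_neg_of_pos hm0 (by have := ha.ne; positivity)
    obtain ⟨d, hd1, hd2⟩ := ((h3.eventually_lt_const hneg).and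
      (eventually_gt_atTop (criticalDepth a))).exists
    refine ⟨d, hd2, ?_, fun x hx _ =>
      ⟨(kappa_pos_of_nonpos ha.le (hc.trans hx)).ne', fun h => absurd h ha.not_gt⟩⟩
    exact neg_of_mul_neg_left hd1 (hc.trans hd2).le
  · subst ha
    refine ⟨2, ?_, mu2_zero_two_neg, fun x hx _ =>
      ⟨(kappa_pos_of_nonpos le_rfl (hc.trans hx)).ne', fun h => absurd h (lt_irrefl _)⟩⟩
    by_contra h2
    have := pow_le_pow_left₀ (by norm_num) (not_lt.mp h2) 3
    norm_num at h this
    linarith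
  · have hcs := criticalDepth_lt_stagnationDepth ha
    have hbot : Tendsto (mu2 a) (𝓝[<] stagnationDepth a) atBot :=
      (stagnation_behaviour ha).2.mono_left
        (nhdsWithin_mono _ fun x (hx : x < stagnationDepth a) => hx.ne)
    obtain ⟨d, hd, hcd, hds⟩ : ∃ d, mu2 a d < 0 ∧ criticalDepth a < d ∧ d < stagnationDepth a :=
      ((hbot.eventually_lt_atBot 0).and ((show ∀ᶠ x in 𝓝[<] stagnationDepth a,
        criticalDepth a < x from nhdsWithin_le_nhds (Ioi_mem_nhds hcs)).and
        (eventually_mem_nhdsWithin (s := Iio (stagnationDepth a))))).exists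
    refine ⟨d, hcd, hd, fun x hx hxd => ⟨?_, fun _ => hxd.trans_lt hds⟩⟩
    rw [kappa_eq_mul_sub ha (hc.trans hx)]
    have h1 : 0 < a * (x + stagnationDepth a) :=
      mul_pos ha (add_pos (hc.trans hx) (hc.trans hcs))
    refine mul_ne_zero (sub_ne_zero.mpr (hxd.trans_lt hds).ne) (div_ne_zero (by linarith) ?_)
    have := hc.trans hx
    positivity

/-! ### Partial derivatives -/

/-- The partial derivative in the first variable of a function of two variables. -/
def dx (f : ℝ → ℝ → ℝ) (x y : ℝ) : ℝ := deriv (fun s => f s y) x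

/-- The partial derivative in the second variable of a function of two variables. -/
def dy (f : ℝ → ℝ → ℝ) (x y : ℝ) : ℝ := deriv (f x) y

/-- The partial derivative in `t` of a function of `(t, x, y)`. -/
def pt (f : ℝ → ℝ → ℝ → ℝ) (t x y : ℝ) : ℝ := deriv (fun s => f s x y) t

/-- The partial derivative in `x` of a function of `(t, x, y)`. -/
def px (f : ℝ → ℝ → ℝ → ℝ) (t x y : ℝ) : ℝ := deriv (fun s => f t s y) x

/-- The partial derivative in `y` of a function of `(t, x, y)`. -/
def py (f : ℝ → ℝ → ℝ → ℝ) (t x y : ℝ) : ℝ := deriv (fun s => f t x s) y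

/-- `u` is `C^n` at `(x, y)`. -/
def CD (n : ℕ) (u : ℝ → ℝ → ℝ) (x y : ℝ) : Prop :=
  ContDiffAt ℝ n (fun p : ℝ × ℝ => u p.1 p.2) (x, y)

/-- `f` is analytic at `(t, x, y)`. -/
def An (f : ℝ → ℝ → ℝ → ℝ) (t x y : ℝ) : Prop :=
  AnalyticAt ℝ (fun p : ℝ × ℝ × ℝ => f p.1 p.2.1 p.2.2) (t, x, y)

section two

variable {u : ℝ → ℝ → ℝ} {x y : ℝ} {n : ℕ}

lemma CD.hasFDerivAt (h : CD n u x y) (hn : 1 ≤ n) :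
    HasFDerivAt (fun p : ℝ × ℝ => u p.1 p.2)
      (fderiv ℝ (fun p : ℝ × ℝ => u p.1 p.2) (x, y)) (x, y) :=
  (ContDiffAt.differentiableAt h (by exact_mod_cast (Nat.one_le_iff_ne_zero.mp hn))).hasFDerivAt

lemma CD.dx_eq (h : CD n u x y) (hn : 1 ≤ n) :
    dx u x y = fderiv ℝ (fun p : ℝ × ℝ => u p.1 p.2) (x, y) (1, 0) := by
  have h1 : HasDerivAt (fun s : ℝ => (s, y)) ((1, 0) : ℝ × ℝ) x :=
    (hasDerivAt_id x).prodMk (hasDerivAt_const x y)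
  exact ((h.hasFDerivAt hn).comp_hasDerivAt x h1).deriv

lemma CD.dy_eq (h : CD n u x y) (hn : 1 ≤ n) :
    dy u x y = fderiv ℝ (fun p : ℝ × ℝ => u p.1 p.2) (x, y) (0, 1) := by
  have h1 : HasDerivAt (fun s : ℝ => (x, s)) ((0, 1) : ℝ × ℝ) y :=
    (hasDerivAt_const y x).prodMk (hasDerivAt_id y)
  exact ((h.hasFDerivAt hn).comp_hasDerivAt y h1).deriv

/-- The chain rule along a curve. -/
lemma CD.hasDerivAt_comp (h : CD n u x y) (hn : 1 ≤ n) {α β : ℝ → ℝ} {s α' β' : ℝ}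
    (hα : HasDerivAt α α' s) (hβ : HasDerivAt β β' s) (hx : α s = x) (hy : β s = y) :
    HasDerivAt (fun s => u (α s) (β s)) (dx u x y * α' + dy u x y * β') s := by
  subst hx hy
  have h1 := (h.hasFDerivAt hn).comp_hasDerivAt s (hα.prodMk hβ)
  refine h1.congr_deriv ?_
  rw [h.dx_eq hn, h.dy_eq hn]
  have : ((α', β') : ℝ × ℝ) = α' • (1, 0) + β' • (0, 1) := by simp
  rw [this, map_add, map_smul, map_smul]
  simp [mul_comm]

lemma CD.eventually (h : CD n u x y) : ∀ᶠ p in 𝓝 (x, y), CD n u p.1 p.2 :=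
  ContDiffAt.eventually h (by simp)

lemma CD.dx (h : CD (n + 1) u x y) : CD n (dx u) x y := by
  have h1 : ContDiffAt ℝ n (fun p : ℝ × ℝ =>
      fderiv ℝ (fun p : ℝ × ℝ => u p.1 p.2) p (1, 0)) (x, y) :=
    (ContDiffAt.fderiv_right h (by simp)).clm_apply contDiffAt_const
  exact h1.congr_of_eventuallyEq (h.eventually.mono fun p hp => hp.dx_eq (by simp))

lemma CD.dy (h : CD (n + 1) u x y) : CD n (dy u) x y := by
  have h1 : ContDiffAt ℝ n (fun p : ℝ × ℝ =>
      fderiv ℝ (fun p : ℝ × ℝ => u p.1 p.2) p (0, 1)) (x, y) :=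
    (ContDiffAt.fderiv_right h (by simp)).clm_apply contDiffAt_const
  exact h1.congr_of_eventuallyEq (h.eventually.mono fun p hp => hp.dy_eq (by simp))

lemma CD.of_le {m : ℕ} (h : CD n u x y) (hm : m ≤ n) : CD m u x y :=
  ContDiffAt.of_le h (by exact_mod_cast hm)

lemma CD.continuousAt (h : CD n u x y) : ContinuousAt (fun p : ℝ × ℝ => u p.1 p.2) (x, y) :=
  ContDiffAt.continuousAt h

end two

section three

variable {f : ℝ → ℝ → ℝ → ℝ} {t x y : ℝ}

lemma An.hasFDerivAt (h : An f t x y) :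
    HasFDerivAt (fun p : ℝ × ℝ × ℝ => f p.1 p.2.1 p.2.2)
      (fderiv ℝ (fun p : ℝ × ℝ × ℝ => f p.1 p.2.1 p.2.2) (t, x, y)) (t, x, y) :=
  (AnalyticAt.differentiableAt h).hasFDerivAt

lemma An.eventually (h : An f t x y) : ∀ᶠ p in 𝓝 (t, x, y), An f p.1 p.2.1 p.2.2 :=
  AnalyticAt.eventually_analyticAt h

lemma An.pt_eq (h : An f t x y) :
    pt f t x y = fderiv ℝ (fun p : ℝ × ℝ × ℝ => f p.1 p.2.1 p.2.2) (t, x, y) (1, 0, 0) := by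
  have h1 : HasDerivAt (fun s : ℝ => (s, x, y)) ((1, 0, 0) : ℝ × ℝ × ℝ) t :=
    ((hasDerivAt_id t).prodMk ((hasDerivAt_const t x).prodMk (hasDerivAt_const t y)))
  exact (h.hasFDerivAt.comp_hasDerivAt t h1).deriv

lemma An.px_eq (h : An f t x y) :
    px f t x y = fderiv ℝ (fun p : ℝ × ℝ × ℝ => f p.1 p.2.1 p.2.2) (t, x, y) (0, 1, 0) := by
  have h1 : HasDerivAt (fun s : ℝ => (t, s, y)) ((0, 1, 0) : ℝ × ℝ × ℝ) x :=
    ((hasDerivAt_const x t).prodMk ((hasDerivAt_id x).prodMk (hasDerivAt_const x y)))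
  exact (h.hasFDerivAt.comp_hasDerivAt x h1).deriv

lemma An.py_eq (h : An f t x y) :
    py f t x y = fderiv ℝ (fun p : ℝ × ℝ × ℝ => f p.1 p.2.1 p.2.2) (t, x, y) (0, 0, 1) := by
  have h1 : HasDerivAt (fun s : ℝ => (t, x, s)) ((0, 0, 1) : ℝ × ℝ × ℝ) y :=
    ((hasDerivAt_const y t).prodMk ((hasDerivAt_const y x).prodMk (hasDerivAt_id y)))
  exact (h.hasFDerivAt.comp_hasDerivAt y h1).deriv

lemma An.fderiv_apply (h : An f t x y) (e : ℝ × ℝ × ℝ) :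
    AnalyticAt ℝ (fun p => fderiv ℝ (fun p : ℝ × ℝ × ℝ => f p.1 p.2.1 p.2.2) p e) (t, x, y) :=
  ((ContinuousLinearMap.apply ℝ ℝ e).analyticAt _).fun_comp (AnalyticAt.fderiv h)

lemma An.pt (h : An f t x y) : An (pt f) t x y :=
  (h.fderiv_apply (1, 0, 0)).congr (h.eventually.mono fun _ hp => hp.pt_eq.symm)

lemma An.px (h : An f t x y) : An (px f) t x y :=
  (h.fderiv_apply (0, 1, 0)).congr (h.eventually.mono fun _ hp => hp.px_eq.symm)

lemma An.py (h : An f t x y) : An (py f) t x y :=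
  (h.fderiv_apply (0, 0, 1)).congr (h.eventually.mono fun _ hp => hp.py_eq.symm)

/-- The chain rule along a curve. -/
lemma An.hasDerivAt_comp (h : An f t x y) {α β γ : ℝ → ℝ} {s α' β' γ' : ℝ}
    (hα : HasDerivAt α α' s) (hβ : HasDerivAt β β' s) (hγ : HasDerivAt γ γ' s)
    (ht : α s = t) (hx : β s = x) (hy : γ s = y) :
    HasDerivAt (fun s => f (α s) (β s) (γ s))
      (StokesWave.pt f t x y * α' + StokesWave.px f t x y * β' + StokesWave.py f t x y * γ') s := by
  subst ht hx hy
  have h1 := h.hasFDerivAt.comp_hasDerivAt s (hα.prodMk (hβ.prodMk hγ))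
  refine h1.congr_deriv ?_
  rw [h.pt_eq, h.px_eq, h.py_eq]
  have : ((α', β', γ') : ℝ × ℝ × ℝ) = α' • (1, 0, 0) + β' • (0, 1, 0) + γ' • (0, 0, 1) := by simp
  rw [this, map_add, map_add, map_smul, map_smul, map_smul]
  simp [mul_comm]

lemma An.hasDerivAt_t (h : An f t x y) :
    HasDerivAt (fun s => f s x y) (StokesWave.pt f t x y) t := by
  simpa using h.hasDerivAt_comp (hasDerivAt_id t) (hasDerivAt_const t x) (hasDerivAt_const t y)
    rfl rfl rfl

lemma An.hasDerivAt_x (h : An f t x y) :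
    HasDerivAt (fun s => f t s y) (StokesWave.px f t x y) x := by
  simpa using h.hasDerivAt_comp (hasDerivAt_const x t) (hasDerivAt_id x) (hasDerivAt_const x y)
    rfl rfl rfl

lemma An.analyticAt_t (h : An f t x y) : AnalyticAt ℝ (fun s => f s x y) t := by
  have : AnalyticAt ℝ (fun s : ℝ => (s, x, y)) t := by fun_prop
  exact AnalyticAt.fun_comp_of_eq (g := fun p : ℝ × ℝ × ℝ => f p.1 p.2.1 p.2.2) h this rfl

lemma An.analyticAt_y (h : An f t x y) : AnalyticAt ℝ (fun s => f t x s) y := by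
  have : AnalyticAt ℝ (fun s : ℝ => (t, x, s)) y := by fun_prop
  exact AnalyticAt.fun_comp_of_eq (g := fun p : ℝ × ℝ × ℝ => f p.1 p.2.1 p.2.2) h this rfl

lemma An.cd (h : An f t x y) (n : ℕ) : CD n (f t) x y := by
  have : AnalyticAt ℝ (fun p : ℝ × ℝ => (t, p.1, p.2)) (x, y) :=
    analyticAt_const.prod (analyticAt_fst.prod analyticAt_snd)
  exact (AnalyticAt.fun_comp_of_eq (g := fun p : ℝ × ℝ × ℝ => f p.1 p.2.1 p.2.2) h this rfl).contDiffAt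

/-- Symmetry of the second derivative; all the commutation rules for `pt`, `px`, `py` are instances
of it. -/
lemma An.fderiv_comm (h : An f t x y) (e e' : ℝ × ℝ × ℝ) :
    fderiv ℝ (fun p => fderiv ℝ (fun p : ℝ × ℝ × ℝ => f p.1 p.2.1 p.2.2) p e) (t, x, y) e'
      = fderiv ℝ (fun p => fderiv ℝ (fun p : ℝ × ℝ × ℝ => f p.1 p.2.1 p.2.2) p e')
        (t, x, y) e := by
  have hd : DifferentiableAt ℝ (fderiv ℝ (fun p : ℝ × ℝ × ℝ => f p.1 p.2.1 p.2.2)) (t, x, y) :=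
    (AnalyticAt.fderiv h).differentiableAt
  have hs : IsSymmSndFDerivAt ℝ (fun p : ℝ × ℝ × ℝ => f p.1 p.2.1 p.2.2) (t, x, y) :=
    (AnalyticAt.contDiffAt h (n := ⊤)).isSymmSndFDerivAt (by simp)
  rw [fderiv_clm_apply hd (by fun_prop), fderiv_clm_apply hd (by fun_prop)]
  simpa using hs e' e

lemma An.pt_px (h : An f t x y) :
    StokesWave.pt (StokesWave.px f) t x y = StokesWave.px (StokesWave.pt f) t x y := by
  rw [h.px.pt_eq, h.pt.px_eq,
    Filter.EventuallyEq.fderiv_eq (h.eventually.mono fun _ hp => hp.px_eq),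
    Filter.EventuallyEq.fderiv_eq (h.eventually.mono fun _ hp => hp.pt_eq)]
  exact h.fderiv_comm _ _

lemma An.pt_py (h : An f t x y) :
    StokesWave.pt (StokesWave.py f) t x y = StokesWave.py (StokesWave.pt f) t x y := by
  rw [h.py.pt_eq, h.pt.py_eq,
    Filter.EventuallyEq.fderiv_eq (h.eventually.mono fun _ hp => hp.py_eq),
    Filter.EventuallyEq.fderiv_eq (h.eventually.mono fun _ hp => hp.pt_eq)]
  exact h.fderiv_comm _ _

lemma An.px_py (h : An f t x y) :
    StokesWave.px (StokesWave.py f) t x y = StokesWave.py (StokesWave.px f) t x y := by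
  rw [h.py.px_eq, h.px.py_eq,
    Filter.EventuallyEq.fderiv_eq (h.eventually.mono fun _ hp => hp.py_eq),
    Filter.EventuallyEq.fderiv_eq (h.eventually.mono fun _ hp => hp.px_eq)]
  exact h.fderiv_comm _ _

lemma An.eventually_t (h : An f t x y) : ∀ᶠ s in 𝓝 t, An f s x y :=
  ((by fun_prop : Continuous fun s : ℝ => (s, x, y)).tendsto t).eventually h.eventually

lemma An.eventually_x (h : An f t x y) : ∀ᶠ s in 𝓝 x, An f t s y :=
  ((by fun_prop : Continuous fun s : ℝ => (t, s, y)).tendsto x).eventually h.eventually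

lemma An.eventually_y (h : An f t x y) : ∀ᶠ s in 𝓝 y, An f t x s :=
  ((by fun_prop : Continuous fun s : ℝ => (t, x, s)).tendsto y).eventually h.eventually

lemma An.pt_px_px (h : An f t x y) :
    StokesWave.pt (StokesWave.px (StokesWave.px f)) t x y
      = StokesWave.px (StokesWave.px (StokesWave.pt f)) t x y := by
  rw [h.px.pt_px]
  exact Filter.EventuallyEq.deriv_eq (h.eventually_x.mono fun s hs => hs.pt_px)

lemma An.pt_py_py (h : An f t x y) :
    StokesWave.pt (StokesWave.py (StokesWave.py f)) t x y
      = StokesWave.py (StokesWave.py (StokesWave.pt f)) t x y := by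
  rw [h.py.pt_py]
  exact Filter.EventuallyEq.deriv_eq (h.eventually_y.mono fun s hs => hs.pt_py)

end three

/-- An analytic function that vanishes on one side of a point vanishes near it. -/
lemma eventually_zero_of_nhdsGT {f : ℝ → ℝ} {c : ℝ} (hf : AnalyticAt ℝ f c)
    (h : ∀ᶠ t in 𝓝[>] c, f t = 0) : ∀ᶠ t in 𝓝 c, f t = 0 := by
  refine hf.frequently_zero_iff_eventually_zero.mp ?_
  exact (h.frequently).filter_mono (nhdsWithin_mono _ fun x hx => ne_of_gt hx)

lemma eventually_zero_of_nhdsLT {f : ℝ → ℝ} {c : ℝ} (hf : AnalyticAt ℝ f c)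
    (h : ∀ᶠ t in 𝓝[<] c, f t = 0) : ∀ᶠ t in 𝓝 c, f t = 0 := by
  refine hf.frequently_zero_iff_eventually_zero.mp ?_
  exact (h.frequently).filter_mono (nhdsWithin_mono _ fun x hx => ne_of_lt hx)

open MeasureTheory

/-! ### Divergence theorem below a graph -/

/-- The open rectangle `(0, P) × (0, 1)`. -/
def rect (P : ℝ) : Set (ℝ × ℝ) := Ioo 0 P ×ˢ Ioo 0 1

lemma measurableSet_rect (P : ℝ) : MeasurableSet (rect P) := measurableSet_Ioo.prod measurableSet_Ioo

lemma rect_subset (P : ℝ) : rect P ⊆ Icc 0 P ×ˢ Icc 0 1 :=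
  prod_mono Ioo_subset_Icc_self Ioo_subset_Icc_self

lemma rect_ae_eq (P : ℝ) :
    (rect P : Set (ℝ × ℝ)) =ᵐ[volume] (Icc (0, 0) (P, 1) : Set (ℝ × ℝ)) := by
  rw [Icc_prod_eq]
  exact Measure.set_prod_ae_eq Ioo_ae_eq_Icc Ioo_ae_eq_Icc

lemma CD.continuousOn_dx {F : ℝ → ℝ → ℝ} {s : Set (ℝ × ℝ)} (hF : ∀ p ∈ s, CD 1 F p.1 p.2) :
    ContinuousOn (fun p : ℝ × ℝ => StokesWave.dx F p.1 p.2) s := fun p hp =>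
  ((CD.dx (n := 0) (hF p hp)).continuousAt).continuousWithinAt

lemma CD.continuousOn_dy {F : ℝ → ℝ → ℝ} {s : Set (ℝ × ℝ)} (hF : ∀ p ∈ s, CD 1 F p.1 p.2) :
    ContinuousOn (fun p : ℝ × ℝ => StokesWave.dy F p.1 p.2) s := fun p hp =>
  ((CD.dy (n := 0) (hF p hp)).continuousAt).continuousWithinAt

lemma divergence_rect {P : ℝ} (hP : 0 ≤ P) {F G : ℝ → ℝ → ℝ}
    (hF : ∀ p ∈ Icc ((0, 0) : ℝ × ℝ) (P, 1), CD 1 F p.1 p.2)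
    (hG : ∀ p ∈ Icc ((0, 0) : ℝ × ℝ) (P, 1), CD 1 G p.1 p.2) :
    ∫ p in rect P, (dx F p.1 p.2 + dy G p.1 p.2)
      = (((∫ x in 0..P, G x 1) - ∫ x in 0..P, G x 0) + ∫ s in 0..1, F P s)
        - ∫ s in 0..1, F 0 s := by
  have hsub : Ioo (0 : ℝ) P ×ˢ Ioo (0 : ℝ) 1 ⊆ Icc ((0, 0) : ℝ × ℝ) (P, 1) := by
    rw [Icc_prod_eq]; exact rect_subset P
  have hdF : ∀ p ∈ Icc ((0, 0) : ℝ × ℝ) (P, 1),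
      fderiv ℝ (fun p : ℝ × ℝ => F p.1 p.2) p (1, 0) = dx F p.1 p.2 :=
    fun p hp => ((hF p hp).dx_eq le_rfl).symm
  have hdG : ∀ p ∈ Icc ((0, 0) : ℝ × ℝ) (P, 1),
      fderiv ℝ (fun p : ℝ × ℝ => G p.1 p.2) p (0, 1) = dy G p.1 p.2 :=
    fun p hp => ((hG p hp).dy_eq le_rfl).symm
  have key := integral_divergence_prod_Icc_of_hasFDerivAt_of_le
    (fun p : ℝ × ℝ => F p.1 p.2) (fun p : ℝ × ℝ => G p.1 p.2)
    (fderiv ℝ fun p : ℝ × ℝ => F p.1 p.2) (fderiv ℝ fun p : ℝ × ℝ => G p.1 p.2)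
    (0, 0) (P, 1) ⟨hP, zero_le_one⟩
    (fun p hp => (hF p hp).continuousAt.continuousWithinAt)
    (fun p hp => (hG p hp).continuousAt.continuousWithinAt)
    (fun p hp => (hF p (hsub hp)).hasFDerivAt le_rfl)
    (fun p hp => (hG p (hsub hp)).hasFDerivAt le_rfl)
    (by
      refine ContinuousOn.integrableOn_compact isCompact_Icc
        (((CD.continuousOn_dx hF).add (CD.continuousOn_dy hG)).congr fun p hp => ?_)
      simp only [hdF p hp, hdG p hp, Pi.add_apply])
  rw [← key, setIntegral_congr_set (rect_ae_eq P)]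
  exact setIntegral_congr_fun measurableSet_Icc fun p hp => by
    simp only [hdF p hp, hdG p hp]

lemma contDiffAt_deriv {η : ℝ → ℝ} {x : ℝ} (h : ContDiffAt ℝ 2 η x) :
    ContDiffAt ℝ 1 (deriv η) x := by
  have h1 : ContDiffAt ℝ 1 (fun z => fderiv ℝ η z 1) x :=
    (ContDiffAt.fderiv_right h (by norm_num)).clm_apply contDiffAt_const
  exact h1.congr_of_eventuallyEq (Eventually.of_forall fun z => by simp)

lemma CD.flatten {X : ℝ → ℝ → ℝ} {η : ℝ → ℝ} {x s : ℝ} {n : ℕ} (hη : ContDiffAt ℝ n η x)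
    (hX : CD n X x (s * η x)) : CD n (fun x s => X x (s * η x)) x s := by
  have h1 : ContDiffAt ℝ n (fun p : ℝ × ℝ => (p.1, p.2 * η p.1)) (x, s) :=
    contDiffAt_fst.prodMk (contDiffAt_snd.mul (hη.comp (x, s) contDiffAt_fst))
  have h2 : ContDiffAt ℝ n (fun p : ℝ × ℝ => X p.1 p.2)
      ((fun p : ℝ × ℝ => (p.1, p.2 * η p.1)) (x, s)) := hX
  exact h2.comp (x, s) h1

/-- The map `(x, s) ↦ (x, s η(x))` sends a fixed rectangle to the fluid domain with Jacobian `η`.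
Integrals over the fluid are kept in this form throughout, which later allows differentiation in `t`
over a domain independent of `t`. -/
lemma divergence_graph {P : ℝ} (hP : 0 ≤ P) {η : ℝ → ℝ} (hη : ∀ x ∈ Icc 0 P, ContDiffAt ℝ 2 η x)
    (hη0 : ∀ x ∈ Icc 0 P, 0 ≤ η x) {X Y : ℝ → ℝ → ℝ}
    (hX : ∀ x ∈ Icc 0 P, ∀ y ∈ Icc 0 (η x), CD 1 X x y)
    (hY : ∀ x ∈ Icc 0 P, ∀ y ∈ Icc 0 (η x), CD 1 Y x y)
    (hper : ∀ s ∈ Icc (0 : ℝ) 1, η P * X P (s * η P) = η 0 * X 0 (s * η 0)) :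
    ∫ p in rect P, η p.1 * (dx X p.1 (p.2 * η p.1) + dy Y p.1 (p.2 * η p.1))
      = (∫ x in 0..P, (Y x (η x) - deriv η x * X x (η x))) - ∫ x in 0..P, Y x 0 := by
  have hmem : ∀ p ∈ Icc ((0, 0) : ℝ × ℝ) (P, 1), p.1 ∈ Icc 0 P ∧ p.2 ∈ Icc (0 : ℝ) 1 ∧
      p.2 * η p.1 ∈ Icc 0 (η p.1) := by
    intro p hp
    rw [Icc_prod_eq] at hp
    have h0 := hη0 p.1 hp.1
    exact ⟨hp.1, hp.2, mul_nonneg hp.2.1 h0, mul_le_of_le_one_left h0 hp.2.2⟩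
  -- `(F, G)` is the Piola transform of `(X, Y)`: its divergence in `(x, s)` is `η` times the
  -- divergence of `(X, Y)`, and its flux through `s = 1` is the flux through the graph.
  set F : ℝ → ℝ → ℝ := fun x s => η x * X x (s * η x) with hF
  set G : ℝ → ℝ → ℝ := fun x s => Y x (s * η x) - s * deriv η x * X x (s * η x) with hG
  have hη1 : ∀ x ∈ Icc 0 P, ContDiffAt ℝ 1 η x := fun x hx => (hη x hx).of_le (by norm_num)
  have hFc : ∀ p ∈ Icc ((0, 0) : ℝ × ℝ) (P, 1), CD 1 F p.1 p.2 := by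
    intro p hp
    obtain ⟨h1, h2, h3⟩ := hmem p hp
    have e := CD.flatten (n := 1) (by exact_mod_cast hη1 _ h1) (hX _ h1 _ h3)
    exact ((hη1 _ h1).comp (p.1, p.2) contDiffAt_fst).mul e
  have hGc : ∀ p ∈ Icc ((0, 0) : ℝ × ℝ) (P, 1), CD 1 G p.1 p.2 := by
    intro p hp
    obtain ⟨h1, h2, h3⟩ := hmem p hp
    have e := CD.flatten (n := 1) (by exact_mod_cast hη1 _ h1) (hX _ h1 _ h3)
    have e' := CD.flatten (n := 1) (by exact_mod_cast hη1 _ h1) (hY _ h1 _ h3)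
    exact ContDiffAt.sub e' ((contDiffAt_snd.mul
      ((contDiffAt_deriv (hη _ h1)).comp (p.1, p.2) contDiffAt_fst)).mul e)
  have key := divergence_rect hP hFc hGc
  have h1 : ∫ s in (0 : ℝ)..1, F P s = ∫ s in (0 : ℝ)..1, F 0 s := by
    refine intervalIntegral.integral_congr fun s hs => ?_
    rw [uIcc_of_le zero_le_one] at hs
    exact hper s hs
  rw [h1, add_sub_cancel_right] at key
  have h2 : ∀ x, G x 1 = Y x (η x) - deriv η x * X x (η x) := fun x => by simp [hG]
  have h3 : ∀ x, G x 0 = Y x 0 := fun x => by simp [hG]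
  simp only [h2, h3] at key
  rw [← key]
  refine setIntegral_congr_fun (measurableSet_rect P) fun p hp => ?_
  have hp' : p ∈ Icc ((0, 0) : ℝ × ℝ) (P, 1) := by
    rw [Icc_prod_eq]; exact rect_subset P hp
  obtain ⟨h1, h2, h3⟩ := hmem p hp'
  have hηd : HasDerivAt η (deriv η p.1) p.1 := ((hη _ h1).differentiableAt (by norm_num)).hasDerivAt
  have hXp := hX _ h1 _ h3
  have hYp := hY _ h1 _ h3
  have eF : dx F p.1 p.2 = deriv η p.1 * X p.1 (p.2 * η p.1) + η p.1 *
      (dx X p.1 (p.2 * η p.1) * 1 + dy X p.1 (p.2 * η p.1) * (p.2 * deriv η p.1)) :=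
    (hηd.mul (hXp.hasDerivAt_comp le_rfl (hasDerivAt_id p.1) (hηd.const_mul p.2) rfl rfl)).deriv
  have hs : HasDerivAt (fun s : ℝ => s * η p.1) (1 * η p.1) p.2 := (hasDerivAt_id p.2).mul_const _
  have eG : dy G p.1 p.2
      = dx Y p.1 (p.2 * η p.1) * 0 + dy Y p.1 (p.2 * η p.1) * (1 * η p.1)
        - (1 * deriv η p.1 * X p.1 (p.2 * η p.1) + p.2 * deriv η p.1 *
          (dx X p.1 (p.2 * η p.1) * 0 + dy X p.1 (p.2 * η p.1) * (1 * η p.1))) :=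
    ((hYp.hasDerivAt_comp le_rfl (hasDerivAt_const p.2 p.1) hs rfl rfl).sub
      (((hasDerivAt_id p.2).mul_const _).mul
        (hXp.hasDerivAt_comp le_rfl (hasDerivAt_const p.2 p.1) hs rfl rfl))).deriv
  simp only [eF, eG]
  ring

/-- Green's second identity for the operator `lam² ∂x² + ∂y²` below a graph. -/
lemma green_graph {P : ℝ} (hP : 0 ≤ P) (lam : ℝ) {η : ℝ → ℝ}
    (hη : ∀ x ∈ Icc 0 P, ContDiffAt ℝ 2 η x) (hη0 : ∀ x ∈ Icc 0 P, 0 ≤ η x)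
    (hηP : η P = η 0) {u v : ℝ → ℝ → ℝ}
    (hu : ∀ x ∈ Icc 0 P, ∀ y ∈ Icc 0 (η x), CD 2 u x y)
    (hv : ∀ x ∈ Icc 0 P, ∀ y ∈ Icc 0 (η x), CD 2 v x y)
    (hu0 : ∀ x ∈ Icc 0 P, u x 0 = 0) (hv0 : ∀ x ∈ Icc 0 P, v x 0 = 0)
    (huP : ∀ y ∈ Icc 0 (η 0), u P y = u 0 y) (hvP : ∀ y ∈ Icc 0 (η 0), v P y = v 0 y)
    (huP' : ∀ y ∈ Icc 0 (η 0), dx u P y = dx u 0 y)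
    (hvP' : ∀ y ∈ Icc 0 (η 0), dx v P y = dx v 0 y) :
    ∫ p in rect P, η p.1 *
        (v p.1 (p.2 * η p.1) * (lam ^ 2 * dx (dx u) p.1 (p.2 * η p.1)
            + dy (dy u) p.1 (p.2 * η p.1))
          - u p.1 (p.2 * η p.1) * (lam ^ 2 * dx (dx v) p.1 (p.2 * η p.1)
            + dy (dy v) p.1 (p.2 * η p.1)))
      = ∫ x in 0..P, ((v x (η x) * dy u x (η x) - u x (η x) * dy v x (η x))
          - deriv η x * (lam ^ 2 * (v x (η x) * dx u x (η x) - u x (η x) * dx v x (η x)))) := by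
  -- In the divergence of this field the products of first derivatives cancel. The lateral fluxes
  -- agree by periodicity and the bottom flux is zero.
  set X : ℝ → ℝ → ℝ := fun x y => lam ^ 2 * (v x y * dx u x y - u x y * dx v x y) with hX
  set Y : ℝ → ℝ → ℝ := fun x y => v x y * dy u x y - u x y * dy v x y with hY
  have h1u : ∀ x ∈ Icc 0 P, ∀ y ∈ Icc 0 (η x), CD 1 u x y := fun x hx y hy =>
    (hu x hx y hy).of_le (by norm_num)
  have h1v : ∀ x ∈ Icc 0 P, ∀ y ∈ Icc 0 (η x), CD 1 v x y := fun x hx y hy =>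
    (hv x hx y hy).of_le (by norm_num)
  have hXc : ∀ x ∈ Icc 0 P, ∀ y ∈ Icc 0 (η x), CD 1 X x y := fun x hx y hy =>
    contDiffAt_const.mul ((ContDiffAt.mul (h1v x hx y hy) (CD.dx (hu x hx y hy))).sub
      (ContDiffAt.mul (h1u x hx y hy) (CD.dx (hv x hx y hy))))
  have hYc : ∀ x ∈ Icc 0 P, ∀ y ∈ Icc 0 (η x), CD 1 Y x y := fun x hx y hy =>
    ContDiffAt.sub (ContDiffAt.mul (h1v x hx y hy) (CD.dy (hu x hx y hy)))
      (ContDiffAt.mul (h1u x hx y hy) (CD.dy (hv x hx y hy)))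
  have hper : ∀ s ∈ Icc (0 : ℝ) 1, η P * X P (s * η P) = η 0 * X 0 (s * η 0) := by
    intro s hs
    have h0 := hη0 0 ⟨le_rfl, hP⟩
    have hm : s * η 0 ∈ Icc 0 (η 0) := ⟨mul_nonneg hs.1 h0, mul_le_of_le_one_left h0 hs.2⟩
    simp only [hX, hηP, huP _ hm, hvP _ hm, huP' _ hm, hvP' _ hm]
  have key := divergence_graph hP hη hη0 hXc hYc hper
  have hY0 : ∫ x in 0..P, Y x 0 = 0 := by
    rw [intervalIntegral.integral_congr (g := fun _ => (0 : ℝ)), intervalIntegral.integral_zero]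
    intro x hx
    rw [uIcc_of_le hP] at hx
    simp [hY, hu0 x hx, hv0 x hx]
  rw [hY0, sub_zero] at key
  rw [← key]
  refine setIntegral_congr_fun (measurableSet_rect P) fun p hp => ?_
  have hx : p.1 ∈ Icc 0 P := (rect_subset P hp).1
  have h0 := hη0 p.1 hx
  have hs : p.2 ∈ Icc (0 : ℝ) 1 := (rect_subset P hp).2
  have hy : p.2 * η p.1 ∈ Icc 0 (η p.1) := ⟨mul_nonneg hs.1 h0, mul_le_of_le_one_left h0 hs.2⟩
  generalize p.2 * η p.1 = y at *
  generalize p.1 = x at *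
  have hcx : ∀ {w : ℝ → ℝ → ℝ}, CD 1 w x y → HasDerivAt (fun s => w s y) (dx w x y) x := by
    intro w hw
    simpa using hw.hasDerivAt_comp le_rfl (hasDerivAt_id x) (hasDerivAt_const x y) rfl rfl
  have hcy : ∀ {w : ℝ → ℝ → ℝ}, CD 1 w x y → HasDerivAt (fun s => w x s) (dy w x y) y := by
    intro w hw
    simpa using hw.hasDerivAt_comp le_rfl (hasDerivAt_const y x) (hasDerivAt_id y) rfl rfl
  have hu' := hu x hx y hy
  have hv' := hv x hx y hy
  have h1u' := h1u x hx y hy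
  have h1v' := h1v x hx y hy
  have eX : dx X x y = lam ^ 2 * ((dx v x y * dx u x y + v x y * dx (dx u) x y)
      - (dx u x y * dx v x y + u x y * dx (dx v) x y)) :=
    ((((hcx h1v').mul (hcx hu'.dx)).sub ((hcx h1u').mul (hcx hv'.dx))).const_mul _).deriv
  have eY : dy Y x y = (dy v x y * dy u x y + v x y * dy (dy u) x y)
      - (dy u x y * dy v x y + u x y * dy (dy v) x y) :=
    (((hcy h1v').mul (hcy hu'.dy)).sub ((hcy h1u').mul (hcy hv'.dy))).deriv
  simp only [eX, eY]
  ring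

/-! ### Integrals depending on a parameter -/

/-- Differentiation under the integral sign over a subset of a compact set. -/
lemma hasDerivAt_setIntegral {X : Type*} [NormedAddCommGroup X] [NormedSpace ℝ X]
    [MeasurableSpace X] [BorelSpace X] [SecondCountableTopology X] {ν : Measure X}
    [IsFiniteMeasureOnCompacts ν] {K S : Set X}
    (hK : IsCompact K) (hS : MeasurableSet S) (hSK : S ⊆ K) {Φ : ℝ → X → ℝ} {t₀ : ℝ}
    (hΦ : ∀ p ∈ K, ContDiffAt ℝ 2 (fun q : ℝ × X => Φ q.1 q.2) (t₀, p)) :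
    HasDerivAt (fun t => ∫ p in S, Φ t p ∂ν) (∫ p in S, deriv (fun t => Φ t p) t₀ ∂ν) t₀ := by
  set Φ' : ℝ → X → ℝ := fun t p => fderiv ℝ (fun q : ℝ × X => Φ q.1 q.2) (t, p) (1, 0) with hΦ'
  have hd : ∀ {t p}, ContDiffAt ℝ 2 (fun q : ℝ × X => Φ q.1 q.2) (t, p) →
      HasDerivAt (fun t => Φ t p) (Φ' t p) t := by
    intro t p h
    have h1 : HasDerivAt (fun t : ℝ => (t, p)) ((1, 0) : ℝ × X) t :=
      (hasDerivAt_id t).prodMk (hasDerivAt_const t p)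
    exact (h.differentiableAt (by norm_num)).hasFDerivAt.comp_hasDerivAt t h1
  have hc : ∀ {t p}, ContDiffAt ℝ 2 (fun q : ℝ × X => Φ q.1 q.2) (t, p) →
      ContinuousAt (fun q : ℝ × X => Φ' q.1 q.2) (t, p) := by
    intro t p h
    have : ContDiffAt ℝ 1 (fun q : ℝ × X => Φ' q.1 q.2) (t, p) :=
      (ContDiffAt.fderiv_right h (by norm_num)).clm_apply contDiffAt_const
    exact this.continuousAt
  have hev : ∀ᶠ t in 𝓝 t₀, ∀ p ∈ K, ContDiffAt ℝ 2 (fun q : ℝ × X => Φ q.1 q.2) (t, p) :=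
    hK.eventually_forall_of_forall_eventually fun p hp => (hΦ p hp).eventually (by simp)
  obtain ⟨M, hM⟩ : ∃ M, ∀ p ∈ K, ‖Φ' t₀ p‖ ≤ M := by
    have : ContinuousOn (fun p => Φ' t₀ p) K := fun p hp =>
      ((hc (hΦ p hp)).comp (f := fun p => (t₀, p)) (by fun_prop)).continuousWithinAt
    obtain ⟨M, hM⟩ := hK.bddAbove_image this.norm
    exact ⟨M, fun p hp => hM ⟨p, hp, rfl⟩⟩
  -- Compactness of `K` makes the bound uniform in `p`, so a constant serves as the dominating
  -- function.
  have hbd : ∀ᶠ t in 𝓝 t₀, ∀ p ∈ K, ‖Φ' t p‖ ≤ M + 1 := by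
    refine hK.eventually_forall_of_forall_eventually fun p hp => ?_
    have := (hc (hΦ p hp)).norm.eventually_lt_const
      (show ‖Φ' t₀ p‖ < M + 1 from (hM p hp).trans_lt (by linarith))
    exact this.mono fun q hq => hq.le
  have hcont : ∀ t, (∀ p ∈ K, ContDiffAt ℝ 2 (fun q : ℝ × X => Φ q.1 q.2) (t, p)) →
      ContinuousOn (fun p => Φ t p) K := fun t ht p hp =>
    ((ht p hp).continuousAt.comp (f := fun p => (t, p)) (by fun_prop)).continuousWithinAt
  have hcont' : ContinuousOn (fun p => Φ' t₀ p) K := fun p hp =>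
    ((hc (hΦ p hp)).comp (f := fun p => (t₀, p)) (by fun_prop)).continuousWithinAt
  have hfin : ν S < ⊤ := (measure_mono hSK).trans_lt hK.measure_lt_top
  have key := hasDerivAt_integral_of_dominated_loc_of_deriv_le (μ := ν.restrict S) (F := Φ)
    (F' := Φ') (bound := fun _ => M + 1) (x₀ := t₀) (𝕜 := ℝ) (hev.and hbd)
    (hev.mono fun t ht => ((hcont t ht).mono hSK).aestronglyMeasurable hS)
    (((hcont t₀ hΦ).integrableOn_compact hK).mono_set hSK)
    ((hcont'.mono hSK).aestronglyMeasurable hS)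
    ((ae_restrict_iff' hS).mpr (Eventually.of_forall fun p hp t ht => ht.2 p (hSK hp)))
    (by
      have : IsFiniteMeasure (ν.restrict S) := ⟨by simpa using hfin⟩
      exact integrable_const _)
    ((ae_restrict_iff' hS).mpr (Eventually.of_forall fun p hp t ht => hd (ht.1 p (hSK hp))))
  have e : ∫ p in S, deriv (fun t => Φ t p) t₀ ∂ν = ∫ p in S, Φ' t₀ p ∂ν :=
    setIntegral_congr_fun hS fun p hp => (hd (hΦ p (hSK hp))).deriv
  rw [e]
  exact key.2

/-! ### Green's identity on a strip with separated test functions -/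

/-- The derivative of `gam d τ`. -/
def gamD (d τ y : ℝ) : ℝ :=
  if τ = 0 then 1 / d else τ * Real.cosh (τ * y) / Real.sinh (τ * d)

lemma hasDerivAt_gam (d τ y : ℝ) : HasDerivAt (gam d τ) (gamD d τ y) y := by
  by_cases hτ : τ = 0
  · have e : gam d τ = fun y => y / d := by funext y; simp [gam, hτ]
    rw [e, gamD, if_pos hτ]
    exact (hasDerivAt_id y).div_const d
  · have e : gam d τ = fun y => Real.sinh (τ * y) / Real.sinh (τ * d) := by
      funext y; simp [gam, hτ]
    rw [e, gamD, if_neg hτ]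
    refine ((((hasDerivAt_id y).const_mul τ).sinh).div_const _).congr_deriv ?_
    simp only [id]
    ring

lemma hasDerivAt_gamD (d τ y : ℝ) : HasDerivAt (gamD d τ) (τ ^ 2 * gam d τ y) y := by
  by_cases hτ : τ = 0
  · have e : gamD d τ = fun _ => 1 / d := by funext y; simp [gamD, hτ]
    rw [e, hτ]
    simpa using hasDerivAt_const y (1 / d)
  · have e : gamD d τ = fun y => τ * Real.cosh (τ * y) / Real.sinh (τ * d) := by
      funext y; simp [gamD, hτ]
    rw [e, gam, if_neg hτ]
    refine (((((hasDerivAt_id y).const_mul τ).cosh).const_mul τ).div_const _).congr_deriv ?_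
    simp only [id]
    ring

lemma gam_zero_right (d τ : ℝ) : gam d τ 0 = 0 := by
  simp [gam]

lemma gam_self {d τ : ℝ} (hd : 0 < d) : gam d τ d = 1 := by
  rw [gam]
  split_ifs with h
  · exact div_self hd.ne'
  · refine div_self fun h0 => ?_
    rw [Real.sinh_eq_zero] at h0
    rcases mul_eq_zero.mp h0 with h1 | h1
    · exact h h1
    · exact hd.ne' h1

lemma gamD_self (d τ : ℝ) : gamD d τ d = gamSlope d τ := (hasDerivAt_gam d τ d).deriv.symm

lemma contDiff_gam (d τ : ℝ) (n : ℕ) : ContDiff ℝ n (gam d τ) := by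
  by_cases hτ : τ = 0
  · have e : gam d τ = fun y => y / d := by funext y; simp [gam, hτ]
    rw [e]; fun_prop
  · have e : gam d τ = fun y => Real.sinh (τ * y) / Real.sinh (τ * d) := by
      funext y; simp [gam, hτ]
    rw [e]
    exact (Real.contDiff_sinh.comp (contDiff_const.mul contDiff_id)).div_const _

lemma contDiff_gamD (d τ : ℝ) (n : ℕ) : ContDiff ℝ n (gamD d τ) := by
  by_cases hτ : τ = 0
  · have e : gamD d τ = fun y => 1 / d := by funext y; simp [gamD, hτ]
    rw [e]; fun_prop
  · have e : gamD d τ = fun y => τ * Real.cosh (τ * y) / Real.sinh (τ * d) := by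
      funext y; simp [gamD, hτ]
    rw [e]
    exact (contDiff_const.mul (Real.contDiff_cosh.comp (contDiff_const.mul contDiff_id))).div_const _

/-- The separated function `g(y) cos(ω x)`. -/
def sep (g : ℝ → ℝ) (ω x y : ℝ) : ℝ := g y * Real.cos (ω * x)

lemma hasDerivAt_cos_mul (ω x : ℝ) :
    HasDerivAt (fun x => Real.cos (ω * x)) (-(ω * Real.sin (ω * x))) x := by
  refine (((hasDerivAt_id x).const_mul ω).cos).congr_deriv ?_
  simp only [id]; ring

lemma hasDerivAt_sin_mul (ω x : ℝ) :
    HasDerivAt (fun x => Real.sin (ω * x)) (ω * Real.cos (ω * x)) x := by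
  refine (((hasDerivAt_id x).const_mul ω).sin).congr_deriv ?_
  simp only [id]; ring

lemma dx_sep (g : ℝ → ℝ) (ω x y : ℝ) : dx (sep g ω) x y = -(g y * (ω * Real.sin (ω * x))) := by
  refine (((hasDerivAt_cos_mul ω x).const_mul (g y))).deriv.trans ?_
  ring

lemma dx_dx_sep (g : ℝ → ℝ) (ω x y : ℝ) :
    dx (dx (sep g ω)) x y = -(ω ^ 2 * g y * Real.cos (ω * x)) := by
  have e : (fun s => dx (sep g ω) s y) = fun s => -(g y * (ω * Real.sin (ω * s))) :=
    funext fun s => dx_sep g ω s y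
  rw [dx, e]
  refine ((((hasDerivAt_sin_mul ω x).const_mul ω).const_mul (g y)).neg).deriv.trans ?_
  ring

lemma dy_sep {g g' : ℝ → ℝ} (hg : ∀ y, HasDerivAt g (g' y) y) (ω : ℝ) :
    dy (sep g ω) = sep g' ω := by
  funext x y
  exact ((hg y).mul_const _).deriv

lemma cd_sep {g : ℝ → ℝ} {n : ℕ} (hg : ContDiff ℝ n g) (ω x y : ℝ) : CD n (sep g ω) x y := by
  have h1 : ContDiff ℝ n (fun p : ℝ × ℝ => g p.2 * Real.cos (ω * p.1)) :=
    (hg.comp contDiff_snd).mul (Real.contDiff_cos.comp (contDiff_const.mul contDiff_fst))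
  exact h1.contDiffAt

section strip

variable {d P : ℝ} {u : ℝ → ℝ → ℝ}

/-- `u` is `C²` near the closed strip, periodic, and zero on the bottom. -/
structure StripFun (d P : ℝ) (u : ℝ → ℝ → ℝ) : Prop where
  cd : ∀ x, ∀ y ∈ Icc 0 d, CD 2 u x y
  periodic : ∀ x, ∀ y ∈ Icc 0 d, u (x + P) y = u x y
  bottom : ∀ x, u x 0 = 0

lemma StripFun.dx_periodic (h : StripFun d P u) (x : ℝ) {y : ℝ} (hy : y ∈ Icc 0 d) :
    dx u (x + P) y = dx u x y := by
  have e : (fun s => u (s + P) y) = fun s => u s y := funext fun s => h.periodic s y hy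
  rw [dx, ← deriv_comp_add_const, e, dx]

lemma StripFun.green (h : StripFun d P u) (hd : 0 ≤ d) (hP : 0 ≤ P) {ω : ℝ}
    (hs : Real.sin (ω * P) = 0) (hc : Real.cos (ω * P) = 1) {g g' g'' : ℝ → ℝ}
    (hg : ContDiff ℝ 2 g) (hg0 : g 0 = 0)
    (hg' : ∀ y, HasDerivAt g (g' y) y) (hg'' : ∀ y, HasDerivAt g' (g'' y) y) :
    ∫ p in rect P, d * (g (p.2 * d) * Real.cos (ω * p.1)
          * (dx (dx u) p.1 (p.2 * d) + dy (dy u) p.1 (p.2 * d))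
        - u p.1 (p.2 * d) * ((g'' (p.2 * d) - ω ^ 2 * g (p.2 * d)) * Real.cos (ω * p.1)))
      = ∫ x in 0..P, Real.cos (ω * x) * (g d * dy u x d - g' d * u x d) := by
  have key := green_graph hP 1 (η := fun _ => d) (fun x _ => contDiffAt_const) (fun x _ => hd) rfl
    (u := u) (v := sep g ω) (fun x _ y hy => h.cd x y hy) (fun x _ y _ => cd_sep hg ω x y)
    (fun x _ => h.bottom x) (fun x _ => by simp [sep, hg0])
    (fun y hy => by simpa using h.periodic 0 y hy) (fun y _ => by simp [sep, hc])
    (fun y hy => by simpa using h.dx_periodic 0 hy) (fun y _ => by simp [dx_sep, hs])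
  simp only [dy_sep hg', dy_sep hg'', dx_dx_sep, deriv_const, zero_mul, sub_zero, one_pow,
    one_mul, sep] at key
  calc _ = _ := ?_
    _ = _ := key
    _ = _ := ?_
  · refine setIntegral_congr_fun (measurableSet_rect P) fun p _ => ?_
    ring
  · refine intervalIntegral.integral_congr fun x _ => ?_
    ring

/-- The `cos(ω x)` coefficients of `u` and of `u_y` at the top of the strip. -/
lemma StripFun.green_gam (h : StripFun d P u) (hd : 0 < d) (hP : 0 ≤ P) {ω : ℝ}
    (hs : Real.sin (ω * P) = 0) (hc : Real.cos (ω * P) = 1) :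
    ∫ x in 0..P, Real.cos (ω * x) * (dy u x d - gamSlope d ω * u x d)
      = ∫ p in rect P, d * (gam d ω (p.2 * d) * Real.cos (ω * p.1)
          * (dx (dx u) p.1 (p.2 * d) + dy (dy u) p.1 (p.2 * d))) := by
  -- The test function `γ(y; ω) cos ωx` is harmonic and has trace `cos ωx` at the top, so only the
  -- Laplacian of `u` survives inside.
  have key := h.green hd.le hP hs hc (contDiff_gam d ω 2) (gam_zero_right d ω)
    (hasDerivAt_gam d ω) (hasDerivAt_gamD d ω)
  simp only [sub_self, zero_mul, mul_zero, sub_zero, gam_self hd, gamD_self, one_mul] at key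
  exact key.symm

/-- A harmonic function is paired with `gam(y) cos(ω x)` through its boundary values. -/
lemma StripFun.green_gam_weight (h : StripFun d P u) (hd : 0 < d) (hP : 0 ≤ P) {ω : ℝ}
    (hs : Real.sin (ω * P) = 0) (hc : Real.cos (ω * P) = 1)
    (hu : ∀ x, ∀ y ∈ Ioo 0 d, dx (dx u) x y + dy (dy u) x y = 0) :
    2 * ω ^ 2 * ∫ p in rect P, d * (u p.1 (p.2 * d) * (gam d ω (p.2 * d) * Real.cos (ω * p.1)))
      = ∫ x in 0..P, Real.cos (ω * x) * ((gamSlope d ω + d * ω ^ 2) * u x d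
          - d * gamSlope d ω * dy u x d) := by
  -- Since `γ'' = ω ^ 2 γ`, the function `y γ'(y) cos ωx` has Laplacian `2 ω ^ 2 γ(y) cos ωx`, the
  -- required weight.
  have key := h.green hd.le hP hs hc (g := fun y => y * gamD d ω y)
    (g' := fun y => 1 * gamD d ω y + y * (ω ^ 2 * gam d ω y))
    (g'' := fun y => 1 * (ω ^ 2 * gam d ω y) + (1 * (ω ^ 2 * gam d ω y)
      + y * (ω ^ 2 * gamD d ω y)))
    (contDiff_id.mul (contDiff_gamD d ω 2)) (by simp)
    (fun y => (hasDerivAt_id y).mul (hasDerivAt_gamD d ω y))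
    (fun y => ((hasDerivAt_gamD d ω y).const_mul 1).add
      ((hasDerivAt_id y).mul ((hasDerivAt_gam d ω y).const_mul _)))
  rw [← integral_const_mul]
  have e1 : ∫ p in rect P, 2 * ω ^ 2 * (d * (u p.1 (p.2 * d) *
        (gam d ω (p.2 * d) * Real.cos (ω * p.1))))
      = -∫ x in 0..P, Real.cos (ω * x) * (d * gamD d ω d * dy u x d
          - (1 * gamD d ω d + d * (ω ^ 2 * gam d ω d)) * u x d) := by
    rw [← key, ← integral_neg]
    refine setIntegral_congr_fun (measurableSet_rect P) fun p hp => ?_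
    have hy : p.2 * d ∈ Ioo 0 d := by
      have := hp.2
      exact ⟨mul_pos this.1 hd, mul_lt_of_lt_one_left hd this.2⟩
    simp only [hu p.1 _ hy]
    ring
  rw [e1, ← intervalIntegral.integral_neg]
  refine intervalIntegral.integral_congr fun x _ => ?_
  simp only [gam_self hd, gamD_self]
  ring

/-- Uniqueness for the Dirichlet problem in the strip. -/
lemma StripFun.eq_zero (h : StripFun d P u) (hd : 0 < d) (hP : 0 < P)
    (hu : ∀ x, ∀ y ∈ Ioo 0 d, dx (dx u) x y + dy (dy u) x y = 0) (htop : ∀ x, u x d = 0) (x : ℝ)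
    {y : ℝ} (hy : y ∈ Icc 0 d) : u x y = 0 := by
  have h1 : ∀ x, ∀ y ∈ Icc 0 d, CD 1 u x y := fun x y hy => (h.cd x y hy).of_le (by norm_num)
  -- Energy argument: the divergence of `u ∇u` is `|∇u| ^ 2`, and all boundary fluxes vanish or
  -- cancel.
  set X : ℝ → ℝ → ℝ := fun x y => u x y * dx u x y with hX
  set Y : ℝ → ℝ → ℝ := fun x y => u x y * dy u x y with hY
  have key := divergence_graph hP.le (η := fun _ => d) (fun x _ => contDiffAt_const)
    (fun x _ => hd.le) (X := X) (Y := Y)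
    (fun x _ y hy => ContDiffAt.mul (h1 x y hy) (CD.dx (h.cd x y hy)))
    (fun x _ y hy => ContDiffAt.mul (h1 x y hy) (CD.dy (h.cd x y hy)))
    (by
      intro s hs
      have hm : s * d ∈ Icc 0 d := ⟨mul_nonneg hs.1 hd.le, mul_le_of_le_one_left hd.le hs.2⟩
      have e1 := h.periodic 0 _ hm
      have e2 := h.dx_periodic 0 hm
      rw [zero_add] at e1 e2
      simp only [hX, e1, e2])
  simp only [deriv_const, zero_mul, sub_zero, hY, htop, h.bottom, intervalIntegral.integral_zero]
    at key
  have hmem : ∀ p ∈ rect P, p.2 * d ∈ Ioo 0 d := fun p hp =>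
    ⟨mul_pos hp.2.1 hd, mul_lt_of_lt_one_left hd hp.2.2⟩
  set E : ℝ × ℝ → ℝ := fun p => d * (dx u p.1 (p.2 * d) ^ 2 + dy u p.1 (p.2 * d) ^ 2) with hE
  have hint : ∫ p in rect P, E p = 0 := by
    rw [← key]
    refine setIntegral_congr_fun (measurableSet_rect P) fun p hp => ?_
    have hy := hmem p hp
    have hy' := Ioo_subset_Icc_self hy
    have hlap := hu p.1 _ hy
    simp only [hE]
    generalize p.2 * d = y at *
    generalize p.1 = x at *
    have hcx : ∀ {w : ℝ → ℝ → ℝ}, CD 1 w x y → HasDerivAt (fun s => w s y) (dx w x y) x := by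
      intro w hw
      simpa using hw.hasDerivAt_comp le_rfl (hasDerivAt_id x) (hasDerivAt_const x y) rfl rfl
    have hcy : ∀ {w : ℝ → ℝ → ℝ}, CD 1 w x y → HasDerivAt (fun s => w x s) (dy w x y) y := by
      intro w hw
      simpa using hw.hasDerivAt_comp le_rfl (hasDerivAt_const y x) (hasDerivAt_id y) rfl rfl
    have eX : dx X x y = dx u x y * dx u x y + u x y * dx (dx u) x y :=
      ((hcx (h1 x y hy')).mul (hcx (h.cd x y hy').dx)).deriv
    have eY : dy (fun x y => u x y * dy u x y) x y = dy u x y * dy u x y + u x y * dy (dy u) x y :=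
      ((hcy (h1 x y hy')).mul (hcy (h.cd x y hy').dy)).deriv
    rw [eX, eY]
    linear_combination (-(d * u x y)) * hlap
  have hcont : ContinuousOn E (Icc 0 P ×ˢ Icc 0 1) := by
    intro p hp
    have hm : p.2 * d ∈ Icc 0 d :=
      ⟨mul_nonneg hp.2.1 hd.le, mul_le_of_le_one_left hd.le hp.2.2⟩
    have hmap : ContinuousAt (fun p : ℝ × ℝ => (p.1, p.2 * d)) p := by fun_prop
    have c1 : ContinuousAt (fun p : ℝ × ℝ => dx u p.1 (p.2 * d)) p :=
      ContinuousAt.comp (g := fun q : ℝ × ℝ => dx u q.1 q.2) (f := fun p : ℝ × ℝ => (p.1, p.2 * d))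
        (CD.dx (n := 0) (h1 p.1 _ hm)).continuousAt hmap
    have c2 : ContinuousAt (fun p : ℝ × ℝ => dy u p.1 (p.2 * d)) p :=
      ContinuousAt.comp (g := fun q : ℝ × ℝ => dy u q.1 q.2) (f := fun p : ℝ × ℝ => (p.1, p.2 * d))
        (CD.dy (n := 0) (h1 p.1 _ hm)).continuousAt hmap
    exact (continuousAt_const.mul ((c1.pow 2).add (c2.pow 2))).continuousWithinAt
  have hae : E =ᵐ[volume.restrict (rect P)] fun _ => 0 := by
    have hi : IntegrableOn E (rect P) :=
      (hcont.integrableOn_compact (isCompact_Icc.prod isCompact_Icc)).mono_set (rect_subset P)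
    refine (setIntegral_eq_zero_iff_of_nonneg_ae (Eventually.of_forall fun p => ?_) hi).mp hint
    simp only [hE, Pi.zero_apply]
    positivity
  have hzero : EqOn E (fun _ => 0) (rect P) :=
    Measure.eqOn_open_of_ae_eq hae (isOpen_Ioo.prod isOpen_Ioo) (hcont.mono (rect_subset P))
      continuousOn_const
  have hin : ∀ x ∈ Ioo 0 P, ∀ y ∈ Icc 0 d, u x y = 0 := by
    intro x hx y hy
    have hder : ∀ y ∈ Icc 0 d, HasDerivAt (fun s => u x s) (dy u x y) y := fun y hy => by
      simpa using (h1 x y hy).hasDerivAt_comp le_rfl (hasDerivAt_const y x) (hasDerivAt_id y)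
        rfl rfl
    have hconst : ∀ z ∈ Icc 0 d, u x z = u x 0 := by
      refine constant_of_has_deriv_right_zero
        (fun y hy => (hder y hy).continuousAt.continuousWithinAt) fun y hy => ?_
      have : dy u x y = 0 := by
        rcases hy.1.eq_or_lt with h0 | h0
        -- The gradient is known to vanish only in the open rectangle; at `y = 0` its value is a
        -- limit from inside.
        · have hlim : Tendsto (fun s => dy u x s) (𝓝[>] y) (𝓝 (dy u x y)) := by
            have : ContinuousAt (fun s => dy u x s) y :=
              ContinuousAt.comp (g := fun q : ℝ × ℝ => dy u q.1 q.2) (f := fun s => (x, s))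
                (CD.dy (n := 0) (h1 x y (Ico_subset_Icc_self hy))).continuousAt (by fun_prop)
            exact this.tendsto.mono_left nhdsWithin_le_nhds
          refine tendsto_nhds_unique hlim (tendsto_const_nhds.congr' ?_)
          filter_upwards [Ioo_mem_nhdsGT hy.2] with s hs
          have hs' : (x, s / d) ∈ rect P :=
            ⟨hx, div_pos (hy.1.trans_lt hs.1) hd, (div_lt_one hd).mpr hs.2⟩
          have := hzero hs'
          simp only [hE, div_mul_cancel₀ s hd.ne'] at this
          have h2 : dx u x s ^ 2 + dy u x s ^ 2 = 0 := by
            rcases mul_eq_zero.mp this with h3 | h3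
            · exact absurd h3 hd.ne'
            · exact h3
          nlinarith [sq_nonneg (dx u x s), sq_nonneg (dy u x s)]
        · have hs' : (x, y / d) ∈ rect P := ⟨hx, div_pos h0 hd, (div_lt_one hd).mpr hy.2⟩
          have := hzero hs'
          simp only [hE, div_mul_cancel₀ y hd.ne'] at this
          have h2 : dx u x y ^ 2 + dy u x y ^ 2 = 0 := by
            rcases mul_eq_zero.mp this with h3 | h3
            · exact absurd h3 hd.ne'
            · exact h3
          nlinarith [sq_nonneg (dx u x y), sq_nonneg (dy u x y)]
      rw [← this]
      exact (hder y (Ico_subset_Icc_self hy)).hasDerivWithinAt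
    rw [hconst y hy, h.bottom]
  have hper : Function.Periodic (fun x => u x y) P := fun x => h.periodic x y hy
  obtain ⟨z, hz, hxz⟩ := hper.exists_mem_Ico₀ hP x
  rw [hxz]
  rcases hz.1.eq_or_lt with h0 | h0
  · have hlim : Tendsto (fun s => u s y) (𝓝[>] z) (𝓝 (u z y)) := by
      have : ContinuousAt (fun s => u s y) z :=
        ContinuousAt.comp (g := fun q : ℝ × ℝ => u q.1 q.2) (f := fun s => (s, y))
          (h1 z y hy).continuousAt (by fun_prop)
      exact this.tendsto.mono_left nhdsWithin_le_nhds
    refine tendsto_nhds_unique hlim (tendsto_const_nhds.congr' ?_)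
    filter_upwards [Ioo_mem_nhdsGT hz.2] with s hs
    exact (hin s ⟨hz.1.trans_lt hs.1, hs.2⟩ y hy).symm
  · exact hin z ⟨h0, hz.2⟩ y hy

end strip

/-! ### Cosine series -/

/-- Evenness kills the sine coefficients, so every Fourier coefficient of the function induced on
the circle vanishes. The coefficients are then trivially summable and the Fourier series represents
the function pointwise. -/
lemma eq_zero_of_cosine_coeffs {P : ℝ} (hP : 0 < P) {f : ℝ → ℝ} (hf : Continuous f)
    (hper : ∀ x, f (x + P) = f x) (heven : ∀ x, f (-x) = f x)
    (h : ∀ n : ℕ, ∫ x in 0..P, f x * Real.cos (n * (2 * Real.pi / P) * x) = 0) (x : ℝ) :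
    f x = 0 := by
  have : Fact (0 < P) := ⟨hP⟩
  have hsin : ∀ n : ℤ, ∫ x in 0..P, f x * Real.sin (n * (2 * Real.pi / P) * x) = 0 := by
    intro n
    set I := ∫ x in 0..P, f x * Real.sin (n * (2 * Real.pi / P) * x)
    have h1 : I = ∫ x in 0..P, f (P - x) * Real.sin (n * (2 * Real.pi / P) * (P - x)) := by
      rw [intervalIntegral.integral_comp_sub_left
        (fun x => f x * Real.sin (n * (2 * Real.pi / P) * x))]
      simp [I]
    have h2 : ∀ x, f (P - x) * Real.sin (n * (2 * Real.pi / P) * (P - x))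
        = -(f x * Real.sin (n * (2 * Real.pi / P) * x)) := by
      intro x
      have e1 : f (P - x) = f x := by
        rw [← heven x, ← hper (-x)]; congr 1; ring
      have e2 : (n : ℝ) * (2 * Real.pi / P) * (P - x)
          = n * (2 * Real.pi) - n * (2 * Real.pi / P) * x := by
        field_simp
      rw [e1, e2, Real.sin_int_mul_two_pi_sub]
      ring
    simp only [h2, intervalIntegral.integral_neg] at h1
    linarith
  have hcos : ∀ n : ℤ, ∫ x in 0..P, f x * Real.cos (n * (2 * Real.pi / P) * x) = 0 := by
    intro n
    obtain ⟨m, rfl | rfl⟩ := n.eq_nat_or_neg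
    · exact_mod_cast h m
    · have := h m
      push_cast
      simpa [neg_mul, Real.cos_neg] using this
  have hperC : Function.Periodic (fun x => (f x : ℂ)) P := fun x => by simp [hper x]
  set F : C(AddCircle P, ℂ) := ⟨hperC.lift, by
    refine continuous_coinduced_dom.mpr ?_
    exact Complex.continuous_ofReal.comp hf⟩ with hF
  have hFx : ∀ x : ℝ, F (x : AddCircle P) = f x := fun x => rfl
  have hcoef : ∀ n : ℤ, fourierCoeff F n = 0 := by
    intro n
    rw [fourierCoeff_eq_intervalIntegral _ n 0, zero_add]
    have e : ∀ x : ℝ, (fourier (-n) (x : AddCircle P) : ℂ) • F (x : AddCircle P)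
        = ((f x * Real.cos (n * (2 * Real.pi / P) * x) : ℝ) : ℂ)
          - Complex.I * ((f x * Real.sin (n * (2 * Real.pi / P) * x) : ℝ) : ℂ) := by
      intro x
      rw [hFx, fourier_coe_apply]
      have : 2 * (Real.pi : ℂ) * Complex.I * ((-n : ℤ) : ℂ) * x / P
          = ((-(n * (2 * Real.pi / P) * x) : ℝ) : ℂ) * Complex.I := by
        push_cast; ring
      rw [this, Complex.exp_mul_I, ← Complex.ofReal_cos, ← Complex.ofReal_sin, Real.cos_neg,
        Real.sin_neg]
      push_cast
      simp only [smul_eq_mul]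
      ring
    simp only [e]
    rw [intervalIntegral.integral_sub, intervalIntegral.integral_const_mul,
      intervalIntegral.integral_ofReal, intervalIntegral.integral_ofReal, hcos, hsin]
    · simp
    · exact Continuous.intervalIntegrable (by fun_prop) _ _
    · exact Continuous.intervalIntegrable (by fun_prop) _ _
  have hsum := has_pointwise_sum_fourier_series_of_summable (f := F)
    (by simp only [funext hcoef]; exact summable_zero) (x : AddCircle P)
  simp only [hcoef, zero_smul] at hsum
  have := hsum.unique hasSum_zero
  rw [hFx] at this
  exact_mod_cast this

/-! ### The spectrum at the laminar flow -/

section laminar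

variable {a d : ℝ}

lemma basePeriod_pos (hd : criticalDepth a < d) (hk : kappa a d ≠ 0) : 0 < basePeriod a d :=
  div_pos (by positivity) (tauStar_pos hd hk)

lemma nat_mul_tauStar_mul_basePeriod (hd : criticalDepth a < d) (hk : kappa a d ≠ 0) (n : ℕ) :
    n * tauStar a d * basePeriod a d = n * (2 * Real.pi) := by
  have := (tauStar_pos hd hk).ne'
  rw [basePeriod]; field_simp

lemma sin_nat_mul_basePeriod (hd : criticalDepth a < d) (hk : kappa a d ≠ 0) (n : ℕ) :
    Real.sin (n * tauStar a d * basePeriod a d) = 0 := by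
  rw [nat_mul_tauStar_mul_basePeriod hd hk]
  simpa using Real.sin_nat_mul_two_pi_sub 0 n

lemma cos_nat_mul_basePeriod (hd : criticalDepth a < d) (hk : kappa a d ≠ 0) (n : ℕ) :
    Real.cos (n * tauStar a d * basePeriod a d) = 1 := by
  rw [nat_mul_tauStar_mul_basePeriod hd hk]
  exact Real.cos_nat_mul_two_pi n

/-- `ψ` agrees at the top of the strip with the laminar flow, to second order. -/
structure LaminarTop (a d : ℝ) (ψ : ℝ → ℝ → ℝ) : Prop where
  dx : ∀ x, deriv (fun s => ψ s d) x = 0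
  dy : ∀ x, deriv (ψ x) d = kappa a d
  dyy : ∀ x, deriv (deriv (ψ x)) d = -a

variable {ψ v : ℝ → ℝ → ℝ} {μ : ℝ}

lemma IsEigenfunction.stripFun (h : IsEigenfunction (basePeriod a d) 1 ψ (fun _ => d) μ v) :
    StripFun d (basePeriod a d) v where
  cd := fun x y hy => h.regular x y hy
  periodic := fun x y _ => h.periodic x y
  bottom := h.bottom

lemma IsEigenfunction.laplace (h : IsEigenfunction (basePeriod a d) 1 ψ (fun _ => d) μ v) (x : ℝ) :
    ∀ y ∈ Ioo 0 d, dx (dx v) x y + dy (dy v) x y = 0 := by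
  intro y hy
  have := h.interior x y hy
  rwa [one_pow, one_mul] at this

lemma IsEigenfunction.top (hk : kappa a d ≠ 0) (hψ : LaminarTop a d ψ)
    (h : IsEigenfunction (basePeriod a d) 1 ψ (fun _ => d) μ v) (x : ℝ) :
    kappa a d ^ 2 * dy v x d = (1 - a * kappa a d + μ) * v x d := by
  have := h.surface x
  simp only [hψ.dx, hψ.dy, hψ.dyy, mul_zero, zero_mul, add_zero, zero_add] at this
  change kappa a d * dy v x d - _ = _ at this
  field_simp at this
  linear_combination this

lemma intervalIntegrable_top {d P : ℝ} {u : ℝ → ℝ → ℝ} (hd : 0 ≤ d) (h : StripFun d P u) :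
    Continuous (fun x => u x d) ∧ Continuous (fun x => dy u x d) := by
  have hmem : d ∈ Icc 0 d := ⟨hd, le_rfl⟩
  constructor
  · refine continuous_iff_continuousAt.mpr fun x => ?_
    exact ContinuousAt.comp (g := fun q : ℝ × ℝ => u q.1 q.2) (f := fun s => (s, d))
      (h.cd x d hmem).continuousAt (by fun_prop)
  · refine continuous_iff_continuousAt.mpr fun x => ?_
    exact ContinuousAt.comp (g := fun q : ℝ × ℝ => dy u q.1 q.2) (f := fun s => (s, d))
      (CD.dy (n := 1) (h.cd x d hmem)).continuousAt (by fun_prop)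

/-- Green's identity with the harmonic function `γ(y; ω) cos ωx`, `ω = n τ_*`, relates the `n`-th
modes of `v_y` and `v` at the top. Combined with the boundary condition this leaves the factor `σ(ω)
- μ`. -/
lemma IsEigenfunction.mode (hd : criticalDepth a < d) (hk : kappa a d ≠ 0)
    (hψ : LaminarTop a d ψ) (h : IsEigenfunction (basePeriod a d) 1 ψ (fun _ => d) μ v) (n : ℕ) :
    (disp a d (n * tauStar a d) - μ)
      * ∫ x in 0..basePeriod a d, v x d * Real.cos (n * tauStar a d * x) = 0 := by
  have hd0 := pos_of_criticalDepth_lt hd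
  have key := h.stripFun.green_gam hd0 (basePeriod_pos hd hk).le
    (sin_nat_mul_basePeriod hd hk n) (cos_nat_mul_basePeriod hd hk n)
  have h0 : ∫ p in rect (basePeriod a d), d * (gam d (n * tauStar a d) (p.2 * d)
      * Real.cos (n * tauStar a d * p.1)
      * (dx (dx v) p.1 (p.2 * d) + dy (dy v) p.1 (p.2 * d))) = 0 := by
    rw [setIntegral_congr_fun (g := fun _ => (0 : ℝ)) (measurableSet_rect _), integral_zero]
    intro p hp
    have hy : p.2 * d ∈ Ioo 0 d := ⟨mul_pos hp.2.1 hd0, mul_lt_of_lt_one_left hd0 hp.2.2⟩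
    simp only [h.laplace p.1 _ hy, mul_zero]
  rw [h0] at key
  have e : ∀ x, Real.cos (n * tauStar a d * x) * (dy v x d - gamSlope d (n * tauStar a d) * v x d)
      = -((disp a d (n * tauStar a d) - μ) / kappa a d ^ 2
        * (v x d * Real.cos (n * tauStar a d * x))) := by
    intro x
    have := h.top hk hψ x
    rw [disp]
    field_simp
    linear_combination Real.cos (n * tauStar a d * x) * this
  simp only [e, intervalIntegral.integral_neg, intervalIntegral.integral_const_mul] at key
  have h2 : kappa a d ^ 2 ≠ 0 := by positivity
  field_simp at key
  linarith

/-- If all modes vanished, completeness of the cosines would annihilate the trace of `v`, and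
uniqueness for the Dirichlet problem would annihilate `v`. -/
lemma IsEigenfunction.exists_mode_ne_zero (hd : criticalDepth a < d) (hk : kappa a d ≠ 0)
    (h : IsEigenfunction (basePeriod a d) 1 ψ (fun _ => d) μ v) :
    ∃ n : ℕ, ∫ x in 0..basePeriod a d, v x d * Real.cos (n * tauStar a d * x) ≠ 0 := by
  have hd0 := pos_of_criticalDepth_lt hd
  by_contra! hall
  have htop : ∀ x, v x d = 0 := by
    refine eq_zero_of_cosine_coeffs (basePeriod_pos hd hk)
      (intervalIntegrable_top hd0.le h.stripFun).1 (fun x => h.periodic x d)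
      (fun x => h.even x d) fun n => ?_
    have e : 2 * Real.pi / basePeriod a d = tauStar a d := by
      rw [basePeriod]
      have := Real.pi_ne_zero
      have := (tauStar_pos hd hk).ne'
      field_simp
    rw [e]
    exact hall n
  obtain ⟨x, y, hy, hne⟩ := h.nonzero
  exact hne (h.stripFun.eq_zero hd0 (basePeriod_pos hd hk) h.laplace htop x hy)

lemma IsEigenfunction.eq_disp (hd : criticalDepth a < d) (hk : kappa a d ≠ 0)
    (hψ : LaminarTop a d ψ) (h : IsEigenfunction (basePeriod a d) 1 ψ (fun _ => d) μ v) :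
    ∃ n : ℕ, μ = disp a d (n * tauStar a d) := by
  obtain ⟨n, hn⟩ := h.exists_mode_ne_zero hd hk
  refine ⟨n, ?_⟩
  rcases mul_eq_zero.mp (h.mode hd hk hψ n) with h1 | h1
  · linarith
  · exact absurd h1 hn

lemma disp_strictMonoOn (hd : 0 < d) (hk : kappa a d ≠ 0) : StrictMonoOn (disp a d) (Ioi 0) := by
  intro x hx y hy hxy
  have hk2 : 0 < kappa a d ^ 2 := by positivity
  have := mul_lt_mul_of_pos_left (gamSlope_strictMonoOn hd hx hy hxy) hk2
  simp only [disp]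
  linarith

lemma disp_nat_pos (hd : criticalDepth a < d) (hk : kappa a d ≠ 0) {n : ℕ} (hn : 2 ≤ n) :
    0 < disp a d (n * tauStar a d) := by
  have ht := tauStar_pos hd hk
  have h1 : (2 : ℝ) ≤ n := by exact_mod_cast hn
  have hlt : tauStar a d < n * tauStar a d := by nlinarith
  have := disp_strictMonoOn (pos_of_criticalDepth_lt hd) hk (show tauStar a d ∈ Ioi 0 from ht)
    (show n * tauStar a d ∈ Ioi 0 from ht.trans hlt) hlt
  rwa [disp_tauStar hd hk] at this

/-- Only `n = 1` solves `σ(n τ_*) = 0`, because `σ(0) < 0` and `σ(n τ_*) > 0` for `n ≥ 2`. This mode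
is the nonzero denominator in the limit of `μ / t ^ 2`. -/
lemma IsEigenfunction.first_mode_ne_zero (hd : criticalDepth a < d) (hk : kappa a d ≠ 0)
    (hψ : LaminarTop a d ψ) (h : IsEigenfunction (basePeriod a d) 1 ψ (fun _ => d) 0 v) :
    ∫ x in 0..basePeriod a d, v x d * Real.cos (tauStar a d * x) ≠ 0 := by
  obtain ⟨n, hn⟩ := h.exists_mode_ne_zero hd hk
  have h1 : n = 1 := by
    rcases mul_eq_zero.mp (h.mode hd hk hψ n) with h1 | h1
    · rw [sub_zero] at h1
      match n with
      | 0 =>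
        have := disp_zero_neg hd
        rw [Nat.cast_zero, zero_mul] at h1
        linarith
      | 1 => rfl
      | m + 2 => exact absurd h1 (disp_nat_pos hd hk (by omega)).ne'
    · exact absurd h1 hn
  subst h1
  simpa using hn

lemma isEigenvalue_disp (hd : criticalDepth a < d) (hk : kappa a d ≠ 0)
    (hψ : LaminarTop a d ψ) (n : ℕ) :
    IsEigenvalue (basePeriod a d) 1 ψ (fun _ => d) (disp a d (n * tauStar a d)) := by
  have hd0 := pos_of_criticalDepth_lt hd
  set ω := n * tauStar a d with hω
  have e1 := dy_sep (hasDerivAt_gam d ω) ω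
  have e2 := dy_sep (hasDerivAt_gamD d ω) ω
  refine ⟨sep (gam d ω) ω, ?_⟩
  constructor
  · exact fun x y _ => cd_sep (contDiff_gam d ω 2) ω x y
  · exact ⟨0, d, ⟨hd0.le, le_rfl⟩, by simp [sep, gam_self hd0]⟩
  · intro x y
    simp [sep]
  · intro x y
    have : ω * (x + basePeriod a d) = ω * x + n * (2 * Real.pi) := by
      rw [mul_add, hω, nat_mul_tauStar_mul_basePeriod hd hk]
    simp only [sep, this, Real.cos_add_nat_mul_two_pi]
  · intro x y _
    change 1 ^ 2 * dx (dx (sep (gam d ω) ω)) x y + dy (dy (sep (gam d ω) ω)) x y = 0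
    rw [e1, e2, dx_dx_sep, sep]
    ring
  · intro x
    simp [sep, gam_zero_right]
  · intro x
    simp only [hψ.dx, hψ.dy, hψ.dyy, mul_zero, zero_mul, add_zero, zero_add]
    change kappa a d * dy (sep (gam d ω) ω) x d - _ = _
    rw [e1, sep, sep, gam_self hd0, gamD_self, disp]
    field_simp
    ring

/-- The only negative eigenvalue is `σ(0)`. A negative `μ` would have to equal it and leave no
smaller one, while a positive `μ` would have both `σ(0)` and `σ(τ_*) = 0` below it. -/
lemma IsSecondEigenvalue.eq_zero (hd : criticalDepth a < d) (hk : kappa a d ≠ 0)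
    (hψ : LaminarTop a d ψ) (h : IsSecondEigenvalue (basePeriod a d) 1 ψ (fun _ => d) μ) :
    μ = 0 := by
  obtain ⟨⟨v, hv⟩, ν, ⟨hν, w, hw⟩, huniq⟩ := h
  have h0 : IsEigenvalue (basePeriod a d) 1 ψ (fun _ => d) (disp a d 0) := by
    simpa using isEigenvalue_disp hd hk hψ 0
  have h1 : IsEigenvalue (basePeriod a d) 1 ψ (fun _ => d) 0 := by
    simpa [disp_tauStar hd hk] using isEigenvalue_disp hd hk hψ 1
  have hneg := disp_zero_neg hd
  have hmin : ∀ n : ℕ, disp a d 0 ≤ disp a d (n * tauStar a d) ∧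
      (n ≠ 0 → 0 ≤ disp a d (n * tauStar a d)) := by
    intro n
    match n with
    | 0 => simp
    | 1 => simp [disp_tauStar hd hk, hneg.le]
    | m + 2 =>
      have := disp_nat_pos hd hk (n := m + 2) (by omega)
      exact ⟨by linarith, fun _ => this.le⟩
  rcases lt_trichotomy μ 0 with hlt | heq | hgt
  · obtain ⟨n, hn⟩ := hv.eq_disp hd hk hψ
    obtain ⟨m, hm⟩ := hw.eq_disp hd hk hψ
    by_cases hn0 : n = 0
    · subst hn0
      rw [Nat.cast_zero, zero_mul] at hn
      have := (hmin m).1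
      linarith
    · have := (hmin n).2 hn0
      linarith
  · exact heq
  · have e1 := huniq _ ⟨hneg.trans hgt, h0⟩
    have e2 := huniq _ ⟨hgt, h1⟩
    linarith

end laminar

/-! ### Values of the branch at `t = 0` -/

/-- A function of `(t, x)` as a function of `(t, x, y)`. -/
def lift2 (η : ℝ → ℝ → ℝ) (t x _y : ℝ) : ℝ := η t x

lemma an_lift2 {η : ℝ → ℝ → ℝ} {t x : ℝ} (h : AnalyticAt ℝ (fun p : ℝ × ℝ => η p.1 p.2) (t, x))
    (y : ℝ) : An (lift2 η) t x y := by
  have h1 : AnalyticAt ℝ (fun p : ℝ × ℝ × ℝ => (p.1, p.2.1)) (t, x, y) :=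
    analyticAt_fst.prod (analyticAt_fst.fun_comp analyticAt_snd)
  exact AnalyticAt.fun_comp_of_eq (g := fun p : ℝ × ℝ => η p.1 p.2) h h1 rfl

lemma An.mul {f g : ℝ → ℝ → ℝ → ℝ} {t x y : ℝ} (hf : An f t x y) (hg : An g t x y) :
    An (fun t x y => f t x y * g t x y) t x y := AnalyticAt.mul hf hg

lemma An.div {f g : ℝ → ℝ → ℝ → ℝ} {t x y : ℝ} (hf : An f t x y) (hg : An g t x y)
    (h0 : g t x y ≠ 0) : An (fun t x y => f t x y / g t x y) t x y := AnalyticAt.div hf hg h0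

lemma An.flatten {f : ℝ → ℝ → ℝ → ℝ} {η : ℝ → ℝ → ℝ} {t x s : ℝ}
    (hη : AnalyticAt ℝ (fun p : ℝ × ℝ => η p.1 p.2) (t, x)) (hf : An f t x (s * η t x)) :
    An (fun t x s => f t x (s * η t x)) t x s := by
  have h1 : AnalyticAt ℝ (fun p : ℝ × ℝ × ℝ => p.2.1) (t, x, s) :=
    analyticAt_fst.fun_comp analyticAt_snd
  have h2 : AnalyticAt ℝ (fun p : ℝ × ℝ × ℝ => p.2.2) (t, x, s) :=
    analyticAt_snd.fun_comp analyticAt_snd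
  have h3 : AnalyticAt ℝ (fun p : ℝ × ℝ × ℝ => (p.1, p.2.1, p.2.2 * η p.1 p.2.1)) (t, x, s) :=
    analyticAt_fst.prod (h1.prod (h2.mul (an_lift2 hη s)))
  exact AnalyticAt.fun_comp_of_eq (g := fun p : ℝ × ℝ × ℝ => f p.1 p.2.1 p.2.2) hf h3 rfl

lemma An.surface {f : ℝ → ℝ → ℝ → ℝ} {η : ℝ → ℝ → ℝ} {t x : ℝ}
    (hη : AnalyticAt ℝ (fun p : ℝ × ℝ => η p.1 p.2) (t, x)) (hf : An f t x (η t x)) (y : ℝ) :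
    An (fun t x _ => f t x (η t x)) t x y := by
  have h1 : AnalyticAt ℝ (fun p : ℝ × ℝ × ℝ => p.2.1) (t, x, y) :=
    analyticAt_fst.fun_comp analyticAt_snd
  have h3 : AnalyticAt ℝ (fun p : ℝ × ℝ × ℝ => (p.1, p.2.1, η p.1 p.2.1)) (t, x, y) :=
    analyticAt_fst.prod (h1.prod (an_lift2 hη y))
  exact AnalyticAt.fun_comp_of_eq (g := fun p : ℝ × ℝ × ℝ => f p.1 p.2.1 p.2.2) hf h3 rfl

lemma An.analyticAt_tx {f : ℝ → ℝ → ℝ → ℝ} {t x y : ℝ} (hf : An f t x y) :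
    AnalyticAt ℝ (fun p : ℝ × ℝ => f p.1 p.2 y) (t, x) := by
  have h1 : AnalyticAt ℝ (fun p : ℝ × ℝ => (p.1, p.2, y)) (t, x) :=
    analyticAt_fst.prod (analyticAt_snd.prod analyticAt_const)
  exact AnalyticAt.fun_comp_of_eq (g := fun p : ℝ × ℝ × ℝ => f p.1 p.2.1 p.2.2) hf h1 rfl

/-- Analytic functions that agree on `[0, d]` agree near each of its points. -/
lemma eventuallyEq_of_eqOn_Icc {f g : ℝ → ℝ} {d y : ℝ} (hd : 0 < d) (hy : y ∈ Icc 0 d)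
    (hf : AnalyticAt ℝ f y) (hg : AnalyticAt ℝ g y) (h : ∀ z ∈ Icc 0 d, f z = g z) :
    f =ᶠ[𝓝 y] g := by
  have hfg : AnalyticAt ℝ (fun z => f z - g z) y := hf.sub hg
  have : ∀ᶠ z in 𝓝 y, f z - g z = 0 := by
    rcases hy.2.eq_or_lt with h1 | h1
    · refine eventually_zero_of_nhdsLT hfg ?_
      filter_upwards [Ioo_mem_nhdsLT (show 0 < y from h1 ▸ hd)] with z hz
      exact sub_eq_zero.mpr (h z ⟨hz.1.le, hz.2.le.trans hy.2⟩)
    · refine eventually_zero_of_nhdsGT hfg ?_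
      filter_upwards [Ioo_mem_nhdsGT h1] with z hz
      exact sub_eq_zero.mpr (h z ⟨hy.1.trans hz.1.le, hz.2.le⟩)
  exact this.mono fun z hz => sub_eq_zero.mp hz

lemma hasDerivAt_laminar (a d y : ℝ) :
    HasDerivAt (laminar a d) (-(a / 2) * (2 * y - d) + 1 / d) y := by
  unfold laminar
  refine (((((hasDerivAt_id y).const_mul (-(a / 2))).mul ((hasDerivAt_id y).sub_const d)).add
    ((hasDerivAt_id y).div_const d))).congr_deriv ?_
  simp only [id]
  ring

lemma deriv_laminar (a d : ℝ) :
    deriv (laminar a d) = fun y => -(a / 2) * (2 * y - d) + 1 / d :=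
  funext fun y => (hasDerivAt_laminar a d y).deriv

lemma deriv_deriv_laminar (a d : ℝ) : deriv (deriv (laminar a d)) = fun _ => -a := by
  rw [deriv_laminar]
  funext y
  refine (((((hasDerivAt_id y).const_mul 2).sub_const d).const_mul (-(a / 2))).add_const
    (1 / d)).deriv.trans ?_
  ring

lemma analyticAt_laminar (a d y : ℝ) : AnalyticAt ℝ (laminar a d) y := by
  unfold laminar
  fun_prop

lemma eventually_forall_Icc (P : ℝ) {Q : ℝ → ℝ → Prop}
    (hQ : ∀ x, ∀ᶠ p in 𝓝 ((0, x) : ℝ × ℝ), Q p.1 p.2) :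
    ∀ᶠ t in 𝓝 0, ∀ x ∈ Icc 0 P, Q t x :=
  isCompact_Icc.eventually_forall_of_forall_eventually fun x _ => hQ x

section branch

variable {a d : ℝ} {ψ : ℝ → ℝ → ℝ → ℝ} {η : ℝ → ℝ → ℝ} {lam : ℝ → ℝ}

namespace IsStokesBranch

lemma surface_zero_fun (B : IsStokesBranch a d ψ η lam) : η 0 = fun _ => d := funext B.surface_zero

lemma an (B : IsStokesBranch a d ψ η lam) (x : ℝ) {y : ℝ} (hy : y ∈ Icc 0 d) : An ψ 0 x y :=
  B.analytic_stream x y hy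

lemma stream_eventuallyEq (B : IsStokesBranch a d ψ η lam) (hd : 0 < d) (x : ℝ) {y : ℝ}
    (hy : y ∈ Icc 0 d) : ψ 0 x =ᶠ[𝓝 y] laminar a d :=
  eventuallyEq_of_eqOn_Icc hd hy (B.an x hy).analyticAt_y (analyticAt_laminar a d y)
    (B.stream_zero x)

lemma laminarTop (B : IsStokesBranch a d ψ η lam) (hd : 0 < d) : LaminarTop a d (ψ 0) where
  dx x := by
    have e : (fun s => ψ 0 s d) = fun _ => laminar a d d :=
      funext fun s => B.stream_zero s d ⟨hd.le, le_rfl⟩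
    rw [e, deriv_const]
  dy x := (B.stream_eventuallyEq hd x ⟨hd.le, le_rfl⟩).deriv_eq
  dyy x := by
    rw [(B.stream_eventuallyEq hd x ⟨hd.le, le_rfl⟩).deriv.deriv_eq, deriv_deriv_laminar]

lemma px_zero (B : IsStokesBranch a d ψ η lam) (x : ℝ) {y : ℝ} (hy : y ∈ Icc 0 d) :
    px ψ 0 x y = 0 := by
  have e : (fun s => ψ 0 s y) = fun _ => laminar a d y := funext fun s => B.stream_zero s y hy
  rw [px, e, deriv_const]

lemma px_px_zero (B : IsStokesBranch a d ψ η lam) (x : ℝ) {y : ℝ} (hy : y ∈ Icc 0 d) :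
    px (px ψ) 0 x y = 0 := by
  have e : (fun s => px ψ 0 s y) = fun _ => 0 := funext fun s => B.px_zero s hy
  rw [px, e, deriv_const]

/-- The first order term of the stream function. -/
lemma pt_zero (B : IsStokesBranch a d ψ η lam) (x : ℝ) {y : ℝ} (hy : y ∈ Icc 0 d) :
    pt ψ 0 x y = sep (fun y => -kappa a d * gam d (tauStar a d) y) (tauStar a d) x y :=
  B.stream_one x y hy

lemma px_px_pt_zero (B : IsStokesBranch a d ψ η lam) (x : ℝ) {y : ℝ} (hy : y ∈ Icc 0 d) :
    px (px (pt ψ)) 0 x y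
      = kappa a d * tauStar a d ^ 2 * (gam d (tauStar a d) y * Real.cos (tauStar a d * x)) := by
  have e : (fun s => pt ψ 0 s y)
      = fun s => sep (fun y => -kappa a d * gam d (tauStar a d) y) (tauStar a d) s y :=
    funext fun s => B.pt_zero s hy
  have e2 : ∀ s, px (pt ψ) 0 s y
      = dx (sep (fun y => -kappa a d * gam d (tauStar a d) y) (tauStar a d)) s y := by
    intro s
    rw [px, e, dx]
  have e3 := dx_dx_sep (fun y => -kappa a d * gam d (tauStar a d) y) (tauStar a d) x y
  rw [px, funext e2]
  rw [dx] at e3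
  rw [e3]
  ring

/-- A property that holds near the laminar flow holds up to the surface, for small `t`. -/
lemma eventually_rect (B : IsStokesBranch a d ψ η lam) (hd : 0 ≤ d) (P : ℝ)
    {Q : ℝ → ℝ → ℝ → Prop}
    (hQ : ∀ x, ∀ y ∈ Icc 0 d, ∀ᶠ p in 𝓝 ((0, x, y) : ℝ × ℝ × ℝ), Q p.1 p.2.1 p.2.2) :
    ∀ᶠ t in 𝓝 0, ∀ x ∈ Icc 0 P, ∀ s ∈ Icc (0 : ℝ) 1, Q t x (s * η t x) := by
  have hK : IsCompact (Icc (0 : ℝ) P ×ˢ Icc (0 : ℝ) 1) := isCompact_Icc.prod isCompact_Icc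
  have key := hK.eventually_forall_of_forall_eventually (x₀ := (0 : ℝ))
    (P := fun t p => Q t p.1 (p.2 * η t p.1)) (fun p hp => by
      have hc : ContinuousAt (fun q : ℝ × ℝ × ℝ => (q.1, q.2.1, q.2.2 * η q.1 q.2.1)) (0, p) := by
        have h1 := (an_lift2 (B.analytic_surface p.1) p.2)
        have h2 : ContinuousAt (fun q : ℝ × ℝ × ℝ => η q.1 q.2.1) (0, p) :=
          AnalyticAt.continuousAt h1
        exact continuousAt_fst.prodMk ((continuousAt_fst.comp continuousAt_snd).prodMk
          ((continuousAt_snd.comp continuousAt_snd).mul h2))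
      refine hc.eventually (p := fun q : ℝ × ℝ × ℝ => Q q.1 q.2.1 q.2.2) ?_
      refine hQ p.1 _ ?_
      simp only [B.surface_zero]
      exact ⟨mul_nonneg hp.2.1 hd, mul_le_of_le_one_left hd hp.2.2⟩)
  exact key.mono fun t ht x hx s hs => ht (x, s) ⟨hx, hs⟩

lemma eventually_below (B : IsStokesBranch a d ψ η lam) (hd : 0 < d) (P : ℝ)
    {Q : ℝ → ℝ → ℝ → Prop}
    (hQ : ∀ x, ∀ y ∈ Icc 0 d, ∀ᶠ p in 𝓝 ((0, x, y) : ℝ × ℝ × ℝ), Q p.1 p.2.1 p.2.2) :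
    ∀ᶠ t in 𝓝 0, ∀ x ∈ Icc 0 P, 0 < η t x ∧ ∀ y ∈ Icc 0 (η t x), Q t x y := by
  have hpos : ∀ᶠ t in 𝓝 0, ∀ x ∈ Icc 0 P, 0 < η t x := by
    refine isCompact_Icc.eventually_forall_of_forall_eventually fun x _ => ?_
    have h1 := (B.analytic_surface x).continuousAt
    exact h1.eventually_const_lt (by simpa [B.surface_zero x] using hd)
  filter_upwards [B.eventually_rect hd.le P hQ, hpos] with t ht htp x hx
  refine ⟨htp x hx, fun y hy => ?_⟩
  have := ht x hx (y / η t x)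
    ⟨div_nonneg hy.1 (htp x hx).le, (div_le_one (htp x hx)).mpr hy.2⟩
  rwa [div_mul_cancel₀ _ (htp x hx).ne'] at this

end IsStokesBranch

/-- The wave equations hold only for `t ≥ 0`, but a point `t > 0` is interior, so there they may be
differentiated in `t`. -/
lemma eventually_eventually_of_nhdsGE {p : ℝ → Prop} (h : ∀ᶠ t in 𝓝[≥] (0 : ℝ), p t) :
    ∀ᶠ t in 𝓝[>] (0 : ℝ), ∀ᶠ s in 𝓝 t, p s := by
  have h1 : ∀ᶠ t in 𝓝[>] (0 : ℝ), p t := h.filter_mono (nhdsWithin_mono _ Ioi_subset_Ici_self)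
  filter_upwards [eventually_eventually_nhdsWithin.mpr h1, self_mem_nhdsWithin] with t ht h0
  rwa [isOpen_Ioi.nhdsWithin_eq h0] at ht

/-! ### Pointwise identities along the branch -/

/-- Everything that is needed near a single `t > 0` on the branch. -/
structure GoodTime (a d : ℝ) (ψ : ℝ → ℝ → ℝ → ℝ) (η : ℝ → ℝ → ℝ) (lam : ℝ → ℝ) (t : ℝ) :
    Prop where
  wave : ∀ᶠ s in 𝓝 t, IsWave a (bernoulli a d) (basePeriod a d) (lam s) (ψ s) (η s)
  lam : DifferentiableAt ℝ lam t
  surface : ∀ x ∈ Icc 0 (basePeriod a d), AnalyticAt ℝ (fun p : ℝ × ℝ => η p.1 p.2) (t, x)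
  stream : ∀ x ∈ Icc 0 (basePeriod a d), ∀ y ∈ Icc 0 (η t x), An ψ t x y
  ne_zero : ∀ x ∈ Icc 0 (basePeriod a d), py ψ t x (η t x) ≠ 0

lemma IsStokesBranch.goodTime (B : IsStokesBranch a d ψ η lam) (hd : 0 < d)
    (hk : kappa a d ≠ 0) : ∀ᶠ t in 𝓝[>] (0 : ℝ), GoodTime a d ψ η lam t := by
  have h1 := B.eventually_below hd (basePeriod a d) (Q := An ψ) fun x y hy => (B.an x hy).eventually
  have h2 := eventually_forall_Icc (basePeriod a d)
    (Q := fun t x => AnalyticAt ℝ (fun p : ℝ × ℝ => η p.1 p.2) (t, x))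
    fun x => (B.analytic_surface x).eventually_analyticAt
  have h3 := eventually_forall_Icc (basePeriod a d) (Q := fun t x => py ψ t x (η t x) ≠ 0)
    fun x => by
      have hm : η 0 x ∈ Icc 0 d := by rw [B.surface_zero]; exact ⟨hd.le, le_rfl⟩
      have h := (((B.an x hm).py.surface (B.analytic_surface x) 0).analyticAt_tx).continuousAt
      refine h.eventually_ne ?_
      simp only [B.surface_zero]
      have := (B.laminarTop hd).dy x
      rw [py]
      rwa [show deriv (fun s => ψ 0 x s) d = kappa a d from this]
  have h4 := B.analytic_lam.eventually_analyticAt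
  filter_upwards [eventually_eventually_of_nhdsGE B.wave, nhdsWithin_le_nhds h1,
    nhdsWithin_le_nhds h2, nhdsWithin_le_nhds h3, nhdsWithin_le_nhds h4] with t g1 g2 g3 g4 g5
  exact ⟨g1, g5.differentiableAt, g3, fun x hx => (g2 x hx).2, g4⟩

namespace GoodTime

variable {t x y : ℝ}

lemma hasDerivAt_surface_t (g : GoodTime a d ψ η lam t) (hx : x ∈ Icc 0 (basePeriod a d)) :
    HasDerivAt (fun s => η s x) (pt (lift2 η) t x 0) t :=
  (an_lift2 (g.surface x hx) 0).hasDerivAt_t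

lemma hasDerivAt_surface_x (g : GoodTime a d ψ η lam t) (hx : x ∈ Icc 0 (basePeriod a d)) :
    HasDerivAt (η t) (deriv (η t) x) x :=
  (an_lift2 (g.surface x hx) 0).hasDerivAt_x

lemma top_mem (g : GoodTime a d ψ η lam t) : η t x ∈ Icc 0 (η t x) :=
  ⟨(g.wave.self_of_nhds.pos x).le, le_rfl⟩

lemma surface_t (g : GoodTime a d ψ η lam t) (hx : x ∈ Icc 0 (basePeriod a d)) :
    pt ψ t x (η t x) + py ψ t x (η t x) * pt (lift2 η) t x 0 = 0 := by
  have h1 := (g.stream x hx _ g.top_mem).hasDerivAt_comp (hasDerivAt_id t) (hasDerivAt_const t x)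
    (g.hasDerivAt_surface_t hx) rfl rfl rfl
  have h2 : HasDerivAt (fun s => ψ (id s) x (η s x)) 0 t :=
    (hasDerivAt_const t (1 : ℝ)).congr_of_eventuallyEq (g.wave.mono fun s hs => hs.surface x)
  have := h1.unique h2
  linarith

lemma surface_x (g : GoodTime a d ψ η lam t) (hx : x ∈ Icc 0 (basePeriod a d)) :
    px ψ t x (η t x) + py ψ t x (η t x) * deriv (η t) x = 0 := by
  have h1 := (g.stream x hx _ g.top_mem).hasDerivAt_comp (hasDerivAt_const x t) (hasDerivAt_id x)
    (g.hasDerivAt_surface_x hx) rfl rfl rfl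
  have h2 : HasDerivAt (fun s => ψ t (id s) (η t s)) 0 x :=
    (hasDerivAt_const x (1 : ℝ)).congr_of_eventuallyEq
      (Eventually.of_forall fun s => g.wave.self_of_nhds.surface s)
  have := h1.unique h2
  linarith

/-- The `t`-derivative of the Bernoulli equation along the moving surface. The coefficient of `η_t`
is the same `ρ` as in the eigenvalue problem, so `ψ_t` satisfies its boundary condition with `μ = 0`
apart from the `λ'` term. -/
lemma dynamic_t (g : GoodTime a d ψ η lam t) (hx : x ∈ Icc 0 (basePeriod a d)) :
    py ψ t x (η t x) * py (pt ψ) t x (η t x) + lam t ^ 2 * px ψ t x (η t x) * px (pt ψ) t x (η t x)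
      = -(1 + lam t ^ 2 * px (py ψ) t x (η t x) * px ψ t x (η t x)
          + py (py ψ) t x (η t x) * py ψ t x (η t x)) * pt (lift2 η) t x 0
        - lam t * deriv lam t * px ψ t x (η t x) ^ 2 := by
  have hA := g.stream x hx _ g.top_mem
  have hη := g.hasDerivAt_surface_t hx
  have h1 := hA.py.hasDerivAt_comp (hasDerivAt_id t) (hasDerivAt_const t x) hη rfl rfl rfl
  have h2 := hA.px.hasDerivAt_comp (hasDerivAt_id t) (hasDerivAt_const t x) hη rfl rfl rfl
  have h3 := ((((h1.pow 2).add ((g.lam.hasDerivAt.pow 2).mul (h2.pow 2))).const_mul (1 / 2)).add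
    hη)
  have h4 := (hasDerivAt_const t (bernoulli a d)).congr_of_eventuallyEq
    (g.wave.mono fun s hs => hs.dynamic x)
  have := h3.unique h4
  simp only [hA.pt_py, hA.pt_px, hA.px_py, Pi.pow_apply, id] at this ⊢
  norm_num at this
  linear_combination this

lemma vorticity_t (g : GoodTime a d ψ η lam t) (hx : x ∈ Icc 0 (basePeriod a d))
    (hy : y ∈ Ioo 0 (η t x)) :
    lam t ^ 2 * px (px (pt ψ)) t x y + py (py (pt ψ)) t x y
      = -2 * lam t * deriv lam t * px (px ψ) t x y := by
  have hA := g.stream x hx _ (Ioo_subset_Icc_self hy)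
  have h1 := (((g.lam.hasDerivAt.pow 2).mul hA.px.px.hasDerivAt_t).add
    hA.py.py.hasDerivAt_t).add_const a
  have hev : ∀ᶠ s in 𝓝 t, y ∈ Ioo 0 (η s x) := by
    filter_upwards [(g.hasDerivAt_surface_t hx).continuousAt.eventually_const_lt hy.2] with s hs
      using ⟨hy.1, hs⟩
  have h2 := (hasDerivAt_const t (0 : ℝ)).congr_of_eventuallyEq
    ((g.wave.and hev).mono fun s hs => hs.1.vorticity x y hs.2)
  have := h1.unique h2
  simp only [hA.pt_px_px, hA.pt_py_py, Pi.pow_apply] at this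
  norm_num at this
  linear_combination this

lemma pt_bottom (g : GoodTime a d ψ η lam t) : pt ψ t x 0 = 0 :=
  ((hasDerivAt_const t (0 : ℝ)).congr_of_eventuallyEq (g.wave.mono fun _ hs => hs.bottom x)).deriv

lemma pt_periodic (g : GoodTime a d ψ η lam t) : pt ψ t (x + basePeriod a d) y = pt ψ t x y :=
  Filter.EventuallyEq.deriv_eq (g.wave.mono fun _ hs => hs.periodic_stream x y)

end GoodTime

lemma dx_periodic {u : ℝ → ℝ → ℝ} {P y : ℝ} (h : ∀ x, u (x + P) y = u x y) (x : ℝ) :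
    dx u (x + P) y = dx u x y := by
  have e : (fun s => u (s + P) y) = fun s => u s y := funext h
  rw [dx, ← deriv_comp_add_const, e, dx]

/-- Green's identity for an eigenfunction and the `t`-derivative of the stream function. -/
lemma GoodTime.eigenvalue_identity {t μ : ℝ} {v : ℝ → ℝ → ℝ} (g : GoodTime a d ψ η lam t)
    (hP : 0 ≤ basePeriod a d)
    (hv : IsEigenfunction (basePeriod a d) (lam t) (ψ t) (η t) μ v) :
    μ * ∫ x in 0..basePeriod a d, v x (η t x) * pt (lift2 η) t x 0 / py ψ t x (η t x)
      = lam t * deriv lam t * ((∫ x in 0..basePeriod a d,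
          v x (η t x) * px ψ t x (η t x) ^ 2 / py ψ t x (η t x))
        - 2 * ∫ p in rect (basePeriod a d),
          η t p.1 * (v p.1 (p.2 * η t p.1) * px (px ψ) t p.1 (p.2 * η t p.1))) := by
  have hw := g.wave.self_of_nhds
  have key := green_graph hP (lam t) (η := η t) (u := pt ψ t) (v := v)
    (fun x hx => by
      have h1 : AnalyticAt ℝ (fun s : ℝ => (t, s)) x := analyticAt_const.prod analyticAt_id
      exact (AnalyticAt.fun_comp_of_eq (g := fun p : ℝ × ℝ => η p.1 p.2) (g.surface x hx) h1
        rfl).contDiffAt)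
    (fun x _ => (hw.pos x).le) (by simpa using hw.periodic_surface 0)
    (fun x hx y hy => (g.stream x hx y hy).pt.cd 2) (fun x _ y hy => hv.regular x y hy)
    (fun x _ => g.pt_bottom) (fun x _ => hv.bottom x)
    (fun y _ => by simpa using g.pt_periodic (x := 0) (y := y))
    (fun y _ => by simpa using hv.periodic 0 y)
    (fun y _ => by simpa using dx_periodic (fun x => g.pt_periodic (x := x) (y := y)) 0)
    (fun y _ => by simpa using dx_periodic (fun x => hv.periodic x y) 0)
  have e1 : ∫ p in rect (basePeriod a d), η t p.1 *
        (v p.1 (p.2 * η t p.1) * (lam t ^ 2 * dx (dx (pt ψ t)) p.1 (p.2 * η t p.1)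
            + dy (dy (pt ψ t)) p.1 (p.2 * η t p.1))
          - pt ψ t p.1 (p.2 * η t p.1) * (lam t ^ 2 * dx (dx v) p.1 (p.2 * η t p.1)
            + dy (dy v) p.1 (p.2 * η t p.1)))
      = -2 * lam t * deriv lam t * ∫ p in rect (basePeriod a d),
          η t p.1 * (v p.1 (p.2 * η t p.1) * px (px ψ) t p.1 (p.2 * η t p.1)) := by
    rw [← integral_const_mul]
    refine setIntegral_congr_fun (measurableSet_rect _) fun p hp => ?_
    have h0 := hw.pos p.1
    have hy : p.2 * η t p.1 ∈ Ioo 0 (η t p.1) :=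
      ⟨mul_pos hp.2.1 h0, mul_lt_of_lt_one_left h0 hp.2.2⟩
    have h1 := g.vorticity_t (rect_subset _ hp).1 hy
    have h2 := hv.interior p.1 _ hy
    change lam t ^ 2 * dx (dx v) p.1 (p.2 * η t p.1) + dy (dy v) p.1 (p.2 * η t p.1) = 0 at h2
    change lam t ^ 2 * dx (dx (pt ψ t)) p.1 (p.2 * η t p.1)
      + dy (dy (pt ψ t)) p.1 (p.2 * η t p.1) = _ at h1
    simp only [h1, h2]
    ring
  have e2 : ∫ x in 0..basePeriod a d,
        ((v x (η t x) * dy (pt ψ t) x (η t x) - pt ψ t x (η t x) * dy v x (η t x))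
          - deriv (η t) x * (lam t ^ 2 * (v x (η t x) * dx (pt ψ t) x (η t x)
            - pt ψ t x (η t x) * dx v x (η t x))))
      = ∫ x in 0..basePeriod a d,
        (μ * (v x (η t x) * pt (lift2 η) t x 0 / py ψ t x (η t x))
          - lam t * deriv lam t * (v x (η t x) * px ψ t x (η t x) ^ 2 / py ψ t x (η t x))) := by
    refine intervalIntegral.integral_congr fun x hx => ?_
    rw [uIcc_of_le hP] at hx
    have h1 := g.surface_t hx
    have h2 := g.surface_x hx
    have h3 := g.dynamic_t hx
    have h4 := hv.surface x
    have hne := g.ne_zero x hx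
    change lam t ^ 2 * px ψ t x (η t x) * dx v x (η t x) + py ψ t x (η t x) * dy v x (η t x)
      - (1 + lam t ^ 2 * px (py ψ) t x (η t x) * px ψ t x (η t x)
        + py (py ψ) t x (η t x) * py ψ t x (η t x)) / py ψ t x (η t x) * v x (η t x)
      = μ / py ψ t x (η t x) * v x (η t x) at h4
    change (v x (η t x) * py (pt ψ) t x (η t x) - pt ψ t x (η t x) * dy v x (η t x))
          - deriv (η t) x * (lam t ^ 2 * (v x (η t x) * px (pt ψ) t x (η t x)
            - pt ψ t x (η t x) * dx v x (η t x))) = _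
    generalize 1 + lam t ^ 2 * px (py ψ) t x (η t x) * px ψ t x (η t x)
        + py (py ψ) t x (η t x) * py ψ t x (η t x) = ρ at *
    generalize py (pt ψ) t x (η t x) = uy at *
    generalize px (pt ψ) t x (η t x) = ux at *
    -- The differentiated kinematic condition `ψ = 1` trades `ψ_t` and `ψ_x` on the surface for
    -- `η_t` and `η_x`; what remains is a combination of the dynamic condition and the boundary
    -- condition of `v`.
    have h1' : pt ψ t x (η t x) = -(py ψ t x (η t x) * pt (lift2 η) t x 0) := by linarith
    have h2' : px ψ t x (η t x) = -(py ψ t x (η t x) * deriv (η t) x) := by linarith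
    rw [h1']
    rw [h2'] at h3 h4 ⊢
    generalize py ψ t x (η t x) = p at *
    generalize pt (lift2 η) t x 0 = ηt at *
    generalize deriv (η t) x = ηx at *
    generalize dx v x (η t x) = vx at *
    generalize dy v x (η t x) = vy at *
    generalize v x (η t x) = V at *
    field_simp at h4 ⊢
    linear_combination V * h3 + ηt * h4
  have hηc : ∀ x ∈ Icc 0 (basePeriod a d), ContinuousAt (η t) x := fun x hx =>
    (g.hasDerivAt_surface_x hx).continuousAt
  have hgc : ∀ x ∈ Icc 0 (basePeriod a d), ContinuousAt (fun x => (x, η t x)) x := fun x hx =>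
    continuousAt_id.prodMk (hηc x hx)
  have hvc : ∀ x ∈ Icc 0 (basePeriod a d), ContinuousAt (fun x => v x (η t x)) x := fun x hx =>
    ContinuousAt.comp (g := fun q : ℝ × ℝ => v q.1 q.2) (f := fun x => (x, η t x))
      (hv.regular x _ g.top_mem).continuousAt (hgc x hx)
  have hAc : ∀ {f : ℝ → ℝ → ℝ → ℝ} {x}, x ∈ Icc 0 (basePeriod a d) → An f t x (η t x) →
      ContinuousAt (fun x => f t x (η t x)) x := fun {f x} hx hf =>
    ContinuousAt.comp (g := fun q : ℝ × ℝ => f t q.1 q.2) (f := fun x => (x, η t x))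
      (hf.cd 0).continuousAt (hgc x hx)
  have hηt : ∀ x ∈ Icc 0 (basePeriod a d), ContinuousAt (fun x => pt (lift2 η) t x 0) x :=
    fun x hx => (an_lift2 (g.surface x hx) 0).pt.hasDerivAt_x.continuousAt
  have i1 : IntervalIntegrable (fun x => v x (η t x) * pt (lift2 η) t x 0 / py ψ t x (η t x))
      volume 0 (basePeriod a d) :=
    ContinuousOn.intervalIntegrable_of_Icc hP fun x hx =>
      (((hvc x hx).mul (hηt x hx)).div (hAc hx (g.stream x hx _ g.top_mem).py)
        (g.ne_zero x hx)).continuousWithinAt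
  have i2 : IntervalIntegrable (fun x => v x (η t x) * px ψ t x (η t x) ^ 2 / py ψ t x (η t x))
      volume 0 (basePeriod a d) :=
    ContinuousOn.intervalIntegrable_of_Icc hP fun x hx =>
      (((hvc x hx).mul ((hAc hx (g.stream x hx _ g.top_mem).px).pow 2)).div
        (hAc hx (g.stream x hx _ g.top_mem).py) (g.ne_zero x hx)).continuousWithinAt
  rw [e1, e2, intervalIntegral.integral_sub (i1.const_mul _) (i2.const_mul _),
    intervalIntegral.integral_const_mul, intervalIntegral.integral_const_mul] at key
  linear_combination -key

end branch

/-! ### The limit of the eigenvalue identity as `t → 0+` -/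

section limit

variable {a d : ℝ} {ψ : ℝ → ℝ → ℝ → ℝ} {η : ℝ → ℝ → ℝ} {lam : ℝ → ℝ}

lemma hasDerivAt_intervalIntegral {P : ℝ} (hP : 0 ≤ P) {f : ℝ → ℝ → ℝ → ℝ}
    (hf : ∀ x ∈ Icc 0 P, An f 0 x 0) :
    HasDerivAt (fun t => ∫ x in 0..P, f t x 0) (∫ x in 0..P, pt f 0 x 0) 0 := by
  simp only [intervalIntegral.integral_of_le hP]
  exact hasDerivAt_setIntegral isCompact_Icc measurableSet_Ioc Ioc_subset_Icc_self
    fun x hx => (hf x hx).analyticAt_tx.contDiffAt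

lemma hasDerivAt_rectIntegral {P : ℝ} {f : ℝ → ℝ → ℝ → ℝ}
    (hf : ∀ x ∈ Icc 0 P, ∀ s ∈ Icc (0 : ℝ) 1, An f 0 x s) :
    HasDerivAt (fun t => ∫ p in rect P, f t p.1 p.2) (∫ p in rect P, pt f 0 p.1 p.2) 0 :=
  hasDerivAt_setIntegral (isCompact_Icc.prod isCompact_Icc) (measurableSet_rect P) (rect_subset P)
    (Φ := fun t p => f t p.1 p.2) fun p hp => AnalyticAt.contDiffAt (hf p.1 hp.1 p.2 hp.2)

lemma An.pow {f : ℝ → ℝ → ℝ → ℝ} {t x y : ℝ} (hf : An f t x y) (n : ℕ) :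
    An (fun t x y => f t x y ^ n) t x y := AnalyticAt.fun_pow hf n

namespace IsStokesBranch

lemma mem_top (B : IsStokesBranch a d ψ η lam) (hd : 0 < d) (x : ℝ) : η 0 x ∈ Icc 0 d := by
  rw [B.surface_zero]; exact ⟨hd.le, le_rfl⟩

lemma py_zero_top (B : IsStokesBranch a d ψ η lam) (hd : 0 < d) (x : ℝ) :
    py ψ 0 x d = kappa a d := (B.laminarTop hd).dy x

lemma pt_surface (B : IsStokesBranch a d ψ η lam) (x y : ℝ) :
    pt (lift2 η) 0 x y = Real.cos (tauStar a d * x) := B.surface_one x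

lemma py_px_px_zero (B : IsStokesBranch a d ψ η lam) (x : ℝ) {y : ℝ} (hy : y ∈ Ioo 0 d) :
    py (px (px ψ)) 0 x y = 0 := by
  have e : (fun s => px (px ψ) 0 x s) =ᶠ[𝓝 y] fun _ => 0 := by
    filter_upwards [Ioo_mem_nhds hy.1 hy.2] with s hs
    exact B.px_px_zero x (Ioo_subset_Icc_self hs)
  rw [py, e.deriv_eq, deriv_const]

variable {v : ℝ → ℝ → ℝ → ℝ}

/-- The denominator in the formula for the second eigenvalue. -/
lemma tendsto_weight (B : IsStokesBranch a d ψ η lam) (hd : criticalDepth a < d)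
    (hk : kappa a d ≠ 0) (hv : ∀ x, ∀ y ∈ Icc 0 d, An v 0 x y) :
    Tendsto (fun t => ∫ x in 0..basePeriod a d,
        v t x (η t x) * pt (lift2 η) t x 0 / py ψ t x (η t x)) (𝓝 0)
      (𝓝 ((∫ x in 0..basePeriod a d, v 0 x d * Real.cos (tauStar a d * x)) / kappa a d)) := by
  have hd0 := pos_of_criticalDepth_lt hd
  have h := (hasDerivAt_intervalIntegral (basePeriod_pos hd hk).le
    (f := fun t x y => v t x (η t x) * pt (lift2 η) t x y / py ψ t x (η t x)) fun x _ => by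
      have hη := B.analytic_surface x
      refine (((hv x _ (B.mem_top hd0 x)).surface hη 0).mul (an_lift2 hη 0).pt).div
        ((B.an x (B.mem_top hd0 x)).py.surface hη 0) ?_
      rw [B.surface_zero, B.py_zero_top hd0]
      exact hk).continuousAt.tendsto
  convert h using 2
  rw [← intervalIntegral.integral_div]
  refine intervalIntegral.integral_congr fun x _ => ?_
  simp only [B.surface_zero, B.pt_surface, B.py_zero_top hd0]

/-- The integrand is quadratic in `ψ_x`, which vanishes at `t = 0`, so this term does not contribute
to the limit. -/
lemma hasDerivAt_surfaceTerm (B : IsStokesBranch a d ψ η lam) (hd : criticalDepth a < d)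
    (hk : kappa a d ≠ 0) (hv : ∀ x, ∀ y ∈ Icc 0 d, An v 0 x y) :
    HasDerivAt (fun t => ∫ x in 0..basePeriod a d,
        v t x (η t x) * px ψ t x (η t x) ^ 2 / py ψ t x (η t x)) 0 0 := by
  have hd0 := pos_of_criticalDepth_lt hd
  have hne : ∀ x, py ψ 0 x (η 0 x) ≠ 0 := fun x => by
    rw [B.surface_zero, B.py_zero_top hd0]; exact hk
  have hV : ∀ x y, An (fun t x _ => v t x (η t x)) 0 x y := fun x y =>
    (hv x _ (B.mem_top hd0 x)).surface (B.analytic_surface x) y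
  have hX : ∀ x y, An (fun t x _ => px ψ t x (η t x)) 0 x y := fun x y =>
    (B.an x (B.mem_top hd0 x)).px.surface (B.analytic_surface x) y
  have hY : ∀ x y, An (fun t x _ => py ψ t x (η t x)) 0 x y := fun x y =>
    (B.an x (B.mem_top hd0 x)).py.surface (B.analytic_surface x) y
  have h := hasDerivAt_intervalIntegral (basePeriod_pos hd hk).le
    (f := fun t x _ => v t x (η t x) * px ψ t x (η t x) ^ 2 / py ψ t x (η t x)) fun x _ =>
      ((hV x 0).mul ((hX x 0).pow 2)).div (hY x 0) (hne x)
  convert h using 1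
  rw [intervalIntegral.integral_congr (g := fun _ => (0 : ℝ)), intervalIntegral.integral_zero]
  intro x _
  have hz : px ψ 0 x (η 0 x) = 0 := B.px_zero x (B.mem_top hd0 x)
  have := (((hV x 0).hasDerivAt_t.mul ((hX x 0).hasDerivAt_t.pow 2)).div (hY x 0).hasDerivAt_t
    (hne x)).deriv
  refine this.trans ?_
  simp [hz]

/-- Since `ψ_xx` vanishes identically at `t = 0`, neither the variation of `v` nor that of the
domain matters: only `ψ_xxt = κ τ_* ^ 2 γ cos τ_* x` contributes. -/
lemma hasDerivAt_interiorTerm (B : IsStokesBranch a d ψ η lam) (hd : criticalDepth a < d)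
    (hv : ∀ x, ∀ y ∈ Icc 0 d, An v 0 x y) :
    HasDerivAt (fun t => ∫ p in rect (basePeriod a d),
        η t p.1 * (v t p.1 (p.2 * η t p.1) * px (px ψ) t p.1 (p.2 * η t p.1)))
      (kappa a d * tauStar a d ^ 2 * ∫ p in rect (basePeriod a d),
        d * (v 0 p.1 (p.2 * d) * (gam d (tauStar a d) (p.2 * d) * Real.cos (tauStar a d * p.1)))) 0
      := by
  have hd0 := pos_of_criticalDepth_lt hd
  have hm : ∀ x, ∀ s ∈ Icc (0 : ℝ) 1, s * η 0 x ∈ Icc 0 d := fun x s hs => by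
    rw [B.surface_zero]
    exact ⟨mul_nonneg hs.1 hd0.le, mul_le_of_le_one_left hd0.le hs.2⟩
  have hE : ∀ x s, An (fun t x _ => η t x) 0 x s := fun x s => an_lift2 (B.analytic_surface x) s
  have hV : ∀ x, ∀ s ∈ Icc (0 : ℝ) 1, An (fun t x s => v t x (s * η t x)) 0 x s := fun x s hs =>
    (hv x _ (hm x s hs)).flatten (B.analytic_surface x)
  have hX : ∀ x, ∀ s ∈ Icc (0 : ℝ) 1, An (fun t x s => px (px ψ) t x (s * η t x)) 0 x s :=
    fun x s hs => (B.an x (hm x s hs)).px.px.flatten (B.analytic_surface x)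
  have h := hasDerivAt_rectIntegral (P := basePeriod a d)
    (f := fun t x s => η t x * (v t x (s * η t x) * px (px ψ) t x (s * η t x)))
    fun x _ s hs => (hE x s).mul ((hV x s hs).mul (hX x s hs))
  convert h using 1
  rw [← integral_const_mul]
  refine setIntegral_congr_fun (measurableSet_rect _) fun p hp => ?_
  have hs := (rect_subset _ hp).2
  have hy : p.2 * d ∈ Ioo 0 d := ⟨mul_pos hp.2.1 hd0, mul_lt_of_lt_one_left hd0 hp.2.2⟩
  have hy' := Ioo_subset_Icc_self hy
  have hz : px (px ψ) 0 p.1 (p.2 * d) = 0 := B.px_px_zero p.1 hy'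
  have h1 : HasDerivAt (fun t => px (px ψ) t p.1 (p.2 * η t p.1))
      (kappa a d * tauStar a d ^ 2 * (gam d (tauStar a d) (p.2 * d)
        * Real.cos (tauStar a d * p.1))) 0 := by
    have hA := B.an p.1 hy'
    have h2 := hA.px.px.hasDerivAt_comp (hasDerivAt_id 0) (hasDerivAt_const 0 p.1)
      ((hE p.1 0).hasDerivAt_t.const_mul p.2) rfl rfl (by rw [B.surface_zero])
    refine h2.congr_deriv ?_
    rw [hA.pt_px_px, B.px_px_pt_zero _ hy', B.py_px_px_zero _ hy]
    ring
  have := ((hE p.1 p.2).hasDerivAt_t.mul ((hV p.1 p.2 hs).hasDerivAt_t.mul h1)).deriv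
  refine Eq.symm (this.trans ?_)
  simp only [Pi.mul_apply, B.surface_zero, hz, mul_zero]
  ring

/-- The second eigenvalue to second order, in terms of the second derivative of `lam`. -/
lemma tendsto_eigenvalue (B : IsStokesBranch a d ψ η lam) (hd : criticalDepth a < d)
    (hk : kappa a d ≠ 0) {μ : ℝ → ℝ} (hv : ∀ x, ∀ y ∈ Icc 0 d, An v 0 x y)
    (h : ∀ᶠ t in 𝓝[≥] (0 : ℝ),
        IsSecondEigenvalue (basePeriod a d) (lam t) (ψ t) (η t) (μ t) ∧
        IsEigenfunction (basePeriod a d) (lam t) (ψ t) (η t) (μ t) (v t)) :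
    Tendsto (fun t => μ t / t ^ 2) (𝓝[>] 0)
      (𝓝 (-deriv (deriv lam) 0 * (kappa a d ^ 2 * (gamSlope d (tauStar a d)
        + d * tauStar a d ^ 2 - d * gamSlope d (tauStar a d) ^ 2)))) := by
  have hd0 := pos_of_criticalDepth_lt hd
  have hP := basePeriod_pos hd hk
  have hT := B.laminarTop hd0
  have h0 := h.self_of_nhdsWithin self_mem_Ici
  rw [B.lam_zero, B.surface_zero_fun] at h0
  have hμ0 := h0.1.eq_zero hd hk hT
  have hv0 := h0.2
  rw [hμ0] at hv0
  set m := ∫ x in 0..basePeriod a d, v 0 x d * Real.cos (tauStar a d * x) with hm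
  have hm0 : m ≠ 0 := hv0.first_mode_ne_zero hd hk hT
  have hA := (B.tendsto_weight hd hk hv).mono_left (nhdsWithin_le_nhds (s := Ioi 0))
  have hB := (B.hasDerivAt_surfaceTerm hd hk hv).sub ((B.hasDerivAt_interiorTerm hd hv).const_mul 2)
  set A : ℝ → ℝ := fun t => ∫ x in 0..basePeriod a d,
        v t x (η t x) * pt (lift2 η) t x 0 / py ψ t x (η t x)
  set I : ℝ → ℝ := fun t => (∫ x in 0..basePeriod a d,
          v t x (η t x) * px ψ t x (η t x) ^ 2 / py ψ t x (η t x))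
        - 2 * ∫ p in rect (basePeriod a d),
          η t p.1 * (v t p.1 (p.2 * η t p.1) * px (px ψ) t p.1 (p.2 * η t p.1)) with hI
  set G := gamSlope d (tauStar a d) with hG
  -- The interior integral reduces to the first mode of the trace of `v`: at `t = 0` the eigenvalue
  -- is zero, so `v_y = G v` on top and the weighted Green identity closes.
  have hval : 2 * tauStar a d ^ 2 * ∫ p in rect (basePeriod a d),
      d * (v 0 p.1 (p.2 * d) * (gam d (tauStar a d) (p.2 * d) * Real.cos (tauStar a d * p.1)))
      = (G + d * tauStar a d ^ 2 - d * G ^ 2) * m := by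
    have e := hv0.stripFun.green_gam_weight hd0 hP.le
      (ω := tauStar a d) (by simpa using sin_nat_mul_basePeriod hd hk 1)
      (by simpa using cos_nat_mul_basePeriod hd hk 1) hv0.laplace
    rw [e, hm, ← intervalIntegral.integral_const_mul]
    refine intervalIntegral.integral_congr fun x _ => ?_
    have h1 := hv0.top hk hT x
    have h2 := one_sub_mul_kappa hd hk
    have h3 : dy (v 0) x d = G * v 0 x d := by
      have hk2 : kappa a d ^ 2 ≠ 0 := by positivity
      apply mul_left_cancel₀ hk2
      rw [h1, add_zero, h2]
      ring
    simp only [h3]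
    ring
  have hI' : HasDerivAt I (-(kappa a d * ((G + d * tauStar a d ^ 2 - d * G ^ 2) * m))) 0 := by
    refine hB.congr_deriv ?_
    rw [← hval]
    ring
  have hI0 : I 0 = 0 := by
    have e1 : ∀ x, px ψ 0 x (η 0 x) = 0 := fun x => B.px_zero x (B.mem_top hd0 x)
    have e2 : ∫ p in rect (basePeriod a d),
          η 0 p.1 * (v 0 p.1 (p.2 * η 0 p.1) * px (px ψ) 0 p.1 (p.2 * η 0 p.1)) = 0 := by
      rw [setIntegral_congr_fun (g := fun _ => (0 : ℝ)) (measurableSet_rect _), integral_zero]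
      intro p hp
      have hs := (rect_subset _ hp).2
      have : p.2 * η 0 p.1 ∈ Icc 0 d := by
        rw [B.surface_zero]
        exact ⟨mul_nonneg hs.1 hd0.le, mul_le_of_le_one_left hd0.le hs.2⟩
      simp only [B.px_px_zero p.1 this, mul_zero]
    simp [hI, e1, e2]
  have hIlim : Tendsto (fun t => I t / t) (𝓝[>] 0)
      (𝓝 (-(kappa a d * ((G + d * tauStar a d ^ 2 - d * G ^ 2) * m)))) := by
    have := (hasDerivAt_iff_tendsto_slope.mp hI').mono_left
      (nhdsWithin_mono 0 fun x (hx : 0 < x) => hx.ne')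
    refine this.congr fun t => ?_
    simp [slope_def_field, hI0]
  have hlam : Tendsto (fun t => deriv lam t / t) (𝓝[>] 0) (𝓝 (deriv (deriv lam) 0)) := by
    have hd' : HasDerivAt (deriv lam) (deriv (deriv lam) 0) 0 :=
      B.analytic_lam.deriv.differentiableAt.hasDerivAt
    have := (hasDerivAt_iff_tendsto_slope.mp hd').mono_left
      (nhdsWithin_mono 0 fun x (hx : 0 < x) => hx.ne')
    refine this.congr fun t => ?_
    simp [slope_def_field, B.lam_one]
  have hlam0 : Tendsto lam (𝓝[>] 0) (𝓝 1) := by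
    have := B.analytic_lam.continuousAt.tendsto
    rw [B.lam_zero] at this
    exact this.mono_left nhdsWithin_le_nhds
  have hA0 : m / kappa a d ≠ 0 := div_ne_zero hm0 hk
  have hlim := ((hlam0.mul (hlam.mul hIlim)).div hA hA0)
  have e : 1 * (deriv (deriv lam) 0 * -(kappa a d * ((G + d * tauStar a d ^ 2 - d * G ^ 2) * m)))
      / (m / kappa a d)
      = -deriv (deriv lam) 0 * (kappa a d ^ 2 * (G + d * tauStar a d ^ 2 - d * G ^ 2)) := by
    field_simp
  rw [e] at hlim
  refine hlim.congr' ?_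
  have h' : ∀ᶠ t in 𝓝[>] (0 : ℝ),
      IsEigenfunction (basePeriod a d) (lam t) (ψ t) (η t) (μ t) (v t) :=
    (h.filter_mono (nhdsWithin_mono _ Ioi_subset_Ici_self)).mono fun t ht => ht.2
  filter_upwards [B.goodTime hd0 hk, h', hA.eventually_ne hA0,
    eventually_mem_nhdsWithin (s := Ioi (0 : ℝ))] with t hg hvt hAt ht
  have ht0 : t ≠ 0 := ne_of_gt ht
  have key := hg.eigenvalue_identity hP.le hvt
  change μ t * A t = lam t * deriv lam t * I t at key
  have : μ t = lam t * deriv lam t * I t / A t := by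
    rw [← key]; field_simp
  change lam t * (deriv lam t / t * (I t / t)) / A t = μ t / t ^ 2
  rw [this]
  field_simp

end IsStokesBranch

end limit

/-- An analytic function is determined to second order by its one-sided limit quotient. -/
lemma isBigO_of_tendsto_div_sq {μ : ℝ → ℝ} {M : ℝ} (hμ : AnalyticAt ℝ μ 0)
    (h : Tendsto (fun t => μ t / t ^ 2) (𝓝[>] 0) (𝓝 M)) :
    (fun t => μ t - M * t ^ 2) =O[𝓝[≥] (0 : ℝ)] fun t => t ^ 3 := by
  have hg : AnalyticAt ℝ (fun t => μ t - M * t ^ 2) 0 := by fun_prop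
  by_cases h0 : ∀ᶠ t in 𝓝 (0 : ℝ), μ t - M * t ^ 2 = 0
  · refine IsBigO.of_bound 1 (nhdsWithin_le_nhds (h0.mono fun t ht => ?_))
    rw [ht, norm_zero]
    positivity
  obtain ⟨n, f, hf, hf0, hev⟩ := hg.exists_eventuallyEq_pow_smul_nonzero_iff.mpr h0
  have hlim : Tendsto (fun t => (μ t - M * t ^ 2) / t ^ 2) (𝓝[>] 0) (𝓝 0) := by
    have := h.sub_const M
    rw [sub_self] at this
    refine this.congr' ?_
    filter_upwards [self_mem_nhdsWithin] with t ht
    have ht0 : t ≠ 0 := ne_of_gt ht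
    field_simp
  -- An order of vanishing below 3 would make the nonzero number `f 0` the limit of the quotient by
  -- `t ^ 2` times `t ^ (2 - n)`, which is zero.
  have hn : 3 ≤ n := by
    by_contra hn
    have h2 : Tendsto (fun t => (μ t - M * t ^ 2) / t ^ 2 * t ^ (2 - n)) (𝓝[>] 0) (𝓝 0) := by
      have : Tendsto (fun t : ℝ => t ^ (2 - n)) (𝓝[>] 0) (𝓝 (0 ^ (2 - n))) :=
        ((continuous_pow (2 - n)).tendsto 0).mono_left nhdsWithin_le_nhds
      simpa using hlim.mul this
    have h3 : Tendsto f (𝓝[>] 0) (𝓝 (f 0)) := hf.continuousAt.tendsto.mono_left nhdsWithin_le_nhds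
    refine hf0 (tendsto_nhds_unique (h3.congr' ?_) h2)
    filter_upwards [nhdsWithin_le_nhds hev, self_mem_nhdsWithin] with t ht ht0
    have ht0 : t ≠ 0 := ne_of_gt ht0
    have e : t ^ 2 = t ^ n * t ^ (2 - n) := by rw [← pow_add]; congr 1; omega
    rw [ht, sub_zero, smul_eq_mul, e]
    field_simp
  have hO : (fun t => (t ^ (n - 3) * f t) * t ^ 3) =O[𝓝 (0 : ℝ)] fun t => 1 * t ^ 3 := by
    refine IsBigO.mul ?_ (isBigO_refl _ _)
    have : ContinuousAt (fun t => t ^ (n - 3) * f t) 0 :=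
      (continuous_pow (n - 3)).continuousAt.mul hf.continuousAt
    exact this.norm.isBoundedUnder_le.isBigO_one ℝ
  simp only [one_mul] at hO
  refine (hO.congr' ?_ EventuallyEq.rfl).mono nhdsWithin_le_nhds
  filter_upwards [hev] with t ht
  have e : t ^ n = t ^ (n - 3) * t ^ 3 := by rw [← pow_add]; congr 1; omega
  rw [ht, sub_zero, smul_eq_mul, e]
  ring

/-! ### Higher derivatives along the surface -/

lemma eventually_deriv_eq_zero {F F' : ℝ → ℝ} {c : ℝ} (h : ∀ᶠ t in 𝓝 c, F t = 0)
    (hF : ∀ᶠ t in 𝓝 c, HasDerivAt F (F' t) t) : ∀ᶠ t in 𝓝 c, F' t = 0 := by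
  filter_upwards [h.eventually_nhds, hF] with t h1 h2
  exact h2.unique ((hasDerivAt_const t (0 : ℝ)).congr_of_eventuallyEq h1)

/-- Extends each wave equation, given for `t ≥ 0` only, to a full neighbourhood of `0`, so that its
ordinary `t`-derivatives at `0` can be taken. -/
lemma eventually_zero_of_nhdsGE {F : ℝ → ℝ} (hF : AnalyticAt ℝ F 0)
    (h : ∀ᶠ t in 𝓝[≥] (0 : ℝ), F t = 0) : ∀ᶠ t in 𝓝 0, F t = 0 :=
  eventually_zero_of_nhdsGT hF (h.filter_mono (nhdsWithin_mono _ Ioi_subset_Ici_self))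

section commute

variable {f : ℝ → ℝ → ℝ → ℝ} {t x y : ℝ}

lemma An.pt_pt_py (h : An f t x y) :
    StokesWave.pt (StokesWave.pt (StokesWave.py f)) t x y
      = StokesWave.py (StokesWave.pt (StokesWave.pt f)) t x y := by
  rw [← h.pt.pt_py]
  exact Filter.EventuallyEq.deriv_eq (h.eventually_t.mono fun s hs => hs.pt_py)

lemma An.pt_pt_px (h : An f t x y) :
    StokesWave.pt (StokesWave.pt (StokesWave.px f)) t x y
      = StokesWave.px (StokesWave.pt (StokesWave.pt f)) t x y := by
  rw [← h.pt.pt_px]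
  exact Filter.EventuallyEq.deriv_eq (h.eventually_t.mono fun s hs => hs.pt_px)

lemma An.pt_pt_pt_py (h : An f t x y) :
    StokesWave.pt (StokesWave.pt (StokesWave.pt (StokesWave.py f))) t x y
      = StokesWave.py (StokesWave.pt (StokesWave.pt (StokesWave.pt f))) t x y := by
  rw [← h.pt.pt.pt_py]
  exact Filter.EventuallyEq.deriv_eq (h.eventually_t.mono fun s hs => hs.pt_pt_py)

lemma An.py_pt_py (h : An f t x y) :
    StokesWave.py (StokesWave.pt (StokesWave.py f)) t x y
      = StokesWave.py (StokesWave.py (StokesWave.pt f)) t x y :=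
  Filter.EventuallyEq.deriv_eq (h.eventually_y.mono fun _ hs => hs.pt_py)

lemma An.py_pt_px (h : An f t x y) :
    StokesWave.py (StokesWave.pt (StokesWave.px f)) t x y
      = StokesWave.py (StokesWave.px (StokesWave.pt f)) t x y :=
  Filter.EventuallyEq.deriv_eq (h.eventually_y.mono fun _ hs => hs.pt_px)

lemma An.py_pt_pt_py (h : An f t x y) :
    StokesWave.py (StokesWave.pt (StokesWave.pt (StokesWave.py f))) t x y
      = StokesWave.py (StokesWave.py (StokesWave.pt (StokesWave.pt f))) t x y :=
  Filter.EventuallyEq.deriv_eq (h.eventually_y.mono fun _ hs => hs.pt_pt_py)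

lemma An.py_py_pt_py (h : An f t x y) :
    StokesWave.py (StokesWave.py (StokesWave.pt (StokesWave.py f))) t x y
      = StokesWave.py (StokesWave.py (StokesWave.py (StokesWave.pt f))) t x y :=
  Filter.EventuallyEq.deriv_eq (h.eventually_y.mono fun _ hs => hs.py_pt_py)

end commute

section surface

/-- The first `t`-derivative of `f` on the surface `y = η`. -/
def surf1 (η : ℝ → ℝ → ℝ) (f : ℝ → ℝ → ℝ → ℝ) (x t : ℝ) : ℝ :=
  pt f t x (η t x) + py f t x (η t x) * pt (lift2 η) t x 0

/-- The second `t`-derivative of `f` on the surface `y = η`. -/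
def surf2 (η : ℝ → ℝ → ℝ) (f : ℝ → ℝ → ℝ → ℝ) (x t : ℝ) : ℝ :=
  pt (pt f) t x (η t x) + 2 * (py (pt f) t x (η t x) * pt (lift2 η) t x 0)
    + py (py f) t x (η t x) * pt (lift2 η) t x 0 ^ 2
    + py f t x (η t x) * pt (pt (lift2 η)) t x 0

/-- The third `t`-derivative of `f` on the surface `y = η`. -/
def surf3 (η : ℝ → ℝ → ℝ) (f : ℝ → ℝ → ℝ → ℝ) (x t : ℝ) : ℝ :=
  pt (pt (pt f)) t x (η t x) + 3 * (py (pt (pt f)) t x (η t x) * pt (lift2 η) t x 0)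
    + 3 * (py (py (pt f)) t x (η t x) * pt (lift2 η) t x 0 ^ 2)
    + 3 * (py (pt f) t x (η t x) * pt (pt (lift2 η)) t x 0)
    + py (py (py f)) t x (η t x) * pt (lift2 η) t x 0 ^ 3
    + 3 * (py (py f) t x (η t x) * (pt (lift2 η) t x 0 * pt (pt (lift2 η)) t x 0))
    + py f t x (η t x) * pt (pt (pt (lift2 η))) t x 0

variable {η : ℝ → ℝ → ℝ} {f : ℝ → ℝ → ℝ → ℝ} {x : ℝ}

lemma An.eventually_surface (hη : AnalyticAt ℝ (fun p : ℝ × ℝ => η p.1 p.2) (0, x))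
    (hf : An f 0 x (η 0 x)) : ∀ᶠ t in 𝓝 0, An f t x (η t x) := by
  have hc : ContinuousAt (fun t : ℝ => (t, x, η t x)) 0 :=
    continuousAt_id.prodMk
      (continuousAt_const.prodMk (an_lift2 hη 0).hasDerivAt_t.continuousAt)
  exact hc.eventually hf.eventually

lemma An.hasDerivAt_surface {t : ℝ} (hf : An f t x (η t x)) (hη : An (lift2 η) t x 0) :
    HasDerivAt (fun t => f t x (η t x)) (surf1 η f x t) t := by
  refine (hf.hasDerivAt_comp (hasDerivAt_id t) (hasDerivAt_const t x) hη.hasDerivAt_t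
    rfl rfl rfl).congr_deriv ?_
  rw [surf1]
  ring

lemma An.hasDerivAt_surf1 {t : ℝ} (hf : An f t x (η t x)) (hη : An (lift2 η) t x 0) :
    HasDerivAt (surf1 η f x) (surf2 η f x t) t := by
  refine ((hf.pt.hasDerivAt_surface hη).add
    ((hf.py.hasDerivAt_surface hη).mul hη.pt.hasDerivAt_t)).congr_deriv ?_
  simp only [surf1, surf2, hf.pt_py]
  ring

lemma An.hasDerivAt_surf2 {t : ℝ} (hf : An f t x (η t x)) (hη : An (lift2 η) t x 0) :
    HasDerivAt (surf2 η f x) (surf3 η f x t) t := by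
  have h1 := hη.pt.hasDerivAt_t
  refine ((((hf.pt.pt.hasDerivAt_surface hη).add
    (((hf.pt.py.hasDerivAt_surface hη).mul h1).const_mul 2)).add
    ((hf.py.py.hasDerivAt_surface hη).mul (h1.pow 2))).add
    ((hf.py.hasDerivAt_surface hη).mul hη.pt.pt.hasDerivAt_t)).congr_deriv ?_
  simp only [surf1, surf3, hf.pt_py, hf.pt.pt_py, hf.pt_py_py, Pi.pow_apply]
  push_cast
  ring

end surface

section branch

variable {a d : ℝ} {ψ : ℝ → ℝ → ℝ → ℝ} {η : ℝ → ℝ → ℝ} {lam : ℝ → ℝ}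

namespace IsStokesBranch

lemma eventually_lift2 (B : IsStokesBranch a d ψ η lam) (x : ℝ) :
    ∀ᶠ t in 𝓝 0, An (lift2 η) t x 0 := (an_lift2 (B.analytic_surface x) 0).eventually_t

lemma eventually_an_surface (B : IsStokesBranch a d ψ η lam) (hd : 0 < d) (x : ℝ) :
    ∀ᶠ t in 𝓝 0, An ψ t x (η t x) :=
  An.eventually_surface (B.analytic_surface x) (B.an x (B.mem_top hd x))

lemma eventually_surface (B : IsStokesBranch a d ψ η lam) (hd : 0 < d) (x : ℝ) :
    ∀ᶠ t in 𝓝 0, surf1 η ψ x t = 0 ∧ surf2 η ψ x t = 0 ∧ surf3 η ψ x t = 0 := by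
  have hA := B.eventually_an_surface hd x
  have hE := B.eventually_lift2 x
  have h0 : ∀ᶠ t in 𝓝 0, ψ t x (η t x) - 1 = 0 := by
    refine eventually_zero_of_nhdsGE (F := fun t => ψ t x (η t x) - 1) ?_
      (B.wave.mono fun t ht => by rw [ht.surface, sub_self])
    exact (((B.an x (B.mem_top hd x)).surface (B.analytic_surface x) 0).analyticAt_t).sub
      analyticAt_const
  have h1 := eventually_deriv_eq_zero h0
    ((hE.and hA).mono fun t ht => (ht.2.hasDerivAt_surface ht.1).sub_const 1)
  have h2 := eventually_deriv_eq_zero h1 ((hE.and hA).mono fun t ht => ht.2.hasDerivAt_surf1 ht.1)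
  have h3 := eventually_deriv_eq_zero h2 ((hE.and hA).mono fun t ht => ht.2.hasDerivAt_surf2 ht.1)
  filter_upwards [h1, h2, h3] with t a1 a2 a3 using ⟨a1, a2, a3⟩

lemma eventually_dynamic (B : IsStokesBranch a d ψ η lam) (hd : 0 < d) (x : ℝ) :
    ∀ᶠ t in 𝓝 0, (1 / 2) * (py ψ t x (η t x) ^ 2 + lam t ^ 2 * px ψ t x (η t x) ^ 2) + η t x
      - bernoulli a d = 0 := by
  have hA := B.an x (B.mem_top hd x)
  refine eventually_zero_of_nhdsGE ?_ (B.wave.mono fun t ht => sub_eq_zero.mpr (ht.dynamic x))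
  have h1 := (hA.py.surface (B.analytic_surface x) 0).analyticAt_t
  have h2 := (hA.px.surface (B.analytic_surface x) 0).analyticAt_t
  have h3 := (an_lift2 (B.analytic_surface x) 0).analyticAt_t
  exact ((analyticAt_const.mul ((h1.pow 2).add ((B.analytic_lam.pow 2).mul (h2.pow 2)))).add
    h3).sub analyticAt_const

/-- The second and third `t`-derivatives of the Bernoulli equation at `t = 0`. -/
lemma dynamic_zero (B : IsStokesBranch a d ψ η lam) (hd : 0 < d) (x : ℝ) :
    surf1 η (py ψ) x 0 ^ 2 + py ψ 0 x d * surf2 η (py ψ) x 0 + surf1 η (px ψ) x 0 ^ 2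
        + pt (pt (lift2 η)) 0 x 0 = 0 ∧
      3 * (surf1 η (py ψ) x 0 * surf2 η (py ψ) x 0) + py ψ 0 x d * surf3 η (py ψ) x 0
        + 3 * (surf1 η (px ψ) x 0 * surf2 η (px ψ) x 0) + pt (pt (pt (lift2 η))) 0 x 0 = 0 := by
  have hA := B.eventually_an_surface hd x
  have hE := B.eventually_lift2 x
  have hL := B.analytic_lam.eventually_analyticAt
  have h0 := B.eventually_dynamic hd x
  have h1 := eventually_deriv_eq_zero h0 (F' := fun t =>
      py ψ t x (η t x) * surf1 η (py ψ) x t + (lam t * deriv lam t * px ψ t x (η t x) ^ 2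
        + lam t ^ 2 * (px ψ t x (η t x) * surf1 η (px ψ) x t)) + pt (lift2 η) t x 0) <| by
    filter_upwards [hA, hE, hL] with t h1 h2 h3
    refine (((((h1.py.hasDerivAt_surface h2).pow 2).add
      ((h3.differentiableAt.hasDerivAt.pow 2).mul
        ((h1.px.hasDerivAt_surface h2).pow 2))).const_mul (1 / 2)).add
        h2.hasDerivAt_t |>.sub_const _).congr_deriv ?_
    simp only [Pi.pow_apply]
    push_cast
    ring
  have h2 := eventually_deriv_eq_zero h1 (F' := fun t =>
      surf1 η (py ψ) x t ^ 2 + py ψ t x (η t x) * surf2 η (py ψ) x t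
        + ((deriv lam t ^ 2 + lam t * deriv (deriv lam) t) * px ψ t x (η t x) ^ 2
          + 4 * (lam t * deriv lam t * (px ψ t x (η t x) * surf1 η (px ψ) x t))
          + lam t ^ 2 * (surf1 η (px ψ) x t ^ 2 + px ψ t x (η t x) * surf2 η (px ψ) x t))
        + pt (pt (lift2 η)) t x 0) <| by
    filter_upwards [hA, hE, hL] with t h1 h2 h3
    have l1 := h3.differentiableAt.hasDerivAt
    have l2 := h3.deriv.differentiableAt.hasDerivAt
    have y1 := h1.py.hasDerivAt_surface h2
    have x1 := h1.px.hasDerivAt_surface h2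
    refine (((y1.mul (h1.py.hasDerivAt_surf1 h2)).add
      (((l1.mul l2).mul (x1.pow 2)).add
        ((l1.pow 2).mul (x1.mul (h1.px.hasDerivAt_surf1 h2))))).add
        h2.pt.hasDerivAt_t).congr_deriv ?_
    simp only [Pi.pow_apply, Pi.mul_apply]
    push_cast
    ring
  have h2' := h2.self_of_nhds
  have hx0 : px ψ 0 x d = 0 := B.px_zero x ⟨hd.le, le_rfl⟩
  simp only [B.surface_zero, B.lam_zero, B.lam_one, hx0] at h2'
  refine ⟨by linear_combination h2', ?_⟩
  -- The last derivative is needed at `t = 0` alone, where `λ'` and `ψ_x` vanish and remove `λ''`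
  -- and `λ'''`. So `λ''(0)` enters the third-order problem only through the interior equation.
  have h3 := (hasDerivAt_const (0 : ℝ) (0 : ℝ)).congr_of_eventuallyEq h2
  have a1 := hA.self_of_nhds
  have a2 := hE.self_of_nhds
  have a3 := B.analytic_lam
  have l1 := a3.differentiableAt.hasDerivAt
  have l2 := a3.deriv.differentiableAt.hasDerivAt
  have l3 := a3.deriv.deriv.differentiableAt.hasDerivAt
  have y0 := a1.py.hasDerivAt_surface a2
  have y1 := a1.py.hasDerivAt_surf1 a2
  have y2 := a1.py.hasDerivAt_surf2 a2
  have x0 := a1.px.hasDerivAt_surface a2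
  have x1 := a1.px.hasDerivAt_surf1 a2
  have x2 := a1.px.hasDerivAt_surf2 a2
  have h4 := ((((y1.pow 2).add (y0.mul y2)).add
    (((((l2.pow 2).add (l1.mul l3)).mul (x0.pow 2)).add
      (((l1.mul l2).mul (x0.mul x1)).const_mul 4)).add
      ((l1.pow 2).mul ((x1.pow 2).add (x0.mul x2))))).add a2.pt.pt.hasDerivAt_t)
  have h5 := h4.unique h3
  simp only [Pi.pow_apply, Pi.mul_apply, Pi.add_apply, B.surface_zero, B.lam_zero, B.lam_one,
    hx0] at h5
  push_cast at h5
  linear_combination h5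

end IsStokesBranch

end branch

lemma analyticAt_gam (d τ y : ℝ) : AnalyticAt ℝ (gam d τ) y := by
  by_cases hτ : τ = 0
  · have e : gam d τ = fun y => y / d := by funext y; simp [gam, hτ]
    rw [e]; fun_prop
  · have e : gam d τ = fun y => Real.sinh (τ * y) / Real.sinh (τ * d) := by
      funext y; simp [gam, hτ]
    rw [e]
    exact (Real.analyticAt_sinh.fun_comp (analyticAt_const.mul analyticAt_id)).div_const

section branch

variable {a d : ℝ} {ψ : ℝ → ℝ → ℝ → ℝ} {η : ℝ → ℝ → ℝ} {lam : ℝ → ℝ}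

namespace IsStokesBranch

/-- The `t`-derivatives of the interior equation at `t = 0`. -/
lemma vorticity_zero (B : IsStokesBranch a d ψ η lam) (x : ℝ) {y : ℝ} (hy : y ∈ Ioo 0 d) :
    px (px (pt (pt ψ))) 0 x y + py (py (pt (pt ψ))) 0 x y = 0 ∧
      px (px (pt (pt (pt ψ)))) 0 x y + py (py (pt (pt (pt ψ)))) 0 x y
        = -(6 * deriv (deriv lam) 0 * px (px (pt ψ)) 0 x y) := by
  have hy' := Ioo_subset_Icc_self hy
  have hA := B.an x hy'
  have hev : ∀ᶠ s in 𝓝 0, y ∈ Ioo 0 (η s x) := by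
    have hc := (an_lift2 (B.analytic_surface x) 0).hasDerivAt_t.continuousAt
    filter_upwards [hc.eventually_const_lt (show y < η 0 x by rw [B.surface_zero]; exact hy.2)]
      with s hs using ⟨hy.1, hs⟩
  have h0 : ∀ᶠ t in 𝓝 0, lam t ^ 2 * px (px ψ) t x y + py (py ψ) t x y + a = 0 := by
    refine eventually_zero_of_nhdsGE ?_ ((B.wave.and (nhdsWithin_le_nhds hev)).mono
      fun t ht => ht.1.vorticity x y ht.2)
    exact (((B.analytic_lam.pow 2).mul hA.px.px.analyticAt_t).add hA.py.py.analyticAt_t).add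
      analyticAt_const
  have hL := B.analytic_lam.eventually_analyticAt
  have h1 := eventually_deriv_eq_zero h0 (F' := fun t => 2 * (lam t * deriv lam t * px (px ψ) t x y)
      + lam t ^ 2 * px (px (pt ψ)) t x y + py (py (pt ψ)) t x y) <| by
    filter_upwards [hA.eventually_t, hL] with t h1 h2
    refine ((((h2.differentiableAt.hasDerivAt.pow 2).mul h1.px.px.hasDerivAt_t).add
      h1.py.py.hasDerivAt_t).add_const a).congr_deriv ?_
    simp only [h1.pt_px_px, h1.pt_py_py, Pi.pow_apply]
    push_cast
    ring
  have h2 := eventually_deriv_eq_zero h1 (F' := fun t =>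
      2 * ((deriv lam t ^ 2 + lam t * deriv (deriv lam) t) * px (px ψ) t x y)
      + 4 * (lam t * deriv lam t * px (px (pt ψ)) t x y)
      + lam t ^ 2 * px (px (pt (pt ψ))) t x y + py (py (pt (pt ψ))) t x y) <| by
    filter_upwards [hA.eventually_t, hL] with t h1 h2
    have l1 := h2.differentiableAt.hasDerivAt
    refine (((((l1.mul h2.deriv.differentiableAt.hasDerivAt).mul
      h1.px.px.hasDerivAt_t).const_mul 2).add ((l1.pow 2).mul h1.pt.px.px.hasDerivAt_t)).add
      h1.pt.py.py.hasDerivAt_t).congr_deriv ?_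
    simp only [h1.pt_px_px, h1.pt.pt_px_px, h1.pt.pt_py_py, Pi.pow_apply, Pi.mul_apply]
    push_cast
    ring
  have h2' := h2.self_of_nhds
  have hx0 := B.px_px_zero x hy'
  simp only [hx0, B.lam_zero, B.lam_one] at h2'
  refine ⟨by linear_combination h2', ?_⟩
  have h3 := (hasDerivAt_const (0 : ℝ) (0 : ℝ)).congr_of_eventuallyEq h2
  have a3 := B.analytic_lam
  have l1 := a3.differentiableAt.hasDerivAt
  have l2 := a3.deriv.differentiableAt.hasDerivAt
  have l3 := a3.deriv.deriv.differentiableAt.hasDerivAt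
  have h4 := ((((((l2.pow 2).add (l1.mul l3)).mul hA.px.px.hasDerivAt_t).const_mul 2).add
    (((l1.mul l2).mul hA.pt.px.px.hasDerivAt_t).const_mul 4)).add
    ((l1.pow 2).mul hA.pt.pt.px.px.hasDerivAt_t)).add hA.pt.pt.py.py.hasDerivAt_t
  have h5 := h4.unique h3
  simp only [Pi.pow_apply, Pi.mul_apply, Pi.add_apply, B.lam_zero, B.lam_one, hx0,
    hA.pt_px_px, hA.pt.pt_px_px, hA.pt.pt.pt_px_px, hA.pt.pt.pt_py_py] at h5
  push_cast at h5
  linear_combination h5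

lemma stripFun_pt_pt (B : IsStokesBranch a d ψ η lam) (hd : 0 < d) :
    StripFun d (basePeriod a d) (pt (pt ψ) 0) ∧
      StripFun d (basePeriod a d) (pt (pt (pt ψ)) 0) := by
  have hper : ∀ x, ∀ y ∈ Icc 0 d,
      (fun t => ψ t (x + basePeriod a d) y) =ᶠ[𝓝 0] fun t => ψ t x y := fun x y hy =>
    (eventually_zero_of_nhdsGE
      ((B.an (x + basePeriod a d) hy).analyticAt_t.sub (B.an x hy).analyticAt_t)
      (B.wave.mono fun t ht => sub_eq_zero.mpr (ht.periodic_stream x y))).mono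
        fun t ht => sub_eq_zero.mp ht
  have hbot : ∀ x, (fun t => ψ t x 0) =ᶠ[𝓝 0] fun _ => 0 := fun x =>
    eventually_zero_of_nhdsGE (B.an x ⟨le_rfl, hd.le⟩).analyticAt_t
      (B.wave.mono fun t ht => ht.bottom x)
  constructor
  · exact ⟨fun x y hy => (B.an x hy).pt.pt.cd 2, fun x y hy => (hper x y hy).deriv.deriv_eq,
      fun x => ((hbot x).deriv.deriv_eq).trans (by simp)⟩
  · exact ⟨fun x y hy => (B.an x hy).pt.pt.pt.cd 2,
      fun x y hy => (hper x y hy).deriv.deriv.deriv_eq,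
      fun x => ((hbot x).deriv.deriv.deriv_eq).trans (by simp)⟩

/-! ### Values on the top of the strip at `t = 0` -/

lemma pt_stream_eventuallyEq (B : IsStokesBranch a d ψ η lam) (hd : 0 < d) (x : ℝ) :
    pt ψ 0 x =ᶠ[𝓝 d]
      fun y => -kappa a d * Real.cos (tauStar a d * x) * gam d (tauStar a d) y := by
  refine eventuallyEq_of_eqOn_Icc hd ⟨hd.le, le_rfl⟩ (B.an x ⟨hd.le, le_rfl⟩).pt.analyticAt_y ?_
    fun z hz => (B.pt_zero x hz).trans (by rw [sep]; ring)
  exact analyticAt_const.mul (analyticAt_gam d _ d)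

lemma px_eventuallyEq (B : IsStokesBranch a d ψ η lam) (hd : 0 < d) (x : ℝ) :
    px ψ 0 x =ᶠ[𝓝 d] fun _ => 0 :=
  eventuallyEq_of_eqOn_Icc hd ⟨hd.le, le_rfl⟩ (B.an x ⟨hd.le, le_rfl⟩).px.analyticAt_y
    analyticAt_const fun _ hz => B.px_zero x hz

lemma px_pt_eventuallyEq (B : IsStokesBranch a d ψ η lam) (hd : 0 < d) (x : ℝ) :
    px (pt ψ) 0 x =ᶠ[𝓝 d] fun y =>
      kappa a d * tauStar a d * Real.sin (tauStar a d * x) * gam d (tauStar a d) y := by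
  refine eventuallyEq_of_eqOn_Icc hd ⟨hd.le, le_rfl⟩ (B.an x ⟨hd.le, le_rfl⟩).pt.px.analyticAt_y ?_
    fun z hz => ?_
  · exact analyticAt_const.mul (analyticAt_gam d _ d)
  · have e : (fun s => pt ψ 0 s z)
        = fun s => sep (fun y => -kappa a d * gam d (tauStar a d) y) (tauStar a d) s z :=
      funext fun s => B.pt_zero s hz
    have e2 := dx_sep (fun y => -kappa a d * gam d (tauStar a d) y) (tauStar a d) x z
    rw [dx] at e2
    rw [px, e, e2]
    ring

/-- The data at `t = 0` are prescribed on `[0, d]` only; analyticity carries them across `y = d`,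
where the two-sided derivatives are then those of the explicit functions. -/
lemma top_values (B : IsStokesBranch a d ψ η lam) (hd : 0 < d) (x : ℝ) :
    py (py ψ) 0 x d = -a ∧ py (py (py ψ)) 0 x d = 0 ∧ py (py (py (py ψ))) 0 x d = 0 ∧
    py (pt ψ) 0 x d = -kappa a d * Real.cos (tauStar a d * x) * gamSlope d (tauStar a d) ∧
    py (py (pt ψ)) 0 x d = -kappa a d * Real.cos (tauStar a d * x) * tauStar a d ^ 2 ∧
    py (py (py (pt ψ))) 0 x d
      = -kappa a d * Real.cos (tauStar a d * x) * (tauStar a d ^ 2 * gamSlope d (tauStar a d)) ∧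
    py (px ψ) 0 x d = 0 ∧ py (py (px ψ)) 0 x d = 0 ∧
    px (pt ψ) 0 x d = kappa a d * tauStar a d * Real.sin (tauStar a d * x) ∧
    py (px (pt ψ)) 0 x d
      = kappa a d * tauStar a d * Real.sin (tauStar a d * x) * gamSlope d (tauStar a d) := by
  have h1 : py (py ψ) 0 x =ᶠ[𝓝 d] fun _ => -a :=
    (B.stream_eventuallyEq hd x ⟨hd.le, le_rfl⟩).deriv.deriv.trans
      (by rw [deriv_deriv_laminar])
  have h2 : py (py (py ψ)) 0 x =ᶠ[𝓝 d] fun _ => 0 := h1.deriv.trans (by simp)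
  have h3 : py (py (py (py ψ))) 0 x =ᶠ[𝓝 d] fun _ => 0 := h2.deriv.trans (by simp)
  have hg : ∀ c, deriv (fun y => c * gam d (tauStar a d) y)
      = fun y => c * gamD d (tauStar a d) y := fun c =>
    funext fun y => ((hasDerivAt_gam d _ y).const_mul c).deriv
  have hg' : ∀ c, deriv (fun y => c * gamD d (tauStar a d) y)
      = fun y => c * (tauStar a d ^ 2 * gam d (tauStar a d) y) := fun c =>
    funext fun y => ((hasDerivAt_gamD d _ y).const_mul c).deriv
  have hg'' : ∀ c, deriv (fun y => c * (tauStar a d ^ 2 * gam d (tauStar a d) y))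
      = fun y => c * (tauStar a d ^ 2 * gamD d (tauStar a d) y) := fun c =>
    funext fun y => (((hasDerivAt_gam d _ y).const_mul _).const_mul c).deriv
  have k0 := B.pt_stream_eventuallyEq hd x
  have k1 := k0.deriv
  rw [hg] at k1
  have k2 := k1.deriv
  rw [hg'] at k2
  have k3 := k2.deriv
  rw [hg''] at k3
  have m1 := (B.px_eventuallyEq hd x).deriv
  have m2 := m1.deriv
  have n0 := B.px_pt_eventuallyEq hd x
  have n1 := n0.deriv
  rw [hg] at n1
  refine ⟨h1.self_of_nhds, h2.self_of_nhds, h3.self_of_nhds, k1.self_of_nhds.trans ?_,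
    k2.self_of_nhds.trans ?_, k3.self_of_nhds.trans ?_, m1.self_of_nhds.trans ?_,
    m2.self_of_nhds.trans ?_, n0.self_of_nhds.trans ?_, n1.self_of_nhds.trans ?_⟩ <;>
  simp [gam_self hd, gamD_self]

/-- The harmonic second order term satisfies the equation up to the surface. -/
lemma laplace_pt_pt_top (B : IsStokesBranch a d ψ η lam) (hd : 0 < d) (x : ℝ) :
    py (py (pt (pt ψ))) 0 x d = -px (px (pt (pt ψ))) 0 x d := by
  have hA := (B.an x ⟨hd.le, le_rfl⟩).pt.pt
  have h : ∀ᶠ y in 𝓝 d, px (px (pt (pt ψ))) 0 x y + py (py (pt (pt ψ))) 0 x y = 0 := by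
    refine eventually_zero_of_nhdsLT (hA.px.px.analyticAt_y.add hA.py.py.analyticAt_y) ?_
    filter_upwards [Ioo_mem_nhdsLT hd] with y hy using (B.vorticity_zero x hy).1
  linarith [h.self_of_nhds]

end IsStokesBranch

end branch

lemma integral_const_mul_add {P : ℝ} {f g : ℝ → ℝ} (c : ℝ) (hf : Continuous f)
    (hg : Continuous g) :
    ∫ x in 0..P, (c * f x + g x) = c * (∫ x in 0..P, f x) + ∫ x in 0..P, g x := by
  rw [intervalIntegral.integral_add ((hf.const_mul c).intervalIntegrable _ _)
    (hg.intervalIntegrable _ _), intervalIntegral.integral_const_mul]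

lemma integral_deriv_eq_zero {P : ℝ} {f f' : ℝ → ℝ} (h : ∀ x, HasDerivAt f (f' x) x)
    (hf' : Continuous f') (hP : f P = f 0) : ∫ x in 0..P, f' x = 0 := by
  rw [intervalIntegral.integral_eq_sub_of_hasDerivAt (fun x _ => h x)
    (hf'.intervalIntegrable _ _), hP, sub_self]

lemma continuous_of_an {f : ℝ → ℝ → ℝ → ℝ} {t y : ℝ} (h : ∀ x, An f t x y) :
    Continuous fun x => f t x y :=
  continuous_iff_continuousAt.mpr fun x => (h x).hasDerivAt_x.continuousAt

section trig

variable {a d : ℝ}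

lemma integral_cos_nat_mul (hd : criticalDepth a < d) (hk : kappa a d ≠ 0) {n : ℕ} (hn : n ≠ 0) :
    ∫ x in 0..basePeriod a d, Real.cos (n * tauStar a d * x) = 0 := by
  have hω : n * tauStar a d ≠ 0 :=
    mul_ne_zero (Nat.cast_ne_zero.mpr hn) (tauStar_pos hd hk).ne'
  have h := integral_deriv_eq_zero (P := basePeriod a d) (hasDerivAt_sin_mul (n * tauStar a d))
    (by fun_prop) (by simp [sin_nat_mul_basePeriod hd hk])
  rw [intervalIntegral.integral_const_mul] at h
  exact (mul_eq_zero.mp h).resolve_left hω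

lemma cos_two_mul_mul (τ x : ℝ) : Real.cos (2 * τ * x) = 2 * Real.cos (τ * x) ^ 2 - 1 := by
  rw [mul_assoc, Real.cos_two_mul]

lemma cos_four_mul_mul (τ x : ℝ) :
    Real.cos (4 * τ * x) = 8 * Real.cos (τ * x) ^ 4 - 8 * Real.cos (τ * x) ^ 2 + 1 := by
  rw [show 4 * τ * x = 2 * (2 * τ * x) by ring, Real.cos_two_mul, cos_two_mul_mul]
  ring

end trig

/-! ### Boundary conditions of order two and three, and the value of `λ''(0)` -/

section branch

variable {a d : ℝ} {ψ : ℝ → ℝ → ℝ → ℝ} {η : ℝ → ℝ → ℝ} {lam : ℝ → ℝ}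

namespace IsStokesBranch

/-- The boundary condition of order two, with the surface elevation eliminated. -/
lemma second_order (B : IsStokesBranch a d ψ η lam) (hd : criticalDepth a < d)
    (hk : kappa a d ≠ 0) (x : ℝ) :
    pt (pt ψ) 0 x d - (2 * kappa a d * gamSlope d (tauStar a d) + a)
        * Real.cos (tauStar a d * x) ^ 2 + kappa a d * pt (pt (lift2 η)) 0 x 0 = 0 ∧
    kappa a d ^ 2 * (py (pt (pt ψ)) 0 x d - gamSlope d (tauStar a d) * pt (pt ψ) 0 x d)
      + (kappa a d * xi a d ^ 2 - 2 * kappa a d ^ 3 * tauStar a d ^ 2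
          + kappa a d ^ 2 * gamSlope d (tauStar a d)
            * (2 * kappa a d * gamSlope d (tauStar a d) + a)) * Real.cos (tauStar a d * x) ^ 2
      + kappa a d ^ 3 * tauStar a d ^ 2 * Real.sin (tauStar a d * x) ^ 2 = 0 := by
  have hd0 := pos_of_criticalDepth_lt hd
  have hA := B.an x (y := d) ⟨hd0.le, le_rfl⟩
  have h1 := one_sub_mul_kappa hd hk
  have hK := (B.eventually_surface hd0 x).self_of_nhds.2.1
  have hB := (B.dynamic_zero hd0 x).1
  obtain ⟨v1, v2, v3, v4, v5, v6, v7, v8, v9, v10⟩ := B.top_values hd0 x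
  simp only [surf1, surf2, B.surface_zero, B.pt_surface, B.py_zero_top hd0, hA.pt_py, hA.pt_px,
    hA.pt_pt_py, hA.py_pt_py, v1, v2, v4, v5, v7, v9] at hK hB
  have hK' : pt (pt ψ) 0 x d - (2 * kappa a d * gamSlope d (tauStar a d) + a)
      * Real.cos (tauStar a d * x) ^ 2 + kappa a d * pt (pt (lift2 η)) 0 x 0 = 0 := by
    linear_combination hK
  refine ⟨hK', ?_⟩
  rw [xi]
  -- The kinematic condition and the dispersion relation `1 - a κ = κ ^ 2 G` cancel `η_tt`; the
  -- third-order condition is treated in the same way.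
  linear_combination kappa a d * hB - kappa a d ^ 2 * gamSlope d (tauStar a d) * hK'
    - kappa a d * pt (pt (lift2 η)) 0 x 0 * h1

/-- The boundary condition of order three, with the surface elevation eliminated. -/
lemma third_order (B : IsStokesBranch a d ψ η lam) (hd : criticalDepth a < d)
    (hk : kappa a d ≠ 0) (x : ℝ) :
    kappa a d ^ 2 * (py (pt (pt (pt ψ))) 0 x d
        - gamSlope d (tauStar a d) * pt (pt (pt ψ)) 0 x d)
      - 3 * kappa a d ^ 2 * (px (px (pt (pt ψ))) 0 x d * Real.cos (tauStar a d * x))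
      + 3 * kappa a d ^ 2 * tauStar a d
        * (px (pt (pt ψ)) 0 x d * Real.sin (tauStar a d * x))
      + 3 * (kappa a d * xi a d - kappa a d ^ 2 * gamSlope d (tauStar a d))
        * (py (pt (pt ψ)) 0 x d * Real.cos (tauStar a d * x))
      + 3 * (kappa a d ^ 2 * tauStar a d ^ 2 - xi a d ^ 2)
        * (pt (pt ψ) 0 x d * Real.cos (tauStar a d * x))
      - (6 * kappa a d ^ 2 * tauStar a d ^ 2 * xi a d
          + 3 * (kappa a d ^ 2 * tauStar a d ^ 2 - xi a d ^ 2)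
            * (2 * kappa a d * gamSlope d (tauStar a d) + a)) * Real.cos (tauStar a d * x) ^ 3
      + 6 * kappa a d ^ 3 * gamSlope d (tauStar a d) * tauStar a d ^ 2
        * (Real.sin (tauStar a d * x) ^ 2 * Real.cos (tauStar a d * x)) = 0 := by
  have hd0 := pos_of_criticalDepth_lt hd
  have hA := B.an x (y := d) ⟨hd0.le, le_rfl⟩
  have h1 := one_sub_mul_kappa hd hk
  have hK := (B.eventually_surface hd0 x).self_of_nhds.2.2
  have hB := (B.dynamic_zero hd0 x).2
  have h2 := (B.second_order hd hk x).1
  obtain ⟨v1, v2, v3, v4, v5, v6, v7, v8, v9, v10⟩ := B.top_values hd0 x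
  simp only [surf1, surf2, surf3, B.surface_zero, B.pt_surface, B.py_zero_top hd0, hA.pt_py,
    hA.pt_px, hA.pt_pt_py, hA.pt_pt_px, hA.py_pt_py, hA.py_pt_px, hA.pt_pt_pt_py, hA.py_pt_pt_py,
    hA.py_py_pt_py, B.laplace_pt_pt_top hd0, v1, v2, v3, v4, v5, v6, v7, v8, v9, v10] at hK hB
  rw [xi]
  generalize gamSlope d (tauStar a d) = G at *
  generalize kappa a d = κ at *
  generalize tauStar a d = τ at *
  generalize Real.cos (τ * x) = C at *
  generalize pt (pt (lift2 η)) 0 x 0 = h at *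
  generalize pt (pt (pt (lift2 η))) 0 x 0 = h' at *
  linear_combination κ * hB - κ ^ 2 * G * hK - κ * h' * h1
    + 3 * C * (κ ^ 2 * τ ^ 2 - (a + κ * G) ^ 2) * h2

end IsStokesBranch

/-- The Dirichlet-to-Neumann operator of the strip acts on the mode `cos ωx` as multiplication by
`γ'(d; ω)`. -/
lemma StripFun.harmonic_mode {P : ℝ} {u : ℝ → ℝ → ℝ} (h : StripFun d P u) (hd : 0 < d)
    (hP : 0 ≤ P) {ω : ℝ} (hs : Real.sin (ω * P) = 0) (hc : Real.cos (ω * P) = 1)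
    (hu : ∀ x, ∀ y ∈ Ioo 0 d, dx (dx u) x y + dy (dy u) x y = 0) :
    ∫ x in 0..P, Real.cos (ω * x) * dy u x d
      = gamSlope d ω * ∫ x in 0..P, Real.cos (ω * x) * u x d := by
  have key := h.green_gam hd hP hs hc
  rw [setIntegral_congr_fun (g := fun _ => (0 : ℝ)) (measurableSet_rect _), integral_zero] at key
  · have h1 := (intervalIntegrable_top hd.le h).1
    have h2 := (intervalIntegrable_top hd.le h).2
    have e : ∀ x, Real.cos (ω * x) * (dy u x d - gamSlope d ω * u x d)
        = -gamSlope d ω * (Real.cos (ω * x) * u x d) + Real.cos (ω * x) * dy u x d :=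
      fun x => by ring
    simp only [e] at key
    rw [integral_const_mul_add _ (by fun_prop) (by fun_prop)] at key
    linarith
  · intro p hp
    simp only [hu p.1 (p.2 * d) ⟨mul_pos hp.2.1 hd, mul_lt_of_lt_one_left hd hp.2.2⟩, mul_zero]

namespace IsStokesBranch

/-- The first mode of the third order term of the stream function. -/
lemma third_mode (B : IsStokesBranch a d ψ η lam) (hd : criticalDepth a < d)
    (hk : kappa a d ≠ 0) :
    ∫ x in 0..basePeriod a d, Real.cos (tauStar a d * x) * (py (pt (pt (pt ψ))) 0 x d
        - gamSlope d (tauStar a d) * pt (pt (pt ψ)) 0 x d)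
      = -(3 / 2 * basePeriod a d * kappa a d * deriv (deriv lam) 0 *
        (gamSlope d (tauStar a d) + d * tauStar a d ^ 2 - d * gamSlope d (tauStar a d) ^ 2)) := by
  have hd0 := pos_of_criticalDepth_lt hd
  have hP := basePeriod_pos hd hk
  have ht := (tauStar_pos hd hk).ne'
  have hs : Real.sin (tauStar a d * basePeriod a d) = 0 := by
    simpa using sin_nat_mul_basePeriod hd hk 1
  have hc : Real.cos (tauStar a d * basePeriod a d) = 1 := by
    simpa using cos_nat_mul_basePeriod hd hk 1
  have key := (B.stripFun_pt_pt hd0).2.green_gam hd0 hP.le hs hc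
  refine key.trans ?_
  have e1 := dy_sep (hasDerivAt_gam d (tauStar a d)) (tauStar a d)
  have e2 := dy_sep (hasDerivAt_gamD d (tauStar a d)) (tauStar a d)
  -- The Laplacian of `ψ_ttt` is a multiple of `γ cos τ_* x`, so its pairing with the same function
  -- is the square integral of a harmonic function, given by `green_gam_weight`.
  have hS : StripFun d (basePeriod a d) (sep (gam d (tauStar a d)) (tauStar a d)) :=
    ⟨fun x y _ => cd_sep (contDiff_gam d _ 2) _ x y,
      fun x y _ => by
        have := Real.cos_add (tauStar a d * x) (tauStar a d * basePeriod a d)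
        rw [sep, sep, mul_add, this, hs, hc]
        ring,
      fun x => by rw [sep, gam_zero_right, zero_mul]⟩
  have hw := hS.green_gam_weight hd0 hP.le hs hc fun x y _ => by
    rw [dx_dx_sep, e1, e2, sep]
    ring
  have hcos : ∫ x in 0..basePeriod a d, Real.cos (tauStar a d * x) ^ 2 = basePeriod a d / 2 := by
    have e : ∀ x, Real.cos (tauStar a d * x) ^ 2
        = 1 / 2 * Real.cos ((2 : ℕ) * tauStar a d * x) + 1 / 2 := fun x => by
      rw [Nat.cast_ofNat, cos_two_mul_mul]; ring
    simp only [e]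
    rw [integral_const_mul_add _ (by fun_prop) (by fun_prop),
      integral_cos_nat_mul hd hk two_ne_zero, intervalIntegral.integral_const, smul_eq_mul]
    ring
  have e3 : ∫ x in 0..basePeriod a d, Real.cos (tauStar a d * x)
        * ((gamSlope d (tauStar a d) + d * tauStar a d ^ 2)
            * sep (gam d (tauStar a d)) (tauStar a d) x d
          - d * gamSlope d (tauStar a d) * dy (sep (gam d (tauStar a d)) (tauStar a d)) x d)
      = (gamSlope d (tauStar a d) + d * tauStar a d ^ 2 - d * gamSlope d (tauStar a d) ^ 2)
        * (basePeriod a d / 2) := by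
    rw [← hcos, ← intervalIntegral.integral_const_mul]
    refine intervalIntegral.integral_congr fun x _ => ?_
    simp only [e1, sep, gam_self hd0, gamD_self]
    ring
  rw [e3] at hw
  have e4 : ∫ p in rect (basePeriod a d), d * (gam d (tauStar a d) (p.2 * d)
        * Real.cos (tauStar a d * p.1)
        * (dx (dx (pt (pt (pt ψ)) 0)) p.1 (p.2 * d) + dy (dy (pt (pt (pt ψ)) 0)) p.1 (p.2 * d)))
      = -(6 * deriv (deriv lam) 0 * kappa a d * tauStar a d ^ 2)
        * ∫ p in rect (basePeriod a d), d * (sep (gam d (tauStar a d)) (tauStar a d) p.1 (p.2 * d)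
          * (gam d (tauStar a d) (p.2 * d) * Real.cos (tauStar a d * p.1))) := by
    rw [← integral_const_mul]
    refine setIntegral_congr_fun (measurableSet_rect _) fun p hp => ?_
    have hy : p.2 * d ∈ Ioo 0 d := ⟨mul_pos hp.2.1 hd0, mul_lt_of_lt_one_left hd0 hp.2.2⟩
    have h1 := (B.vorticity_zero p.1 hy).2
    rw [B.px_px_pt_zero p.1 (Ioo_subset_Icc_self hy)] at h1
    change dx (dx (pt (pt (pt ψ)) 0)) p.1 (p.2 * d) + dy (dy (pt (pt (pt ψ)) 0)) p.1 (p.2 * d)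
      = _ at h1
    simp only [h1, sep]
    ring
  rw [e4]
  linear_combination -(3 * deriv (deriv lam) 0 * kappa a d) * hw

/-- The modes of the second order term of the stream function. -/
lemma second_modes (B : IsStokesBranch a d ψ η lam) (hd : criticalDepth a < d)
    (hk : kappa a d ≠ 0) :
    ∫ x in 0..basePeriod a d, pt (pt ψ) 0 x d = 2 * c1 a d * d * basePeriod a d ∧
      ∫ x in 0..basePeriod a d, py (pt (pt ψ)) 0 x d = 2 * c1 a d * basePeriod a d ∧
      ∫ x in 0..basePeriod a d, Real.cos (2 * tauStar a d * x) * pt (pt ψ) 0 x d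
        = d1 a d * basePeriod a d ∧
      ∫ x in 0..basePeriod a d, Real.cos (2 * tauStar a d * x) * py (pt (pt ψ)) 0 x d
        = gamSlope d (2 * tauStar a d) * d1 a d * basePeriod a d := by
  have hd0 := pos_of_criticalDepth_lt hd
  have hP := basePeriod_pos hd hk
  have hS := (B.stripFun_pt_pt hd0).1
  have hH : ∀ x, ∀ y ∈ Ioo 0 d,
      dx (dx (pt (pt ψ) 0)) x y + dy (dy (pt (pt ψ) 0)) x y = 0 := fun x y hy =>
    (B.vorticity_zero x hy).1
  have hs2 : Real.sin (2 * tauStar a d * basePeriod a d) = 0 := by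
    simpa using sin_nat_mul_basePeriod hd hk 2
  have hc2 : Real.cos (2 * tauStar a d * basePeriod a d) = 1 := by
    simpa using cos_nat_mul_basePeriod hd hk 2
  have m0 := hS.harmonic_mode hd0 hP.le (ω := 0) (by simp) (by simp) hH
  have m2 := hS.harmonic_mode hd0 hP.le hs2 hc2 hH
  simp only [zero_mul, Real.cos_zero, one_mul, gamSlope_zero] at m0
  change ∫ x in 0..basePeriod a d, py (pt (pt ψ)) 0 x d = _ at m0
  change ∫ x in 0..basePeriod a d, Real.cos (2 * tauStar a d * x) * py (pt (pt ψ)) 0 x d = _ at m2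
  have i2 : ∫ x in 0..basePeriod a d, Real.cos (2 * tauStar a d * x) = 0 := by
    simpa using integral_cos_nat_mul hd hk (two_ne_zero)
  have i4 : ∫ x in 0..basePeriod a d, Real.cos (4 * tauStar a d * x) = 0 := by
    simpa using integral_cos_nat_mul hd hk (four_ne_zero)
  have hc : Continuous fun x => pt (pt ψ) 0 x d :=
    continuous_of_an fun x => (B.an x ⟨hd0.le, le_rfl⟩).pt.pt
  have hcy : Continuous fun x => py (pt (pt ψ)) 0 x d :=
    continuous_of_an fun x => (B.an x ⟨hd0.le, le_rfl⟩).pt.pt.py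
  set F := ∫ x in 0..basePeriod a d, pt (pt ψ) 0 x d with hF
  set F2 := ∫ x in 0..basePeriod a d, Real.cos (2 * tauStar a d * x) * pt (pt ψ) 0 x d with hF2
  set α := kappa a d * xi a d ^ 2 - 2 * kappa a d ^ 3 * tauStar a d ^ 2
          + kappa a d ^ 2 * gamSlope d (tauStar a d)
            * (2 * kappa a d * gamSlope d (tauStar a d) + a) with hα
  set β := kappa a d ^ 3 * tauStar a d ^ 2 with hβ
  -- The forcing contains only the modes `0` and `2`. Integration against `1` and `cos 2τ_* x`, with
  -- `ψ_tt` harmonic, gives one scalar equation for each mode, solvable since `σ(0)` and `σ(2τ_*)`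
  -- are nonzero. The factors 2 below reflect that `ψ_tt` is twice the Taylor coefficient.
  have h0 : ∀ x, kappa a d ^ 2 * py (pt (pt ψ)) 0 x d
      + (-(kappa a d ^ 2 * gamSlope d (tauStar a d)) * pt (pt ψ) 0 x d
        + ((α - β) / 2 * Real.cos (2 * tauStar a d * x) + (α + β) / 2)) = 0 := fun x => by
    have h1 := (B.second_order hd hk x).2
    have h2 := Real.sin_sq_add_cos_sq (tauStar a d * x)
    rw [cos_two_mul_mul]
    linear_combination h1 - β * h2
  have h2 : ∀ x, kappa a d ^ 2 * (Real.cos (2 * tauStar a d * x) * py (pt (pt ψ)) 0 x d)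
      + (-(kappa a d ^ 2 * gamSlope d (tauStar a d))
          * (Real.cos (2 * tauStar a d * x) * pt (pt ψ) 0 x d)
        + ((α + β) / 2 * Real.cos (2 * tauStar a d * x)
          + ((α - β) / 4 * Real.cos (4 * tauStar a d * x) + (α - β) / 4))) = 0 := fun x => by
    have h1 := h0 x
    rw [cos_four_mul_mul]
    rw [cos_two_mul_mul] at h1 ⊢
    linear_combination (2 * Real.cos (tauStar a d * x) ^ 2 - 1) * h1
  have k0 : ∫ x in 0..basePeriod a d, (0 : ℝ) = 0 := intervalIntegral.integral_zero
  have k2 := k0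
  rw [← intervalIntegral.integral_congr fun x _ => h0 x,
    integral_const_mul_add _ (by fun_prop) (by fun_prop),
    integral_const_mul_add _ (by fun_prop) (by fun_prop),
    integral_const_mul_add _ (by fun_prop) (by fun_prop), intervalIntegral.integral_const, i2, m0,
    smul_eq_mul, ← hF] at k0
  rw [← intervalIntegral.integral_congr fun x _ => h2 x,
    integral_const_mul_add _ (by fun_prop) (by fun_prop),
    integral_const_mul_add _ (by fun_prop) (by fun_prop),
    integral_const_mul_add _ (by fun_prop) (by fun_prop),
    integral_const_mul_add _ (by fun_prop) (by fun_prop),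
    intervalIntegral.integral_const, i2, i4, m2, smul_eq_mul, ← hF2] at k2
  have hD0 : d * disp a d 0 ≠ 0 := mul_ne_zero hd0.ne' (disp_zero_neg hd).ne
  have hD2 : disp a d (2 * tauStar a d) ≠ 0 := by
    simpa using (disp_nat_pos hd hk (le_refl 2)).ne'
  have ec : c1 a d * (d * disp a d 0) = (1 - a * kappa a d) * coefA1 a d
      - kappa a d * (coefB1 a d + coefC1 a d) := div_mul_cancel₀ _ hD0
  have ed : d1 a d * disp a d (2 * tauStar a d) = (1 - a * kappa a d) * coefA1 a d
      - kappa a d * coefB1 a d := div_mul_cancel₀ _ hD2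
  have h1 := one_sub_mul_kappa hd hk
  have eD0 : d * disp a d 0 = kappa a d ^ 2 * (1 - d * gamSlope d (tauStar a d)) := by
    rw [disp, gamSlope_zero]
    field_simp
    linear_combination -d * h1
  have eD2 : disp a d (2 * tauStar a d)
      = kappa a d ^ 2 * (gamSlope d (2 * tauStar a d) - gamSlope d (tauStar a d)) := by
    rw [disp]
    linear_combination -h1
  rw [h1] at ec ed
  have r0 : F = 2 * c1 a d * d * basePeriod a d := by
    apply mul_left_cancel₀ hD0
    have k0' : kappa a d ^ 2 * F - d * (kappa a d ^ 2 * gamSlope d (tauStar a d)) * F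
        + d * (α + β) / 2 * basePeriod a d = 0 := by
      have := congrArg (d * ·) k0
      field_simp at this ⊢
      linear_combination this
    rw [coefA1, coefB1, coefC1] at ec
    rw [hα, hβ, xi] at k0'
    linear_combination k0' - 2 * d * basePeriod a d * ec + F * eD0
  have r2 : F2 = d1 a d * basePeriod a d := by
    apply mul_left_cancel₀ hD2
    rw [coefA1, coefB1] at ed
    rw [hα, hβ, xi] at k2
    linear_combination k2 - basePeriod a d * ed + F2 * eD2
  refine ⟨r0, ?_, r2, ?_⟩
  · rw [m0, r0]
    field_simp
  · rw [m2, r2]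
    ring

end IsStokesBranch

/-- The kinematic equations for the coefficients of order two. -/
lemma surface_coefs (hd : criticalDepth a < d) (hk : kappa a d ≠ 0) :
    kappa a d * a1 a d + d * c1 a d + coefA1 a d = 0 ∧
      kappa a d * b1 a d + d1 a d + coefA1 a d = 0 := by
  have hd0 := (pos_of_criticalDepth_lt hd).ne'
  have hD0 : d * disp a d 0 ≠ 0 := mul_ne_zero hd0 (disp_zero_neg hd).ne
  have hD2 : disp a d (2 * tauStar a d) ≠ 0 := by
    simpa using (disp_nat_pos hd hk (le_refl 2)).ne'
  have eD0 : d * disp a d 0 = kappa a d ^ 2 + d * (a * kappa a d) - d := by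
    rw [disp, gamSlope_zero]
    field_simp
  have ea : a1 a d * (d * disp a d 0) = _ := div_mul_cancel₀ _ hD0
  have ec : c1 a d * (d * disp a d 0) = _ := div_mul_cancel₀ _ hD0
  have eb : b1 a d * disp a d (2 * tauStar a d) = _ := div_mul_cancel₀ _ hD2
  have ed : d1 a d * disp a d (2 * tauStar a d) = _ := div_mul_cancel₀ _ hD2
  constructor
  · refine (mul_eq_zero.mp ?_).resolve_right hD0
    linear_combination kappa a d * ea + d * ec + coefA1 a d * eD0
  · refine (mul_eq_zero.mp ?_).resolve_right hD2
    have eD2 : disp a d (2 * tauStar a d)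
        = kappa a d ^ 2 * gamSlope d (2 * tauStar a d) + a * kappa a d - 1 := rfl
    linear_combination kappa a d * eb + ed + coefA1 a d * eD2

/-- The second derivative of the frequency along a Stokes branch. -/
lemma IsStokesBranch.deriv_deriv_lam (B : IsStokesBranch a d ψ η lam) (hd : criticalDepth a < d)
    (hk : kappa a d ≠ 0) :
    -deriv (deriv lam) 0 * (kappa a d ^ 2 * (gamSlope d (tauStar a d)
      + d * tauStar a d ^ 2 - d * gamSlope d (tauStar a d) ^ 2)) = mu2 a d := by
  have hd0 := pos_of_criticalDepth_lt hd
  have hP := basePeriod_pos hd hk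
  have hA : ∀ x, An ψ 0 x d := fun x => B.an x ⟨hd0.le, le_rfl⟩
  obtain ⟨f0, y0, f2, y2⟩ := B.second_modes hd hk
  have hK := B.third_mode hd hk
  have hper : ∀ {f : ℝ → ℝ → ℝ}, StripFun d (basePeriod a d) f →
      f (basePeriod a d) d = f 0 d ∧ dx f (basePeriod a d) d = dx f 0 d := fun {f} h => by
    have hm : d ∈ Icc 0 d := ⟨hd0.le, le_rfl⟩
    have h1 := h.periodic 0 d hm
    have h2 := h.dx_periodic 0 hm
    rw [zero_add] at h1 h2
    exact ⟨h1, h2⟩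
  obtain ⟨q1, q2⟩ := hper (B.stripFun_pt_pt hd0).1
  change px (pt (pt ψ)) 0 (basePeriod a d) d = px (pt (pt ψ)) 0 0 d at q2
  have hs : Real.sin (tauStar a d * basePeriod a d) = 0 := by
    simpa using sin_nat_mul_basePeriod hd hk 1
  have hc : Real.cos (tauStar a d * basePeriod a d) = 1 := by
    simpa using cos_nat_mul_basePeriod hd hk 1
  have i2 : ∫ x in 0..basePeriod a d, Real.cos (2 * tauStar a d * x) = 0 := by
    simpa using integral_cos_nat_mul hd hk (two_ne_zero)
  have i4 : ∫ x in 0..basePeriod a d, Real.cos (4 * tauStar a d * x) = 0 := by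
    simpa using integral_cos_nat_mul hd hk (four_ne_zero)
  have c0 : Continuous fun x => pt (pt ψ) 0 x d := continuous_of_an fun x => (hA x).pt.pt
  have cy : Continuous fun x => py (pt (pt ψ)) 0 x d := continuous_of_an fun x => (hA x).pt.pt.py
  have cx : Continuous fun x => px (pt (pt ψ)) 0 x d := continuous_of_an fun x => (hA x).pt.pt.px
  have cxx : Continuous fun x => px (px (pt (pt ψ))) 0 x d :=
    continuous_of_an fun x => (hA x).pt.pt.px.px
  have c3 : Continuous fun x => pt (pt (pt ψ)) 0 x d := continuous_of_an fun x => (hA x).pt.pt.pt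
  have c3y : Continuous fun x => py (pt (pt (pt ψ))) 0 x d :=
    continuous_of_an fun x => (hA x).pt.pt.pt.py
  set κ := kappa a d with hκ
  set τ := tauStar a d with hτ
  set G := gamSlope d τ with hG
  -- `g2` and `g3` are integrations by parts over a period that remove the `x`-derivatives of
  -- `ψ_tt`.
  have g2 : ∫ x in 0..basePeriod a d, (px (px (pt (pt ψ))) 0 x d * Real.cos (τ * x) ^ 2
      - 2 * τ * (px (pt (pt ψ)) 0 x d * (Real.sin (τ * x) * Real.cos (τ * x)))) = 0 := by
    refine integral_deriv_eq_zero (f := fun x => px (pt (pt ψ)) 0 x d * Real.cos (τ * x) ^ 2)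
      (fun x => ?_) (by fun_prop) (by simp [q2, hc])
    refine ((hA x).pt.pt.px.hasDerivAt_x.mul ((hasDerivAt_cos_mul τ x).pow 2)).congr_deriv ?_
    simp only [Pi.pow_apply]
    push_cast
    ring
  have g3 : ∫ x in 0..basePeriod a d, (px (pt (pt ψ)) 0 x d * (Real.sin (τ * x) * Real.cos (τ * x))
      + τ * (pt (pt ψ) 0 x d * (Real.cos (τ * x) ^ 2 - Real.sin (τ * x) ^ 2))) = 0 := by
    refine integral_deriv_eq_zero
      (f := fun x => pt (pt ψ) 0 x d * (Real.sin (τ * x) * Real.cos (τ * x)))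
      (fun x => ?_) (by fun_prop) (by simp [hs])
    refine ((hA x).pt.pt.hasDerivAt_x.mul
      ((hasDerivAt_sin_mul τ x).mul (hasDerivAt_cos_mul τ x))).congr_deriv ?_
    simp only [Pi.mul_apply]
    ring
  set E := -(6 * κ ^ 2 * τ ^ 2 * xi a d
    + 3 * (κ ^ 2 * τ ^ 2 - xi a d ^ 2) * (2 * κ * G + a)) with hE
  -- The third-order condition times `cos τx`, arranged into blocks whose integrals are known. Only
  -- the modes `0` and `2` of `ψ_tt` remain.
  have key : ∀ x, κ ^ 2 * (Real.cos (τ * x) * (py (pt (pt (pt ψ))) 0 x d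
        - G * pt (pt (pt ψ)) 0 x d))
      + (-(3 * κ ^ 2) * (px (px (pt (pt ψ))) 0 x d * Real.cos (τ * x) ^ 2
          - 2 * τ * (px (pt (pt ψ)) 0 x d * (Real.sin (τ * x) * Real.cos (τ * x))))
      + (-(3 * κ ^ 2 * τ) * (px (pt (pt ψ)) 0 x d * (Real.sin (τ * x) * Real.cos (τ * x))
          + τ * (pt (pt ψ) 0 x d * (Real.cos (τ * x) ^ 2 - Real.sin (τ * x) ^ 2)))
      + (3 / 2 * (κ * xi a d - κ ^ 2 * G) * py (pt (pt ψ)) 0 x d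
      + (3 / 2 * (κ * xi a d - κ ^ 2 * G) * (Real.cos (2 * τ * x) * py (pt (pt ψ)) 0 x d)
      + (3 / 2 * (κ ^ 2 * τ ^ 2 - xi a d ^ 2) * pt (pt ψ) 0 x d
      + ((3 / 2 * (κ ^ 2 * τ ^ 2 - xi a d ^ 2) + 3 * κ ^ 2 * τ ^ 2)
          * (Real.cos (2 * τ * x) * pt (pt ψ) 0 x d)
      + (E / 2 * Real.cos (2 * τ * x)
      + ((E - 6 * κ ^ 3 * G * τ ^ 2) / 8 * Real.cos (4 * τ * x)
      + (3 * E + 6 * κ ^ 3 * G * τ ^ 2) / 8)))))))) = 0 := fun x => by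
    have h1 := B.third_order hd hk x
    have h2 := Real.sin_sq_add_cos_sq (τ * x)
    rw [cos_two_mul_mul, cos_four_mul_mul]
    rw [← hκ, ← hτ, ← hG] at h1
    generalize Real.cos (τ * x) = C at *
    generalize Real.sin (τ * x) = S at *
    linear_combination C * h1 + (3 * κ ^ 2 * τ ^ 2 * pt (pt ψ) 0 x d
      - 6 * κ ^ 3 * G * τ ^ 2 * C ^ 2) * h2
  have k0 : ∫ x in 0..basePeriod a d, (0 : ℝ) = 0 := intervalIntegral.integral_zero
  rw [← intervalIntegral.integral_congr fun x _ => key x,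
    integral_const_mul_add _ (by fun_prop) (by fun_prop),
    integral_const_mul_add _ (by fun_prop) (by fun_prop),
    integral_const_mul_add _ (by fun_prop) (by fun_prop),
    integral_const_mul_add _ (by fun_prop) (by fun_prop),
    integral_const_mul_add _ (by fun_prop) (by fun_prop),
    integral_const_mul_add _ (by fun_prop) (by fun_prop),
    integral_const_mul_add _ (by fun_prop) (by fun_prop),
    integral_const_mul_add _ (by fun_prop) (by fun_prop),
    integral_const_mul_add _ (by fun_prop) (by fun_prop),
    intervalIntegral.integral_const, hK, g2, g3, f0, y0, f2, y2, i2, i4, smul_eq_mul] at k0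
  obtain ⟨ea, eb⟩ := surface_coefs hd hk
  rw [mu2_eq_coefs hd hk, coefA2, coefC2, ← hκ, ← hτ, ← hG]
  rw [coefA1, ← hκ, ← hτ, ← hG] at ea eb
  have hP' : 3 / 2 * basePeriod a d * κ ≠ 0 := by
    have := hP.ne'
    positivity
  apply mul_left_cancel₀ hP'
  rw [hE, xi, ← hκ, ← hτ, ← hG] at k0
  rw [xi, ← hκ, ← hτ, ← hG]
  -- `mu2` contains `a1` and `b1`, whereas the integrated condition knows only `c1` and `d1`; the
  -- kinematic relations exchange them.
  linear_combination k0 - 3 * basePeriod a d * (κ ^ 2 * τ ^ 2 - (a + κ * G) ^ 2) * (ea + eb / 2)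

end branch

/-! ### Assembly of the five statements -/

/-- The expansion of the second eigenvalue along a Stokes branch. -/
lemma IsStokesBranch.isBigO_eigenvalue {a d : ℝ} {ψ : ℝ → ℝ → ℝ → ℝ} {η : ℝ → ℝ → ℝ}
    {lam : ℝ → ℝ} (B : IsStokesBranch a d ψ η lam) (hd : criticalDepth a < d)
    (hk : kappa a d ≠ 0) {μ : ℝ → ℝ} {v : ℝ → ℝ → ℝ → ℝ} (hμ : AnalyticAt ℝ μ 0)
    (hv : ∀ x, ∀ y ∈ Icc 0 d, An v 0 x y)
    (h : ∀ᶠ t in 𝓝[≥] (0 : ℝ),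
        IsSecondEigenvalue (basePeriod a d) (lam t) (ψ t) (η t) (μ t) ∧
        IsEigenfunction (basePeriod a d) (lam t) (ψ t) (η t) (μ t) (v t)) :
    (fun t => μ t - mu2 a d * t ^ 2) =O[𝓝[≥] (0 : ℝ)] fun t => t ^ 3 := by
  have hlim := B.tendsto_eigenvalue hd hk hv h
  rw [B.deriv_deriv_lam hd hk] at hlim
  exact isBigO_of_tendsto_div_sq hμ hlim

/-- The behaviour at infinite depth. -/
lemma exists_deep_coef : ∃ q m : ℝ, 0 < q ∧ q = 2 * Real.tanh q ∧
    (∀ q' : ℝ, 0 < q' → q' = 2 * Real.tanh q' → q' = q) ∧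
    m = (q ^ 6 - 11 * q ^ 4 + 28 * q ^ 2 - 16) / (8 * q ^ 2) ∧
    |m - (-0.4067)| < 0.00005 ∧ m < 0 ∧
    ∀ a : ℝ, a ≠ 0 →
      (fun d => mu2 a d - m * a ^ 2 * d⁻¹) =O[atTop] fun d : ℝ => (d ^ 2)⁻¹ := by
  obtain ⟨q, hq, hq2⟩ := deep_root
  have hq0 : 0 < q := by linarith [hq.1]
  have hb := deepCoef_bounds hq
  refine ⟨q, deepCoef (q ^ 2), hq0, (eq_two_tanh_iff hq0).mpr hq2, fun q' h0 h1 => ?_, ?_, hb, ?_,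
    fun a ha => deep_asymptotics ha hq0 hq2⟩
  · exact qcoth_strictMonoOn.injOn h0 hq0 (((eq_two_tanh_iff h0).mp h1).trans hq2.symm)
  · rw [deepCoef]
    ring
  · linarith [(abs_lt.mp hb).2]

end StokesWave

end

theorem mainTheorem2 :
    -- `mu2 a d` is the leading coefficient of the second eigenvalue along the Stokes branch
    (∀ a d : ℝ, criticalDepth a < d → kappa a d ≠ 0 →
      ∀ (ψ : ℝ → ℝ → ℝ → ℝ) (η : ℝ → ℝ → ℝ) (lam : ℝ → ℝ), IsStokesBranch a d ψ η lam →
      ∀ (μ : ℝ → ℝ) (v : ℝ → ℝ → ℝ → ℝ), AnalyticAt ℝ μ 0 →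
      (∀ x, ∀ y ∈ Icc 0 d, AnalyticAt ℝ (fun p : ℝ × ℝ × ℝ => v p.1 p.2.1 p.2.2) (0, x, y)) →
      (∀ᶠ t in 𝓝[≥] (0 : ℝ),
        IsSecondEigenvalue (basePeriod a d) (lam t) (ψ t) (η t) (μ t) ∧
        IsEigenfunction (basePeriod a d) (lam t) (ψ t) (η t) (μ t) (v t)) →
      (fun t => μ t - mu2 a d * t ^ 2) =O[𝓝[≥] (0 : ℝ)] fun t => t ^ 3) ∧
    -- behaviour at the critical depth
    (∀ a : ℝ,
      (fun d => mu2 a d - 5 * (4 - criticalDepth a ^ 3) / (12 * criticalDepth a ^ 4)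
          * (d - criticalDepth a)⁻¹) =O[𝓝[>] criticalDepth a] (fun _ => (1 : ℝ)) ∧
      Tendsto (mu2 a) (𝓝[>] criticalDepth a) atTop) ∧
    -- behaviour at the stagnation depth
    (∀ a : ℝ, 0 < a →
      criticalDepth a < stagnationDepth a ∧
      (fun d => mu2 a d - -2 / a ^ 4 * ((d - stagnationDepth a) ^ 4)⁻¹)
        =O[𝓝[≠] stagnationDepth a] (fun d => ((d - stagnationDepth a) ^ 3)⁻¹) ∧
      Tendsto (mu2 a) (𝓝[≠] stagnationDepth a) atBot) ∧
    -- behaviour at infinite depth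
    (∃ q m : ℝ, 0 < q ∧ q = 2 * Real.tanh q ∧ (∀ q' : ℝ, 0 < q' → q' = 2 * Real.tanh q' → q' = q) ∧
      m = (q ^ 6 - 11 * q ^ 4 + 28 * q ^ 2 - 16) / (8 * q ^ 2) ∧
      |m - (-0.4067)| < 0.00005 ∧ m < 0 ∧
      ∀ a : ℝ, a ≠ 0 →
        (fun d => mu2 a d - m * a ^ 2 * d⁻¹) =O[atTop] fun d : ℝ => (d ^ 2)⁻¹) ∧
    -- existence of the root
    (∀ a : ℝ, ∃ d₀ : ℝ, criticalDepth a < d₀ ∧ kappa a d₀ ≠ 0 ∧ mu2 a d₀ = 0 ∧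
      (0 < a → d₀ < stagnationDepth a)) :=
  ⟨fun _ _ hd hk _ _ _ B _ _ hμ hv h => B.isBigO_eigenvalue hd hk hμ hv h, critical_behaviour,
    fun _ ha => ⟨criticalDepth_lt_stagnationDepth ha, stagnation_behaviour ha⟩, exists_deep_coef,
    exists_mu2_eq_zero⟩
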